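/- Let $N\ge 3$, $p\in[\tfrac12,2)$, and let $\Gamma$ be the star graph of $N$ half-lines $(0,\infty)$ glued at one vertex, $L^2(\Gamma)=\bigoplus_{j=1}^N L^2(0,\infty)$ (complex valued), $H^1_\Gamma=\{\Psi\in\bigoplus_{j=1}^N H^1(0,\infty):\psi_1(0)=\dots=\psi_N(0)\}$ with the $H^1$ norm $\|\Psi\|_{H^1}^2=\|\Psi'\|_{L^2(\Gamma)}^2+\|\Psi\|_{L^2(\Gamma)}^2$. Let $$\Lambda(\Psi)=\|\Psi'\|_{L^2(\Gamma)}^2-\|\Psi\|_{L^{2p+2}(\Gamma)}^{2p+2}+\|\Psi\|_{L^2(\Gamma)}^2,\qquad \Phi=\phi\,(1,\dots,1)^T,\quad \phi(x)=\operatorname{sech}^{1/p}(px),$$ let $L^2_c=\{V\in L^2(\Gamma):\langle V,\Phi\rangle=0\}$, and let $X_c$ be the set of all $V\in H^1_\Gamma\cap L^2_c$ with $\langle\Lambda''(\Phi)V,V\rangle=\frac{d^2}{dt^2}\Lambda(\Phi+tV)\big|_{t=0}=0$. Then $X_c$ is the real span of some family of $N-1$ nonzero, pairwise $L^2(\Gamma)$-orthogonal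 elements, and for every such family $U^{(1)},\dots,U^{(N-1)}$ there are $r,\delta,A>0$ with the following properties. (1) For every $c\in\mathbb R^{N-1}$ with $\|c\|\le\delta$, the functional $$U^\perp\mapsto \Lambda\Big(\Phi+\sum_{j=1}^{N-1}c_jU^{(j)}+U^\perp\Big)-\Lambda(\Phi)$$ has a unique minimizer on $\{U^\perp\in H^1_\Gamma\cap L^2_c\cap[X_c]^\perp:\|U^\perp\|_{H^1}\le r\}$, and this minimizer satisfies $\|U^\perp\|_{H^1}\le A\|c\|^2$. (2) The infimum $M(c)$ of this functional over the same set satisfies $M(c)=M_0(c)+o(\|c\|^3)$ as $c\to0$, where $$M_0(c)=-\tfrac23\,p(p+1)(2p+1)\sum_{i,j,k=1}^{N-1}c_ic_jc_k\,\langle\Phi^{2p-1}U^{(i)}U^{(j)},U^{(k)}\rangle_{L^2(\Gamma)}$$ is a cubic form that is not identically zero. (3) $M$ is sign-indefinite: in every neighbourhood of $c=0$ it takes both positive and negative values. Consequently $\Phi$ is a nonlinear saddle point of $\Lambda$ in $H^1_\Gamma$ with respect to perturbations in $H^1_\Gamma\cap L^2_c$: $\Phi$ is a critical point of $\Lambda$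 in $H^1_\Gamma$, the second variation is nonnegative on $H^1_\Gamma\cap L^2_c$, and for every $\varepsilon>0$ there are $V_\pm\in H^1_\Gamma\cap L^2_c$ with $\|V_\pm\|_{H^1}<\varepsilon$ and $\Lambda(\Phi+V_-)<\Lambda(\Phi)<\Lambda(\Phi+V_+)$. -/

import Mathlib

open scoped Topology InnerProductSpace

noncomputable section

namespace StarGraph

/-- Lebesgue measure on the half-line `(0, ∞)`, which parametrizes each edge. -/
abbrev halfLine : MeasureTheory.Measure ℝ := MeasureTheory.volume.restrict (Set.Ioi 0)

/-- `L²(Γ)`, the Hilbert sum of `N` copies of `L²(0, ∞)` (complex valued), with its norm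
`‖Ψ‖² = ∑ j, ‖ψ j‖²` and its complex inner product. -/
abbrev L2 (N : ℕ) : Type := PiLp 2 (fun _ : Fin N => MeasureTheory.Lp ℂ 2 halfLine)

/-- The energy space `H¹_Γ`, realised as the graph of the weak derivative: the pairs
`(Ψ, Ψ')` in `L²(Γ) × L²(Γ)` such that every component `ψ j` is (a.e. equal to) an absolutely
continuous function with derivative `ψ' j`, and all these functions have the same value `z` at
the vertex. The norm is the `H¹` norm `‖Ψ‖² + ‖Ψ'‖²` (square rooted). -/
def H1 (N : ℕ) : Submodule ℂ (WithLp 2 (L2 N × L2 N)) where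
  carrier := {V | ∃ z : ℂ, ∀ j : Fin N, ∀ᵐ x ∂halfLine,
    V.fst j x = z + ∫ t in (0 : ℝ)..x, V.snd j t}
  zero_mem' := by
    refine ⟨0, fun j => ?_⟩
    have h := MeasureTheory.Lp.coeFn_zero ℂ 2 halfLine
    filter_upwards [h, MeasureTheory.ae_restrict_mem measurableSet_Ioi] with x hx hx0
    have e : ∫ t in (0 : ℝ)..x, (0 : MeasureTheory.Lp ℂ 2 halfLine) t = 0 := by
      rw [intervalIntegral.integral_of_le (le_of_lt hx0)]
      refine MeasureTheory.integral_eq_zero_of_ae ?_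
      exact MeasureTheory.ae_restrict_of_ae_restrict_of_subset Set.Ioc_subset_Ioi_self h
    change (0 : MeasureTheory.Lp ℂ 2 halfLine) x
      = 0 + ∫ t in (0 : ℝ)..x, (0 : MeasureTheory.Lp ℂ 2 halfLine) t
    rw [e, hx]; simp
  add_mem' := by
    rintro V W ⟨z, hz⟩ ⟨w, hw⟩
    refine ⟨z + w, fun j => ?_⟩
    have h1 := MeasureTheory.Lp.coeFn_add (V.fst j) (W.fst j)
    have h2 := MeasureTheory.Lp.coeFn_add (V.snd j) (W.snd j)
    filter_upwards [h1, hz j, hw j, MeasureTheory.ae_restrict_mem measurableSet_Ioi]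
      with x hx hV hW hx0
    have hi : ∀ f : MeasureTheory.Lp ℂ 2 halfLine,
        IntervalIntegrable f MeasureTheory.volume 0 x := by
      intro f
      rw [intervalIntegrable_iff_integrableOn_Ioc_of_le (le_of_lt hx0)]
      have := (MeasureTheory.Lp.memLp f).restrict (Set.Ioc 0 x)
      rw [MeasureTheory.Measure.restrict_restrict measurableSet_Ioc,
        Set.inter_eq_left.2 Set.Ioc_subset_Ioi_self] at this
      exact this.integrable (by norm_num)
    have e : ∫ t in (0 : ℝ)..x, (V.snd j + W.snd j) t
        = (∫ t in (0 : ℝ)..x, V.snd j t) + ∫ t in (0 : ℝ)..x, W.snd j t := by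
      rw [← intervalIntegral.integral_add (hi _) (hi _)]
      rw [intervalIntegral.integral_of_le (le_of_lt hx0),
        intervalIntegral.integral_of_le (le_of_lt hx0)]
      refine MeasureTheory.integral_congr_ae ?_
      exact MeasureTheory.ae_restrict_of_ae_restrict_of_subset Set.Ioc_subset_Ioi_self h2
    change (V.fst j + W.fst j) x = z + w + ∫ t in (0 : ℝ)..x, (V.snd j + W.snd j) t
    rw [hx, e, Pi.add_apply, hV, hW]; ring
  smul_mem' := by
    rintro a V ⟨z, hz⟩
    refine ⟨a * z, fun j => ?_⟩
    have h1 := MeasureTheory.Lp.coeFn_smul a (V.fst j)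
    have h2 := MeasureTheory.Lp.coeFn_smul a (V.snd j)
    filter_upwards [h1, hz j, MeasureTheory.ae_restrict_mem measurableSet_Ioi] with x hx hV hx0
    have e : ∫ t in (0 : ℝ)..x, (a • V.snd j) t = a * ∫ t in (0 : ℝ)..x, V.snd j t := by
      rw [← intervalIntegral.integral_const_mul]
      rw [intervalIntegral.integral_of_le (le_of_lt hx0),
        intervalIntegral.integral_of_le (le_of_lt hx0)]
      refine MeasureTheory.integral_congr_ae ?_
      exact MeasureTheory.ae_restrict_of_ae_restrict_of_subset Set.Ioc_subset_Ioi_self h2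
    change (a • V.fst j) x = a * z + ∫ t in (0 : ℝ)..x, (a • V.snd j) t
    rw [hx, e, Pi.smul_apply, hV, smul_eq_mul]; ring

/-- The function `Ψ ∈ L²(Γ)` underlying an element of `H¹_Γ`. -/
def val {N : ℕ} (V : H1 N) : L2 N := (V : WithLp 2 (L2 N × L2 N)).fst

/-- The derivative `Ψ' ∈ L²(Γ)` of an element of `H¹_Γ`. -/
def der {N : ℕ} (V : H1 N) : L2 N := (V : WithLp 2 (L2 N × L2 N)).snd

/-- The energy `E(Ψ) = ‖Ψ'‖²_{L²(Γ)} - ‖Ψ‖_{L^{2p+2}(Γ)}^{2p+2}`. -/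
def energy {N : ℕ} (p : ℝ) (V : H1 N) : ℝ :=
  ‖der V‖ ^ 2 - ∑ j : Fin N, ∫ x in Set.Ioi (0 : ℝ), ‖val V j x‖ ^ (2 * p + 2)

/-- The mass `Q(Ψ) = ‖Ψ‖²_{L²(Γ)}`. -/
def mass {N : ℕ} (V : H1 N) : ℝ := ‖val V‖ ^ 2

/-- The action functional `Λ = E + Q`. -/
def action {N : ℕ} (p : ℝ) (V : H1 N) : ℝ := energy p V + mass V

/-- The soliton profile `φ(x) = sech^{1/p}(p x)`. -/
def phi (p x : ℝ) : ℝ := ((Real.cosh (p * x))⁻¹) ^ (1 / p)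

theorem hasDerivAt_phi {p : ℝ} (hp : 0 < p) (x : ℝ) :
    HasDerivAt (phi p) (-(phi p x * Real.tanh (p * x))) x := by
  have hc : 0 < Real.cosh (p * x) := Real.cosh_pos _
  have h1 : HasDerivAt (fun y : ℝ => Real.cosh (p * y)) (Real.sinh (p * x) * p) x := by
    have := ((hasDerivAt_id x).const_mul p).cosh
    simpa using this
  have h2 := (h1.inv hc.ne').rpow_const (p := 1 / p) (Or.inl (inv_pos.2 hc).ne')
  refine h2.congr_deriv ?_
  have h3 : (Real.cosh (p * x))⁻¹ ^ (1 / p - 1)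
      = (Real.cosh (p * x))⁻¹ ^ (1 / p) * Real.cosh (p * x) := by
    rw [Real.rpow_sub_one (inv_pos.2 hc).ne', div_inv_eq_mul]
  rw [Pi.inv_apply, h3, Real.tanh_eq_sinh_div_cosh, phi]
  field_simp

theorem phi_pos (p x : ℝ) : 0 < phi p x :=
  Real.rpow_pos_of_pos (inv_pos.2 (Real.cosh_pos _)) _

theorem phi_le {p : ℝ} (hp : 0 < p) (x : ℝ) :
    phi p x ≤ 2 ^ (1 / p) * Real.exp (-x) := by
  have h1 : (Real.cosh (p * x))⁻¹ ≤ 2 * Real.exp (-(p * x)) := by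
    rw [inv_le_iff_one_le_mul₀ (Real.cosh_pos _), Real.cosh_eq]
    have : Real.exp (-(p * x)) * Real.exp (p * x) = 1 := by rw [← Real.exp_add]; simp
    nlinarith [Real.exp_pos (-(p * x))]
  calc phi p x ≤ (2 * Real.exp (-(p * x))) ^ (1 / p) :=
        Real.rpow_le_rpow (inv_pos.2 (Real.cosh_pos _)).le h1 (by positivity)
    _ = 2 ^ (1 / p) * Real.exp (-x) := by
        rw [Real.mul_rpow (by norm_num) (Real.exp_pos _).le, ← Real.exp_mul]
        congr 2
        field_simp

theorem continuous_phi {p : ℝ} (hp : 0 < p) : Continuous (phi p) :=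
  continuous_iff_continuousAt.2 fun x => (hasDerivAt_phi hp x).continuousAt

theorem deriv_phi {p : ℝ} (hp : 0 < p) :
    deriv (phi p) = fun x => -(phi p x * Real.tanh (p * x)) :=
  funext fun x => (hasDerivAt_phi hp x).deriv

theorem continuous_deriv_phi {p : ℝ} (hp : 0 < p) : Continuous (deriv (phi p)) := by
  rw [deriv_phi hp]
  have ht : Continuous Real.tanh := by
    have : Real.tanh = fun x => Real.sinh x / Real.cosh x :=
      funext Real.tanh_eq_sinh_div_cosh
    rw [this]
    exact Real.continuous_sinh.div Real.continuous_cosh fun x => (Real.cosh_pos x).ne'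
  exact ((continuous_phi hp).mul (ht.comp (continuous_const.mul continuous_id))).neg

theorem memLp_of_le_exp {f : ℝ → ℝ} (hf : Continuous f) (C : ℝ)
    (h : ∀ x, |f x| ≤ C * Real.exp (-x)) :
    MeasureTheory.MemLp (fun x => (f x : ℂ)) 2 halfLine := by
  have hm : MeasureTheory.AEStronglyMeasurable (fun x : ℝ => C * Real.exp (-x)) halfLine :=
    (by fun_prop : Continuous fun x : ℝ => C * Real.exp (-x)).aestronglyMeasurable
  have hE : MeasureTheory.MemLp (fun x : ℝ => C * Real.exp (-x)) 2 halfLine := by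
    rw [MeasureTheory.memLp_two_iff_integrable_sq hm]
    have := (integrableOn_exp_mul_Ioi (a := -2) (by norm_num) 0).const_mul (C ^ 2)
    refine this.congr (Filter.Eventually.of_forall fun x => ?_)
    simp only [mul_pow, ← Real.exp_nat_mul]
    congr 2
    push_cast; ring
  refine hE.of_le (Complex.continuous_ofReal.comp hf).aestronglyMeasurable
    (Filter.Eventually.of_forall fun x => ?_)
  rw [Complex.norm_real, Real.norm_eq_abs, Real.norm_eq_abs]
  exact (h x).trans (le_abs_self _)

theorem memLp_phi {p : ℝ} (hp : 0 < p) :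
    MeasureTheory.MemLp (fun x => (phi p x : ℂ)) 2 halfLine :=
  memLp_of_le_exp (continuous_phi hp) _ fun x => by
    rw [abs_of_pos (phi_pos p x)]; exact phi_le hp x

theorem memLp_deriv_phi {p : ℝ} (hp : 0 < p) :
    MeasureTheory.MemLp (fun x => ((deriv (phi p) x : ℝ) : ℂ)) 2 halfLine :=
  memLp_of_le_exp (continuous_deriv_phi hp) (2 ^ (1 / p)) fun x => by
    rw [deriv_phi hp, abs_neg, abs_mul, abs_of_pos (phi_pos p x)]
    have h1 : |Real.tanh (p * x)| ≤ 1 := (Real.abs_tanh_lt_one _).le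
    exact (mul_le_of_le_one_right (phi_pos p x).le h1).trans (phi_le hp x)

/-- The half-soliton state `Φ = φ (1, 1, …, 1)` as an element of `H¹_Γ`. -/
def Phi (N : ℕ) (p : ℝ) (hp : 0 < p) : H1 N :=
  ⟨WithLp.toLp 2 (WithLp.toLp 2 fun _ => (memLp_phi hp).toLp _,
      WithLp.toLp 2 fun _ => (memLp_deriv_phi hp).toLp _), by
    refine ⟨(phi p 0 : ℂ), fun j => ?_⟩
    have h1 := (memLp_phi hp).coeFn_toLp
    have h2 := (memLp_deriv_phi hp).coeFn_toLp
    filter_upwards [h1, MeasureTheory.ae_restrict_mem measurableSet_Ioi] with x hx hx0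
    have e : ∫ t in (0 : ℝ)..x, (memLp_deriv_phi hp).toLp _ t
        = ∫ t in (0 : ℝ)..x, ((deriv (phi p) t : ℝ) : ℂ) := by
      rw [intervalIntegral.integral_of_le (le_of_lt hx0),
        intervalIntegral.integral_of_le (le_of_lt hx0)]
      refine MeasureTheory.integral_congr_ae ?_
      exact MeasureTheory.ae_restrict_of_ae_restrict_of_subset Set.Ioc_subset_Ioi_self h2
    have f : ∫ t in (0 : ℝ)..x, deriv (phi p) t = phi p x - phi p 0 :=
      intervalIntegral.integral_deriv_eq_sub
        (fun y _ => (hasDerivAt_phi hp y).differentiableAt)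
        ((continuous_deriv_phi hp).intervalIntegrable _ _)
    change (memLp_phi hp).toLp _ x
      = (phi p 0 : ℂ) + ∫ t in (0 : ℝ)..x, (memLp_deriv_phi hp).toLp _ t
    rw [e, intervalIntegral.integral_ofReal, f, hx]
    push_cast; ring⟩

/-- `H¹_Γ ∩ L²_c`: the elements of `H¹_Γ` that are orthogonal to `Φ` in `L²(Γ)`. -/
def constrained (N : ℕ) (p : ℝ) (hp : 0 < p) : Set (H1 N) :=
  {V | ⟪val (Phi N p hp), val V⟫_ℂ = 0}

/-- The second variation `⟨Λ''(Φ) V, V⟩` of the action at `Φ` in the direction `V`. -/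
def secondVariation (N : ℕ) (p : ℝ) (hp : 0 < p) (V : H1 N) : ℝ :=
  iteratedDeriv 2 (fun t : ℝ => action p (Phi N p hp + t • V)) 0

/-- `X_c`, the set of all `V ∈ H¹_Γ ∩ L²_c` on which the second variation vanishes. -/
def kernelSet (N : ℕ) (p : ℝ) (hp : 0 < p) : Set (H1 N) :=
  {V | V ∈ constrained N p hp ∧ secondVariation N p hp V = 0}

/-- `U⁽¹⁾, …, U⁽ᴺ⁻¹⁾` are nonzero, orthogonal in `L²(Γ)`, and their real span is `X_c`. -/
structure IsKernelBasis (N : ℕ) (p : ℝ) (hp : 0 < p) (U : Fin (N - 1) → H1 N) : Prop where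
  ne_zero : ∀ j, U j ≠ 0
  orthogonal : ∀ i j, i ≠ j → ⟪val (U i), val (U j)⟫_ℂ = 0
  span_eq : (Submodule.span ℝ (Set.range U) : Set (H1 N)) = kernelSet N p hp

/-- `H¹_Γ ∩ L²_c ∩ [X_c]^⊥`. -/
def complement (N : ℕ) (p : ℝ) (hp : 0 < p) : Set (H1 N) :=
  {V | V ∈ constrained N p hp ∧ ∀ X ∈ kernelSet N p hp, ⟪val X, val V⟫_ℂ = 0}

/-- The objective `Λ(Φ + ∑ j, c j U⁽ʲ⁾ + U^⊥) - Λ(Φ)` as a function of `U^⊥`. -/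
def objective {N : ℕ} (p : ℝ) (hp : 0 < p) (U : Fin (N - 1) → H1 N)
    (c : EuclideanSpace ℝ (Fin (N - 1))) (W : H1 N) : ℝ :=
  action p (Phi N p hp + ∑ j, c j • U j + W) - action p (Phi N p hp)

/-- The admissible set of the (local) variational problem: the elements of
`H¹_Γ ∩ L²_c ∩ [X_c]^⊥` with `H¹` norm at most `r`. -/
def admissible (N : ℕ) (p : ℝ) (hp : 0 < p) (r : ℝ) : Set (H1 N) :=
  {W | W ∈ complement N p hp ∧ ‖W‖ ≤ r}

/-- `W` is a minimizer of the variational problem over the admissible set. -/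
def IsMinimizer {N : ℕ} (p : ℝ) (hp : 0 < p) (r : ℝ) (U : Fin (N - 1) → H1 N)
    (c : EuclideanSpace ℝ (Fin (N - 1))) (W : H1 N) : Prop :=
  W ∈ admissible N p hp r ∧ IsMinOn (objective p hp U c) (admissible N p hp r) W

/-- The reduced function `M(c)`, the infimum of the variational problem. -/
def reducedM {N : ℕ} (p : ℝ) (hp : 0 < p) (r : ℝ) (U : Fin (N - 1) → H1 N)
    (c : EuclideanSpace ℝ (Fin (N - 1))) : ℝ :=
  sInf (objective p hp U c '' admissible N p hp r)

/-- The cubic form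
`M₀(c) = -(2/3) p (p+1) (2p+1) ∑ i j k, c i c j c k ⟨Φ^{2p-1} U⁽ⁱ⁾ U⁽ʲ⁾, U⁽ᵏ⁾⟩`. -/
def cubicM {N : ℕ} (p : ℝ) (U : Fin (N - 1) → H1 N)
    (c : EuclideanSpace ℝ (Fin (N - 1))) : ℝ :=
  -(2 / 3) * p * (p + 1) * (2 * p + 1) *
    ∑ i, ∑ j, ∑ k, c i * c j * c k *
      ∑ l : Fin N, (∫ x in Set.Ioi (0 : ℝ), ((phi p x ^ (2 * p - 1) : ℝ) : ℂ) *
        val (U i) l x * val (U j) l x * (starRingEnd ℂ) (val (U k) l x)).re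

/-- `Φ` is a nonlinear saddle point of `Λ` in `H¹_Γ` with respect to perturbations in
`H¹_Γ ∩ L²_c`: it is a critical point, the second variation is nonnegative along the constraint,
and yet `Λ` takes values above and below `Λ(Φ)` at arbitrarily small perturbations. -/
structure IsNonlinearSaddle (N : ℕ) (p : ℝ) (hp : 0 < p) : Prop where
  critical : HasFDerivAt (action p) (0 : H1 N →L[ℝ] ℝ) (Phi N p hp)
  nonneg : ∀ V ∈ constrained N p hp, 0 ≤ secondVariation N p hp V
  above : ∀ ε > 0, ∃ V ∈ constrained N p hp, ‖V‖ < ε ∧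
    action p (Phi N p hp) < action p (Phi N p hp + V)
  below : ∀ ε > 0, ∃ V ∈ constrained N p hp, ‖V‖ < ε ∧
    action p (Phi N p hp + V) < action p (Phi N p hp)

end StarGraph

end

/-! The action is expanded exactly at the half-soliton: Λ(Φ+V) = Λ(Φ) + Q(V) + R(V). The linear term
drops out because φ solves the soliton equation on each edge and φ'(0) = 0. The form Q is half the
second variation, and R collects the terms of order three and higher of the nonlinearity.

On every edge Q decouples into the form of L₊ = -∂² + 1 - (p+1)(2p+1) sech²(px) for the real part
and of L₋ = -∂² + 1 - (p+1) sech²(px) for the imaginary part. No spectral theory is used: gaps come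
from completing the square with a Riccati supersolution S, S' + S² ≤ V - κ (`PrimOn.riccati`,
`edgeQuad_gap_imag`, `edgeQuad_gap_real`), where S perturbs φ'/φ for L₋ and ψ'/ψ for L₊, with ψ =
-φ' and L₊ψ = 0. A general real component is reduced to one vanishing at 0 and at a fixed interior
point by subtracting multiples of ψ and of η, where L₊η = -φ, η'(0) = 0. Under the mass constraint
the η-part contributes N(2pz)²⟨φ,η⟩, z being the real part of the vertex value, and ⟨φ,η⟩ = (1/(2p)
- 1/4)‖φ‖² is positive exactly because p < 2. Hence Q ≥ 0 on the constraint space, its null vectors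
there are ψ·(a₁,…,a_N) with ∑ aⱼ = 0, and Q is coercive in H¹ on the orthogonal complement of these
(`quadForm_coercive`).

For p ≥ 1/2 the map z ↦ |z|^{2p} z has a locally Lipschitz derivative, so R is Lipschitz with small
constant and nearly midpoint convex on small balls (`remainder_estimates`). Moreover Q(u + W) = Q(W)
for u in the kernel. The abstract minimization `exists_reduction` then yields a unique small
minimizer of size O(‖c‖²) and a minimal value R(u) + O(‖c‖⁴).

On the kernel φ + aψ = φ(1 + a tanh(px)), so the binomial series gives R(u) = M₀(c) + O(‖c‖⁴)
uniformly in x, with M₀ a negative multiple of ∑ aⱼ³. For N ≥ 3 the vector (1, 1, -2, 0, …) has zero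
sum but nonzero sum of cubes; thus M₀ is a nonzero odd form, and both M and Λ change sign. -/

section

open MeasureTheory Set Filter

/-! ### Absolutely continuous functions on an interval and the Riccati inequality -/

/-- `f` is an antiderivative of the integrable function `g` on `[a, b]`. -/
structure PrimOn (f g : ℝ → ℝ) (a b : ℝ) : Prop where
  int : IntervalIntegrable g volume a b
  eq : ∀ x ∈ Icc a b, f x = f a + ∫ t in a..x, g t

namespace PrimOn

variable {f g F G : ℝ → ℝ} {a b : ℝ}

theorem int_left (h : PrimOn f g a b) {x : ℝ} (hx : x ∈ Icc a b) :
    IntervalIntegrable g volume a x :=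
  h.int.mono_set (by
    rw [uIcc_of_le hx.1, uIcc_of_le (hx.1.trans hx.2)]; exact Icc_subset_Icc_right hx.2)

theorem mono (h : PrimOn f g a b) {c d : ℝ} (hc : a ≤ c) (hd : d ≤ b) (hcd : c ≤ d) :
    PrimOn f g c d := by
  refine ⟨h.int.mono_set ?_, fun x hx => ?_⟩
  · rw [uIcc_of_le hcd, uIcc_of_le (by linarith)]; exact Icc_subset_Icc hc hd
  · have h1 : c ∈ Icc a b := ⟨hc, by linarith⟩
    have h2 : x ∈ Icc a b := ⟨by linarith [hx.1], by linarith [hx.2]⟩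
    rw [h.eq x h2, h.eq c h1,
      ← intervalIntegral.integral_interval_sub_left (h.int_left h2) (h.int_left h1)]
    ring

theorem add (h : PrimOn f g a b) (H : PrimOn F G a b) :
    PrimOn (fun x => f x + F x) (fun x => g x + G x) a b :=
  ⟨h.int.add H.int, fun x hx => by
    rw [intervalIntegral.integral_add (h.int_left hx) (H.int_left hx), h.eq x hx, H.eq x hx]
    ring⟩

theorem const_mul (h : PrimOn f g a b) (c : ℝ) :
    PrimOn (fun x => c * f x) (fun x => c * g x) a b :=
  ⟨h.int.const_mul c, fun x hx => by
    rw [intervalIntegral.integral_const_mul, h.eq x hx]; ring⟩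

theorem of_hasDerivAt (hab : a ≤ b) (hf : ∀ x ∈ Icc a b, HasDerivAt f (g x) x)
    (hg : ContinuousOn g (Icc a b)) : PrimOn f g a b := by
  refine ⟨ContinuousOn.intervalIntegrable (by rwa [uIcc_of_le hab]), fun x hx => ?_⟩
  have hs : uIcc a x ⊆ Icc a b := by rw [uIcc_of_le hx.1]; exact Icc_subset_Icc_right hx.2
  rw [intervalIntegral.integral_eq_sub_of_hasDerivAt (fun y hy => hf y (hs hy))
    ((hg.mono hs).intervalIntegrable)]
  ring

theorem continuousOn (h : PrimOn f g a b) : ContinuousOn f (Icc a b) := by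
  rcases lt_or_ge b a with hab | hab
  · simp [Icc_eq_empty_of_lt hab]
  have h1 : ContinuousOn (fun x => f a + ∫ t in a..x, g t) (Icc a b) := by
    have := intervalIntegral.continuousOn_primitive_interval (a := a) (b := b) (f := g)
      (μ := volume) (by
        rw [uIcc_of_le hab]
        exact (intervalIntegrable_iff_integrableOn_Icc_of_le hab).1 h.int)
    rw [uIcc_of_le hab] at this
    exact continuousOn_const.add this
  exact h1.congr h.eq

theorem sub_eq (h : PrimOn f g a b) (hab : a ≤ b) : f b - f a = ∫ t in a..b, g t := by
  rw [h.eq b ⟨hab, le_rfl⟩]; ring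

/-- The densities `g`, `G` are merely integrable, so the product rule holds only almost everywhere;
integration by parts for absolutely continuous functions turns it into an integral identity. -/
theorem mul (h : PrimOn f g a b) (H : PrimOn F G a b) (hab : a ≤ b) :
    PrimOn (fun x => f x * F x) (fun x => g x * F x + f x * G x) a b := by
  have hfc := h.continuousOn
  have hFc := H.continuousOn
  rw [← uIcc_of_le hab] at hfc hFc
  refine ⟨(h.int.mul_continuousOn hFc).add (H.int.continuousOn_mul hfc), fun x hx => ?_⟩
  have h' := h.mono le_rfl hx.2 hx.1
  have H' := H.mono le_rfl hx.2 hx.1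
  have hac : ∀ {u v : ℝ → ℝ}, PrimOn u v a x →
      AbsolutelyContinuousOnInterval (fun y => u a + ∫ t in a..y, v t) a x := fun {u v} hu =>
    ((LipschitzWith.const (u a)).lipschitzOnWith.absolutelyContinuousOnInterval).add
      (hu.int.absolutelyContinuousOnInterval_intervalIntegral left_mem_uIcc)
  have key := AbsolutelyContinuousOnInterval.integral_deriv_mul_eq_sub (hac h') (hac H')
  have e : ∫ t in a..x, (g t * F t + f t * G t) = f x * F x - f a * F a := by
    rw [h'.eq x ⟨hx.1, le_rfl⟩, H'.eq x ⟨hx.1, le_rfl⟩]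
    simp only [intervalIntegral.integral_same, add_zero] at key
    rw [← key]
    refine intervalIntegral.integral_congr_ae ?_
    filter_upwards [h'.int.ae_hasDerivAt_integral, H'.int.ae_hasDerivAt_integral] with t h1 h2 ht
    have ht1 := uIoc_subset_uIcc ht
    have ht2 : t ∈ Icc a x := by rwa [uIcc_of_le hx.1] at ht1
    rw [(((h1 ht1) a left_mem_uIcc).const_add (f a)).deriv,
      (((h2 ht1) a left_mem_uIcc).const_add (F a)).deriv, ← h'.eq t ht2, ← H'.eq t ht2]
  rw [e]; ring

/-- Completing the square with a Riccati multiplier `S`. -/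
theorem riccati {S S' V : ℝ → ℝ} (h : PrimOn f g a b) (hab : a ≤ b)
    (hS : PrimOn S S' a b) (hV : ContinuousOn V (Icc a b))
    (hSV : ∀ x ∈ Icc a b, S' x + S x ^ 2 ≤ V x)
    (hg : IntervalIntegrable (fun x => g x ^ 2) volume a b) :
    S b * f b ^ 2 - S a * f a ^ 2 ≤ ∫ x in a..b, (g x ^ 2 + V x * f x ^ 2) := by
  have h2 := hS.mul (h.mul h hab) hab
  have e := h2.sub_eq hab
  have hfc := h.continuousOn
  have hgV : IntervalIntegrable (fun x => g x ^ 2 + V x * f x ^ 2) volume a b := by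
    refine hg.add (ContinuousOn.intervalIntegrable ?_)
    rw [uIcc_of_le hab]; exact hV.mul (hfc.pow 2)
  have := intervalIntegral.integral_mono_on hab h2.int hgV fun x hx => by
    have h1 := hSV x hx
    have h3 := mul_le_mul_of_nonneg_right h1 (sq_nonneg (f x))
    -- (S f²)' = S' f² + 2 S f g, and 2 S f g ≤ g² + S² f² by the square (g - S f)² ≥ 0.
    nlinarith [sq_nonneg (g x - S x * f x)]
  calc _ = S b * (f b * f b) - S a * (f a * f a) := by ring
    _ ≤ _ := e ▸ this

end PrimOn

/-! ### The space H¹(0, ∞) on a single edge -/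

/-- A real function in `H¹(0, ∞)` together with its derivative. -/
structure EdgeFun (f g : ℝ → ℝ) : Prop where
  memLp : MemLp f 2 StarGraph.halfLine
  memLp' : MemLp g 2 StarGraph.halfLine
  eq : ∀ x, 0 ≤ x → f x = f 0 + ∫ t in (0 : ℝ)..x, g t

theorem MeasureTheory.MemLp.intervalIntegrable_halfLine {g : ℝ → ℝ} (hg : MemLp g 2 StarGraph.halfLine)
    {a b : ℝ} (ha : 0 ≤ a) (hab : a ≤ b) : IntervalIntegrable g volume a b := by
  rw [intervalIntegrable_iff_integrableOn_Ioc_of_le hab]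
  have hs : Ioc a b ⊆ Ioi 0 := fun x hx => lt_of_le_of_lt ha hx.1
  have := hg.restrict (Ioc a b)
  rw [Measure.restrict_restrict measurableSet_Ioc, inter_eq_left.2 hs] at this
  exact this.integrable (by norm_num)

theorem MeasureTheory.MemLp.sq_integrableOn {f : ℝ → ℝ} (hf : MemLp f 2 StarGraph.halfLine) :
    IntegrableOn (fun x => f x ^ 2) (Ioi 0) := by
  have := MemLp.integrable_mul hf hf
  simp only [sq]
  exact this

theorem MeasureTheory.MemLp.mul_integrable {f g : ℝ → ℝ} {μ : Measure ℝ} (hf : MemLp f 2 μ)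
    (hg : MemLp g 2 μ) : Integrable (fun x => f x * g x) μ :=
  MemLp.integrable_mul hf hg

namespace EdgeFun

variable {f g F G : ℝ → ℝ} {a b : ℝ}

theorem primOn (h : EdgeFun f g) (ha : 0 ≤ a) (hab : a ≤ b) : PrimOn f g a b := by
  have : PrimOn f g 0 b :=
    ⟨h.memLp'.intervalIntegrable_halfLine le_rfl (ha.trans hab), fun x hx => h.eq x hx.1⟩
  exact this.mono ha le_rfl hab

theorem add (h : EdgeFun f g) (H : EdgeFun F G) :
    EdgeFun (fun x => f x + F x) (fun x => g x + G x) :=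
  ⟨h.memLp.add H.memLp, h.memLp'.add H.memLp', fun x hx =>
    ((h.primOn le_rfl hx).add (H.primOn le_rfl hx)).eq x ⟨hx, le_rfl⟩⟩

theorem const_mul (h : EdgeFun f g) (c : ℝ) : EdgeFun (fun x => c * f x) (fun x => c * g x) :=
  ⟨h.memLp.const_mul c, h.memLp'.const_mul c, fun x hx =>
    ((h.primOn le_rfl hx).const_mul c).eq x ⟨hx, le_rfl⟩⟩

/-- The derivative 2 f g of f² is integrable, so f² has a limit at infinity; a positive limit would
contradict the integrability of f². -/
theorem tendsto_sq (h : EdgeFun f g) : Tendsto (fun x => f x ^ 2) atTop (𝓝 0) := by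
  have hi : IntegrableOn (fun x => g x * f x + f x * g x) (Ioi 0) :=
    (h.memLp'.mul_integrable h.memLp).add (h.memLp.mul_integrable h.memLp')
  have ht := (intervalIntegral_tendsto_integral_Ioi 0 hi tendsto_id).const_add (f 0 ^ 2)
  have hlim : Tendsto (fun x => f x ^ 2) atTop
      (𝓝 (f 0 ^ 2 + ∫ x in Ioi 0, (g x * f x + f x * g x))) := by
    refine ht.congr' ?_
    filter_upwards [eventually_ge_atTop 0] with x hx
    have := ((h.primOn le_rfl hx).mul (h.primOn le_rfl hx) hx).eq x ⟨hx, le_rfl⟩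
    simp only [id]
    nlinarith
  set l := f 0 ^ 2 + ∫ x in Ioi 0, (g x * f x + f x * g x) with hl
  have hl0 : 0 ≤ l := ge_of_tendsto' hlim fun x => sq_nonneg _
  rcases hl0.eq_or_lt with h0 | h0
  · rwa [← h0] at hlim
  exfalso
  obtain ⟨R, hR⟩ := eventually_atTop.1 (hlim.eventually (lt_mem_nhds (half_lt_self h0)))
  have hfi : IntegrableOn (fun x => f x ^ 2) (Ioi 0) := h.memLp.sq_integrableOn
  have h1 : IntegrableOn (fun x => f x ^ 2) (Ioi (max R 0)) :=
    hfi.mono_set (Ioi_subset_Ioi (le_max_right _ _))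
  have h2 : IntegrableOn (fun _ : ℝ => l / 2) (Ioi (max R 0)) := by
    refine h1.mono' aestronglyMeasurable_const ?_
    filter_upwards [ae_restrict_mem measurableSet_Ioi] with x hx
    rw [Real.norm_of_nonneg (by positivity)]
    exact (hR x ((le_max_left _ _).trans (le_of_lt hx))).le
  rw [integrableOn_const_iff] at h2
  rcases h2 with h2 | h2
  · rw [enorm_eq_zero] at h2; linarith
  · simp at h2

theorem tendsto_zero (h : EdgeFun f g) : Tendsto f atTop (𝓝 0) := by
  have := (h.tendsto_sq).sqrt
  simp only [Real.sqrt_sq_eq_abs, Real.sqrt_zero] at this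
  exact (tendsto_zero_iff_abs_tendsto_zero _).2 this

theorem sq_integrable (h : EdgeFun f g) : IntegrableOn (fun x => f x ^ 2) (Ioi 0) := 
  h.memLp.sq_integrableOn

theorem sq_integrable' (h : EdgeFun f g) : IntegrableOn (fun x => g x ^ 2) (Ioi 0) := 
  h.memLp'.sq_integrableOn

/-- One-dimensional Sobolev inequality: f(x)² is the integral of -2 f g over (x, ∞), and -2 f g ≤ f²
+ g². The boundary term at R disappears by `tendsto_sq`. -/
theorem sq_le (h : EdgeFun f g) {x : ℝ} (hx : 0 ≤ x) :
    f x ^ 2 ≤ (∫ t in Ioi 0, f t ^ 2) + ∫ t in Ioi 0, g t ^ 2 := by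
  have hsq : IntegrableOn (fun t => f t ^ 2 + g t ^ 2) (Ioi 0) := h.sq_integrable.add h.sq_integrable'
  rw [← integral_add h.sq_integrable h.sq_integrable']
  have key : ∀ R, x ≤ R → f x ^ 2 - f R ^ 2 ≤ ∫ t in Ioi 0, (f t ^ 2 + g t ^ 2) := by
    intro R hR
    have hp := h.primOn hx hR
    have e := (hp.mul hp hR).sub_eq hR
    have hs : Ioc x R ⊆ Ioi 0 := fun t ht => lt_of_le_of_lt hx ht.1
    have h1 : IntervalIntegrable (fun t => f t ^ 2 + g t ^ 2) volume x R := by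
      rw [intervalIntegrable_iff_integrableOn_Ioc_of_le hR]
      exact hsq.mono_set hs
    have h2 : -(∫ t in x..R, (g t * f t + f t * g t)) ≤ ∫ t in x..R, (f t ^ 2 + g t ^ 2) := by
      rw [← intervalIntegral.integral_neg]
      exact intervalIntegral.integral_mono_on hR (hp.mul hp hR).int.neg h1
        fun t _ => by nlinarith [sq_nonneg (f t + g t)]
    have h3 : ∫ t in x..R, (f t ^ 2 + g t ^ 2) ≤ ∫ t in Ioi 0, (f t ^ 2 + g t ^ 2) := by
      rw [intervalIntegral.integral_of_le hR]
      exact setIntegral_mono_set hsq (Eventually.of_forall fun t => by positivity)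
        hs.eventuallyLE
    nlinarith
  have ht : Tendsto (fun R => f x ^ 2 - f R ^ 2) atTop (𝓝 (f x ^ 2 - 0)) :=
    tendsto_const_nhds.sub h.tendsto_sq
  rw [sub_zero] at ht
  exact le_of_tendsto ht (by filter_upwards [eventually_ge_atTop x] with R hR using key R hR)

/-- Integration by parts against a bounded multiplier `m`. -/
theorem integral_by_parts (h : EdgeFun f g) {m m' : ℝ → ℝ} {K : ℝ}
    (hm : ∀ x, HasDerivAt m (m' x) x) (hmc : Continuous m')
    (hb : ∀ x, 0 ≤ x → |m x| ≤ K)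
    (h1 : MemLp m 2 StarGraph.halfLine) (h2 : MemLp m' 2 StarGraph.halfLine) :
    (∫ x in Ioi 0, m x * g x) = -(∫ x in Ioi 0, m' x * f x) - m 0 * f 0 := by
  have hi1 : IntegrableOn (fun x => m x * g x) (Ioi 0) := h1.mul_integrable h.memLp'
  have hi2 : IntegrableOn (fun x => m' x * f x) (Ioi 0) := h2.mul_integrable h.memLp
  have hi : IntegrableOn (fun x => m' x * f x + m x * g x) (Ioi 0) := hi2.add hi1
  have ht := intervalIntegral_tendsto_integral_Ioi 0 hi tendsto_id
  have ht2 : Tendsto (fun R => m R * f R - m 0 * f 0) atTop (𝓝 (0 - m 0 * f 0)) := by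
    refine Tendsto.sub ?_ tendsto_const_nhds
    have := (h.tendsto_zero.norm).const_mul K
    rw [norm_zero, mul_zero] at this
    refine squeeze_zero_norm' ?_ this
    filter_upwards [eventually_ge_atTop 0] with x hx
    rw [norm_mul]
    exact mul_le_mul_of_nonneg_right (hb x hx) (norm_nonneg _)
  have e : (∫ x in Ioi 0, (m' x * f x + m x * g x)) = 0 - m 0 * f 0 := by
    refine tendsto_nhds_unique ht (ht2.congr' ?_)
    filter_upwards [eventually_ge_atTop 0] with x hx
    exact ((PrimOn.of_hasDerivAt hx (fun y _ => hm y) hmc.continuousOn).mul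
      (h.primOn le_rfl hx) hx).sub_eq hx
  rw [integral_add hi2 hi1] at e
  linarith

/-- A Riccati supersolution on `[a, ∞)` yields a spectral gap for functions vanishing at `a`. -/
theorem riccati_Ioi (h : EdgeFun f g) (ha : 0 ≤ a) (hfa : f a = 0) {S S' V : ℝ → ℝ} {κ K C : ℝ}
    (hS : ∀ x, a ≤ x → HasDerivAt S (S' x) x) (hS' : ContinuousOn S' (Ici a))
    (hK : ∀ x, a ≤ x → |S x| ≤ K) (hV : Continuous V) (hVC : ∀ x, |V x| ≤ C)
    (hSV : ∀ x, a ≤ x → S' x + S x ^ 2 ≤ V x - κ) :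
    κ * (∫ x in Ioi a, f x ^ 2) ≤ ∫ x in Ioi a, (g x ^ 2 + V x * f x ^ 2) := by
  have hs : Ioi a ⊆ Ioi 0 := Ioi_subset_Ioi ha
  have i1 := h.sq_integrable.mono_set hs
  have i2 := h.sq_integrable'.mono_set hs
  have i3 : IntegrableOn (fun x => V x * f x ^ 2) (Ioi a) :=
    i1.bdd_mul hV.aestronglyMeasurable (Eventually.of_forall hVC)
  have i4 : IntegrableOn (fun x => g x ^ 2 + (V x - κ) * f x ^ 2) (Ioi a) := by
    have := (i2.add i3).sub (i1.const_mul κ)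
    refine this.congr (Eventually.of_forall fun x => ?_)
    simp only [Pi.add_apply, Pi.sub_apply]; ring
  have e : (∫ x in Ioi a, (g x ^ 2 + (V x - κ) * f x ^ 2)) =
      (∫ x in Ioi a, (g x ^ 2 + V x * f x ^ 2)) - κ * ∫ x in Ioi a, f x ^ 2 := by
    rw [← integral_const_mul]
    refine Eq.trans ?_ (integral_sub (i2.add i3) (i1.const_mul κ))
    refine integral_congr_ae (Eventually.of_forall fun x => ?_)
    simp only
    ring
  suffices 0 ≤ ∫ x in Ioi a, (g x ^ 2 + (V x - κ) * f x ^ 2) by linarith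
  have ht := intervalIntegral_tendsto_integral_Ioi a i4 tendsto_id
  have ht2 : Tendsto (fun R => -K * f R ^ 2) atTop (𝓝 0) := by
    simpa using h.tendsto_sq.const_mul (-K)
  refine le_of_tendsto_of_tendsto ht2 ht ?_
  filter_upwards [eventually_ge_atTop a] with R hR
  have := (h.primOn ha hR).riccati hR (PrimOn.of_hasDerivAt hR (fun x hx => hS x hx.1)
    (hS'.mono Icc_subset_Ici_self)) (V := fun x => V x - κ) (by fun_prop)
    (fun x hx => hSV x hx.1) (by
      rw [intervalIntegrable_iff_integrableOn_Ioc_of_le hR]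
      exact i2.mono_set Ioc_subset_Ioi_self)
  have hb := (abs_le.1 (hK R hR)).1
  rw [hfa] at this
  simp only [id]
  nlinarith [sq_nonneg (f R), mul_le_mul_of_nonneg_right hb (sq_nonneg (f R))]

end EdgeFun

/-! ### Explicit profiles φ, ψ, η: differential equations and decay -/

namespace StarGraph

/-- `sech² (p x)`, which is also `φ(x)^{2p}`. -/
noncomputable def sechSq (p x : ℝ) : ℝ := (Real.cosh (p * x) ^ 2)⁻¹

/-- `ψ = -φ'`. -/
noncomputable def psi (p x : ℝ) : ℝ := phi p x * Real.tanh (p * x)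

/-- The derivative of `ψ`. -/
noncomputable def dpsi (p x : ℝ) : ℝ := phi p x * ((p + 1) * sechSq p x - 1)

/-- The derivative at `ω = 1` of the rescaled solitons `ω^{1/(2p)} φ(√ω x)`. -/
noncomputable def eta (p x : ℝ) : ℝ := phi p x / (2 * p) - x * psi p x / 2

/-- The derivative of `η`. -/
noncomputable def deta (p x : ℝ) : ℝ := -psi p x / (2 * p) - psi p x / 2 - x * dpsi p x / 2

theorem sechSq_pos (p x : ℝ) : 0 < sechSq p x := by
  have := Real.cosh_pos (p * x); unfold sechSq; positivity

theorem sechSq_le_one (p x : ℝ) : sechSq p x ≤ 1 := by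
  have := Real.one_le_cosh (p * x)
  exact inv_le_one_of_one_le₀ (by nlinarith)

theorem tanh_sq (p x : ℝ) : Real.tanh (p * x) ^ 2 = 1 - sechSq p x := by
  have := Real.cosh_pos (p * x)
  rw [Real.tanh_eq_sinh_div_cosh, sechSq, div_pow, Real.sinh_sq]
  field_simp

theorem phi_rpow_two_mul {p : ℝ} (hp : 0 < p) (x : ℝ) : phi p x ^ (2 * p) = sechSq p x := by
  have := Real.cosh_pos (p * x)
  rw [phi, ← Real.rpow_mul (by positivity), sechSq, ← inv_pow, ← Real.rpow_natCast]
  congr 1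
  field_simp
  norm_num

theorem hasDerivAt_tanh_mul (p x : ℝ) :
    HasDerivAt (fun y => Real.tanh (p * y)) (p * sechSq p x) x := by
  have hc := Real.cosh_pos (p * x)
  have h1 : HasDerivAt (fun y : ℝ => p * y) p x := by simpa using (hasDerivAt_id x).const_mul p
  have h := (h1.sinh).div (h1.cosh) hc.ne'
  have e : (fun y => Real.tanh (p * y)) = fun y => Real.sinh (p * y) / Real.cosh (p * y) :=
    funext fun y => Real.tanh_eq_sinh_div_cosh _
  rw [e]
  refine h.congr_deriv ?_
  have := Real.cosh_sq (p * x)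
  rw [sechSq]
  field_simp
  linear_combination p * this

theorem hasDerivAt_sechSq (p x : ℝ) :
    HasDerivAt (sechSq p) (-(2 * p * Real.tanh (p * x) * sechSq p x)) x := by
  have h := ((hasDerivAt_tanh_mul p x).pow 2).const_sub 1
  have e : sechSq p = fun y => 1 - Real.tanh (p * y) ^ 2 :=
    funext fun y => by rw [tanh_sq]; ring
  have h' := h.congr_of_eventuallyEq (f₁ := sechSq p) (Eventually.of_forall fun y => by
    rw [e]; rfl)
  refine h'.congr_deriv ?_
  push_cast
  ring

theorem continuous_sechSq (p : ℝ) : Continuous (sechSq p) :=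
  continuous_iff_continuousAt.2 fun x => (hasDerivAt_sechSq p x).continuousAt

theorem continuous_tanh_mul (p : ℝ) : Continuous fun x => Real.tanh (p * x) :=
  continuous_iff_continuousAt.2 fun x => (hasDerivAt_tanh_mul p x).continuousAt

theorem hasDerivAt_phi' {p : ℝ} (hp : 0 < p) (x : ℝ) : HasDerivAt (phi p) (-psi p x) x := hasDerivAt_phi hp x

theorem hasDerivAt_psi {p : ℝ} (hp : 0 < p) (x : ℝ) : HasDerivAt (psi p) (dpsi p x) x := by
  refine ((hasDerivAt_phi hp x).mul (hasDerivAt_tanh_mul p x)).congr_deriv ?_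
  rw [dpsi]
  linear_combination (-phi p x) * tanh_sq p x

/-- This is L₊ψ = 0, the soliton equation differentiated in x. -/
theorem hasDerivAt_dpsi {p : ℝ} (hp : 0 < p) (x : ℝ) :
    HasDerivAt (dpsi p) ((1 - (p + 1) * (2 * p + 1) * sechSq p x) * psi p x) x := by
  refine ((hasDerivAt_phi hp x).mul
    (((hasDerivAt_sechSq p x).const_mul (p + 1)).sub_const 1)).congr_deriv ?_
  rw [psi]; ring

theorem hasDerivAt_eta {p : ℝ} (hp : 0 < p) (x : ℝ) : HasDerivAt (eta p) (deta p x) x := by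
  refine (((hasDerivAt_phi' hp x).div_const (2 * p)).sub
    (((hasDerivAt_id x).mul (hasDerivAt_psi hp x)).div_const 2)).congr_deriv ?_
  simp only [deta, id]; ring

/-- This is L₊η = -φ, the equation of the rescaled solitons differentiated in the frequency at ω =
1. -/
theorem hasDerivAt_deta {p : ℝ} (hp : 0 < p) (x : ℝ) :
    HasDerivAt (deta p) ((1 - (p + 1) * (2 * p + 1) * sechSq p x) * eta p x + phi p x) x := by
  refine ((((hasDerivAt_psi hp x).neg.div_const (2 * p)).sub
    ((hasDerivAt_psi hp x).div_const 2)).sub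
    (((hasDerivAt_id x).mul (hasDerivAt_dpsi hp x)).div_const 2)).congr_deriv ?_
  simp only [eta, dpsi, id]
  field_simp
  ring

theorem continuous_psi {p : ℝ} (hp : 0 < p) : Continuous (psi p) :=
  continuous_iff_continuousAt.2 fun x => (hasDerivAt_psi hp x).continuousAt

theorem continuous_dpsi {p : ℝ} (hp : 0 < p) : Continuous (dpsi p) :=
  continuous_iff_continuousAt.2 fun x => (hasDerivAt_dpsi hp x).continuousAt

theorem memLp_of_le_mul_exp {f : ℝ → ℝ} (hf : Continuous f) (C : ℝ)
    (h : ∀ x, 0 ≤ x → |f x| ≤ C * ((1 + x) * Real.exp (-x))) : MemLp f 2 halfLine := by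
  have hm : AEStronglyMeasurable (fun x : ℝ => C * (2 * Real.exp (-(1/2) * x))) halfLine :=
    (by fun_prop : Continuous fun x : ℝ => C * (2 * Real.exp (-(1/2) * x))).aestronglyMeasurable
  have hC : 0 ≤ C := by
    have := (abs_nonneg _).trans (h 0 le_rfl)
    simpa using this
  have hE : MemLp (fun x : ℝ => C * (2 * Real.exp (-(1/2) * x))) 2 halfLine := by
    rw [memLp_two_iff_integrable_sq hm]
    have := (integrableOn_exp_mul_Ioi (a := -1) (by norm_num) 0).const_mul ((2 * C) ^ 2)
    refine this.congr (Eventually.of_forall fun x => ?_)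
    simp only [mul_pow, ← Real.exp_nat_mul]
    rw [show ((2 : ℕ) : ℝ) * (-(1/2) * x) = -1 * x by push_cast; ring]
    ring
  refine hE.of_le hf.aestronglyMeasurable ?_
  filter_upwards [ae_restrict_mem measurableSet_Ioi] with x hx
  rw [Real.norm_eq_abs, Real.norm_eq_abs]
  refine (h x (le_of_lt hx)).trans ((mul_le_mul_of_nonneg_left ?_ hC).trans (le_abs_self _))
  have h1 : Real.exp (-x) = Real.exp (-(1/2) * x) * Real.exp (-(1/2) * x) := by
    rw [← Real.exp_add]; ring_nf
  have h2 : Real.exp (-(1/2) * x) * Real.exp (1/2 * x) = 1 := by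
    rw [← Real.exp_add]; ring_nf; simp
  have h3 := Real.add_one_le_exp (1/2 * x)
  have h4 := Real.exp_pos (-(1/2) * x)
  -- The polynomial factor is absorbed by half of the exponential, leaving 2 e^{-x/2}, which is
  -- square-integrable.
  have h5 : (1 + x) * Real.exp (-(1/2) * x) ≤ 2 := by
    have : (0 : ℝ) < x := hx
    nlinarith
  rw [h1]; nlinarith

theorem one_add_mul_exp_neg_le {x : ℝ} : (1 + x) * Real.exp (-x) ≤ 1 := by
  have h := Real.add_one_le_exp x
  have h1 := Real.exp_pos (-x)
  have h2 : Real.exp x * Real.exp (-x) = 1 := by rw [← Real.exp_add]; simp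
  nlinarith

/-- Domination by `(1 + x) e^{-x}` on the half-line. -/
def Decays (f : ℝ → ℝ) : Prop :=
  Continuous f ∧ ∃ C, ∀ x, 0 ≤ x → |f x| ≤ C * ((1 + x) * Real.exp (-x))

namespace Decays

variable {f g : ℝ → ℝ}

theorem memLp (h : Decays f) : MemLp f 2 halfLine := by
  obtain ⟨hc, C, hC⟩ := h
  exact memLp_of_le_mul_exp hc C hC

theorem bounded (h : Decays f) : ∃ C, ∀ x, 0 ≤ x → |f x| ≤ C := by
  obtain ⟨-, C, hC⟩ := h
  have h0 : 0 ≤ C := by simpa using (abs_nonneg _).trans (hC 0 le_rfl)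
  exact ⟨C, fun x hx => (hC x hx).trans (by
    simpa using mul_le_mul_of_nonneg_left (one_add_mul_exp_neg_le (x := x)) h0)⟩

theorem add (h : Decays f) (H : Decays g) : Decays fun x => f x + g x := by
  obtain ⟨hc, C, hC⟩ := h
  obtain ⟨hc', C', hC'⟩ := H
  refine ⟨hc.add hc', C + C', fun x hx => (abs_add_le _ _).trans ?_⟩
  rw [add_mul]; exact add_le_add (hC x hx) (hC' x hx)

theorem bdd_mul {b : ℝ → ℝ} (h : Decays f) (hb : Continuous b) {K : ℝ}
    (hK : ∀ x, |b x| ≤ K) : Decays fun x => b x * f x := by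
  obtain ⟨hc, C, hC⟩ := h
  have h0 : 0 ≤ K := (abs_nonneg _).trans (hK 0)
  refine ⟨hb.mul hc, K * C, fun x hx => ?_⟩
  rw [abs_mul, mul_assoc]
  exact mul_le_mul (hK x) (hC x hx) (abs_nonneg _) h0

theorem const_mul (h : Decays f) (c : ℝ) : Decays fun x => c * f x :=
  h.bdd_mul continuous_const fun _ => le_rfl

end Decays

theorem decays_phi {p : ℝ} (hp : 0 < p) : Decays (phi p) :=
  ⟨continuous_phi hp, 2 ^ (1 / p), fun x hx => by
    rw [abs_of_pos (phi_pos p x)]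
    refine (phi_le hp x).trans (mul_le_mul_of_nonneg_left ?_ (by positivity))
    nlinarith [Real.exp_pos (-x)]⟩

theorem decays_id_mul_phi {p : ℝ} (hp : 0 < p) : Decays fun x => x * phi p x :=
  ⟨continuous_id.mul (continuous_phi hp), 2 ^ (1 / p), fun x hx => by
    rw [abs_mul, abs_of_pos (phi_pos p x), abs_of_nonneg hx]
    have h1 := mul_le_mul_of_nonneg_left (phi_le hp x) hx
    have h2 : 0 ≤ (2 : ℝ) ^ (1 / p) * Real.exp (-x) := by positivity
    nlinarith⟩

theorem decays_psi {p : ℝ} (hp : 0 < p) : Decays (psi p) := by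
  have := (decays_phi hp).bdd_mul (continuous_tanh_mul p)
    (fun x => (Real.abs_tanh_lt_one (p * x)).le)
  have e : psi p = fun x => Real.tanh (p * x) * phi p x := funext fun x => mul_comm _ _
  rwa [e]

theorem abs_sechSq_mul_sub_one_le (p c x : ℝ) : |1 - c * sechSq p x| ≤ 1 + |c| := by
  refine (abs_sub _ _).trans ?_
  rw [abs_one, abs_mul, abs_of_pos (sechSq_pos p x)]
  have := mul_le_mul_of_nonneg_left (sechSq_le_one p x) (abs_nonneg c)
  linarith

theorem decays_dpsi {p : ℝ} (hp : 0 < p) : Decays (dpsi p) := by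
  have := (decays_phi hp).bdd_mul (b := fun x => (p + 1) * sechSq p x - 1)
    (((continuous_sechSq p).const_mul _).sub continuous_const) (K := 1 + |p + 1|)
    (fun x => by rw [abs_sub_comm]; exact abs_sechSq_mul_sub_one_le p _ x)
  have e : dpsi p = fun x => ((p + 1) * sechSq p x - 1) * phi p x := funext fun x => mul_comm _ _
  rwa [e]

theorem decays_id_mul_psi {p : ℝ} (hp : 0 < p) : Decays fun x => x * psi p x := by
  have := (decays_id_mul_phi hp).bdd_mul (continuous_tanh_mul p)
    (fun x => (Real.abs_tanh_lt_one (p * x)).le)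
  have e : (fun x => x * psi p x) = fun x => Real.tanh (p * x) * (x * phi p x) :=
    funext fun x => by rw [psi]; ring
  rwa [e]

theorem decays_id_mul_dpsi {p : ℝ} (hp : 0 < p) : Decays fun x => x * dpsi p x := by
  have := (decays_id_mul_phi hp).bdd_mul (b := fun x => (p + 1) * sechSq p x - 1)
    (((continuous_sechSq p).const_mul _).sub continuous_const) (K := 1 + |p + 1|)
    (fun x => by rw [abs_sub_comm]; exact abs_sechSq_mul_sub_one_le p _ x)
  have e : (fun x => x * dpsi p x) = fun x => ((p + 1) * sechSq p x - 1) * (x * phi p x) :=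
    funext fun x => by rw [dpsi]; ring
  rwa [e]

theorem decays_eta {p : ℝ} (hp : 0 < p) : Decays (eta p) := by
  have := ((decays_phi hp).const_mul (1 / (2 * p))).add ((decays_id_mul_psi hp).const_mul (-1 / 2))
  have e : eta p = fun x => 1 / (2 * p) * phi p x + -1 / 2 * (x * psi p x) :=
    funext fun x => by rw [eta]; ring
  rwa [e]

theorem decays_deta {p : ℝ} (hp : 0 < p) : Decays (deta p) := by
  have := ((decays_psi hp).const_mul (-1 / (2 * p) - 1 / 2)).add
    ((decays_id_mul_dpsi hp).const_mul (-1 / 2))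
  have e : deta p = fun x => (-1 / (2 * p) - 1 / 2) * psi p x + -1 / 2 * (x * dpsi p x) :=
    funext fun x => by rw [deta]; ring
  rwa [e]

theorem Decays.potential_mul {f : ℝ → ℝ} (h : Decays f) (p c : ℝ) :
    Decays fun x => (1 - c * sechSq p x) * f x :=
  h.bdd_mul (continuous_const.sub ((continuous_sechSq p).const_mul c))
    fun x => abs_sechSq_mul_sub_one_le p c x

theorem edgeFun_of_hasDerivAt {f g : ℝ → ℝ} (h : ∀ x, HasDerivAt f (g x) x)
    (hf : Decays f) (hg : Decays g) : EdgeFun f g :=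
  ⟨hf.memLp, hg.memLp, fun x hx =>
    (PrimOn.of_hasDerivAt hx (fun y _ => h y) hg.1.continuousOn).eq x ⟨hx, le_rfl⟩⟩

theorem edgeFun_phi {p : ℝ} (hp : 0 < p) : EdgeFun (phi p) fun x => -psi p x :=
  edgeFun_of_hasDerivAt (hasDerivAt_phi' hp) (decays_phi hp)
    (by simpa using (decays_psi hp).const_mul (-1))

theorem edgeFun_psi {p : ℝ} (hp : 0 < p) : EdgeFun (psi p) (dpsi p) :=
  edgeFun_of_hasDerivAt (hasDerivAt_psi hp) (decays_psi hp) (decays_dpsi hp)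

theorem edgeFun_eta {p : ℝ} (hp : 0 < p) : EdgeFun (eta p) (deta p) :=
  edgeFun_of_hasDerivAt (hasDerivAt_eta hp) (decays_eta hp) (decays_deta hp)

theorem psi_zero (p : ℝ) : psi p 0 = 0 := by simp [psi]

theorem phi_zero (p : ℝ) : phi p 0 = 1 := by simp [phi]

theorem eta_zero (p : ℝ) : eta p 0 = 1 / (2 * p) := by simp [eta, phi_zero]

theorem deta_zero (p : ℝ) : deta p 0 = 0 := by simp [deta, psi_zero]

/-! ### Quadratic forms on one edge and Green's formula -/

theorem integral_add_mul_add_mul {μ : Measure ℝ} {u v w : ℝ → ℝ} (hu : Integrable u μ)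
    (hv : Integrable v μ) (hw : Integrable w μ) (a b : ℝ) :
    ∫ x, (u x + a * v x + b * w x) ∂μ = ∫ x, u x ∂μ + a * ∫ x, v x ∂μ + b * ∫ x, w x ∂μ := by
  rw [integral_add (f := fun x => u x + a * v x) (hu.add (hv.const_mul a)) (hw.const_mul b),
    integral_add hu (hv.const_mul a), integral_const_mul, integral_const_mul]

/-- The bilinear form of `-∂² + 1 - c sech²(p x)` on the half-line. -/
noncomputable def edgeBilin (p c : ℝ) (f g F G : ℝ → ℝ) : ℝ :=
  ∫ x in Ioi 0, (g x * G x + (1 - c * sechSq p x) * (f x * F x))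

/-- The quadratic form of `-∂² + 1 - c sech²(p x)` on the half-line. -/
noncomputable def edgeQuad (p c : ℝ) (f g : ℝ → ℝ) : ℝ :=
  ∫ x in Ioi 0, (g x ^ 2 + (1 - c * sechSq p x) * f x ^ 2)

theorem integrable_potential_mul (p c : ℝ) {u : ℝ → ℝ} {s : Set ℝ} (hu : IntegrableOn u s) :
    IntegrableOn (fun x => (1 - c * sechSq p x) * u x) s :=
  Integrable.bdd_mul hu (continuous_const.sub ((continuous_sechSq p).const_mul c)).aestronglyMeasurable
    (Eventually.of_forall fun x => abs_sechSq_mul_sub_one_le p c x)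

theorem edgeBilin_integrable (p c : ℝ) {f g F G : ℝ → ℝ} (h : EdgeFun f g) (H : EdgeFun F G) :
    IntegrableOn (fun x => g x * G x + (1 - c * sechSq p x) * (f x * F x)) (Ioi 0) :=
  (h.memLp'.mul_integrable H.memLp').add
    (integrable_potential_mul p c (h.memLp.mul_integrable H.memLp))

theorem edgeQuad_integrable (p c : ℝ) {f g : ℝ → ℝ} (h : EdgeFun f g) :
    IntegrableOn (fun x => g x ^ 2 + (1 - c * sechSq p x) * f x ^ 2) (Ioi 0) :=
  h.sq_integrable'.add (integrable_potential_mul p c h.sq_integrable)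

theorem edgeQuad_add_const_mul (p c a : ℝ) {f g F G : ℝ → ℝ} (h : EdgeFun f g)
    (H : EdgeFun F G) :
    edgeQuad p c (fun x => f x + a * F x) (fun x => g x + a * G x) =
      edgeQuad p c f g + 2 * a * edgeBilin p c F G f g + a ^ 2 * edgeQuad p c F G := by
  rw [edgeQuad, edgeQuad, edgeBilin, edgeQuad, ← integral_add_mul_add_mul
    (edgeQuad_integrable p c h) (edgeBilin_integrable p c H h) (edgeQuad_integrable p c H)]
  refine integral_congr_ae (Eventually.of_forall fun x => ?_)
  simp only
  ring

/-- Green's formula for a profile m with m'' = V m - k: integrating by parts leaves the source k and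
the boundary term at the vertex. The next three lemmas are its instances for φ, ψ and η. -/
theorem edgeBilin_eq (p c : ℝ) {m m' : ℝ → ℝ} {f g k : ℝ → ℝ}
    (hm' : ∀ x, HasDerivAt m' ((1 - c * sechSq p x) * m x - k x) x)
    (dm : Decays m) (dm' : Decays m') (dk : Decays k) (h : EdgeFun f g) :
    edgeBilin p c m m' f g = (∫ x in Ioi 0, k x * f x) - m' 0 * f 0 := by
  have dm'' : Decays fun x => (1 - c * sechSq p x) * m x - k x := by
    simpa [sub_eq_add_neg] using (dm.potential_mul p c).add (dk.const_mul (-1))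
  obtain ⟨K, hK⟩ := dm'.bounded
  have i1 : IntegrableOn (fun x => m' x * g x) (Ioi 0) := dm'.memLp.mul_integrable h.memLp'
  have i2 : IntegrableOn (fun x => (1 - c * sechSq p x) * (m x * f x)) (Ioi 0) :=
    integrable_potential_mul p c (dm.memLp.mul_integrable h.memLp)
  have i3 : IntegrableOn (fun x => k x * f x) (Ioi 0) := dk.memLp.mul_integrable h.memLp
  have e := h.integral_by_parts hm' dm''.1 hK dm'.memLp dm''.memLp
  rw [edgeBilin, integral_add i1 i2, e]
  have e2 : (∫ x in Ioi 0, ((1 - c * sechSq p x) * m x - k x) * f x) =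
      (∫ x in Ioi 0, (1 - c * sechSq p x) * (m x * f x)) - ∫ x in Ioi 0, k x * f x := by
    rw [← integral_sub i2 i3]
    refine integral_congr_ae (Eventually.of_forall fun x => ?_)
    simp only
    ring
  rw [e2]; ring

/-- Here L₋φ = 0 and φ'(0) = 0, so neither a source nor a boundary term remains, whatever the value
of f at 0. -/
theorem edgeBilin_phi {p : ℝ} (hp : 0 < p) {f g : ℝ → ℝ} (h : EdgeFun f g) :
    edgeBilin p (p + 1) (phi p) (fun x => -psi p x) f g = 0 := by
  rw [edgeBilin_eq p (p + 1) (k := fun _ => 0) (fun x => ?_) (decays_phi hp)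
    (by simpa using (decays_psi hp).const_mul (-1))
    (by simpa using (decays_phi hp).const_mul 0) h]
  · simp [psi_zero]
  · refine (hasDerivAt_psi hp x).neg.congr_deriv ?_
    rw [dpsi]; ring

/-- Since ψ'(0) = p ≠ 0, the boundary term is removed by the Dirichlet condition on f. -/
theorem edgeBilin_psi {p : ℝ} (hp : 0 < p) {f g : ℝ → ℝ} (h : EdgeFun f g) (hf : f 0 = 0) :
    edgeBilin p ((p + 1) * (2 * p + 1)) (psi p) (dpsi p) f g = 0 := by
  rw [edgeBilin_eq p _ (k := fun _ => 0) (fun x => ?_) (decays_psi hp)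
    (decays_dpsi hp) (by simpa using (decays_phi hp).const_mul 0) h]
  · simp [hf]
  · simpa using hasDerivAt_dpsi hp x

/-- The source is -φ and η'(0) = 0: pairing with η reproduces the mass constraint, which is the
reason for introducing η. -/
theorem edgeBilin_eta {p : ℝ} (hp : 0 < p) {f g : ℝ → ℝ} (h : EdgeFun f g) :
    edgeBilin p ((p + 1) * (2 * p + 1)) (eta p) (deta p) f g = -∫ x in Ioi 0, phi p x * f x := by
  rw [edgeBilin_eq p _ (k := fun x => -phi p x) (fun x => ?_) (decays_eta hp)
    (decays_deta hp) (by simpa using (decays_phi hp).const_mul (-1)) h]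
  · simp [deta_zero, integral_neg]
  · simpa using hasDerivAt_deta hp x

theorem integral_phi_sq_pos {p : ℝ} (hp : 0 < p) : 0 < ∫ x in Ioi 0, phi p x ^ 2 := by
  rw [setIntegral_pos_iff_support_of_nonneg_ae (Eventually.of_forall fun x => sq_nonneg _)
    (edgeFun_phi hp).sq_integrable]
  have : Function.support (fun x => phi p x ^ 2) = univ :=
    Function.support_eq_univ fun x => (pow_pos (phi_pos p x) 2).ne'
  simp [this]

theorem psi_pos {p : ℝ} (hp : 0 < p) {x : ℝ} (hx : 0 < x) : 0 < psi p x := by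
  refine mul_pos (phi_pos p x) ?_
  rw [Real.tanh_eq_sinh_div_cosh]
  exact div_pos (Real.sinh_pos_iff.2 (mul_pos hp hx)) (Real.cosh_pos _)

theorem setIntegral_Ioi_pos {f : ℝ → ℝ} (hf : IntegrableOn f (Ioi 0))
    (h : ∀ x, 0 < x → 0 < f x) : 0 < ∫ x in Ioi 0, f x := by
  rw [setIntegral_pos_iff_support_of_nonneg_ae _ hf]
  · have : Ioi (0 : ℝ) ⊆ Function.support f := fun x hx => (h x hx).ne'
    rw [inter_eq_right.2 this]; simp
  · filter_upwards [ae_restrict_mem measurableSet_Ioi] with x hx using (h x hx).le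

/-- Integration by parts gives ∫ xφψ = ½ ∫ φ². The resulting factor changes sign at p = 2; this is
the slope condition on the mass of the soliton family. -/
theorem integral_phi_eta {p : ℝ} (hp : 0 < p) :
    (∫ x in Ioi 0, phi p x * eta p x) =
      (1 / (2 * p) - 1 / 4) * ∫ x in Ioi 0, phi p x ^ 2 := by
  have hx : EdgeFun (fun x => x * phi p x) (fun x => phi p x - x * psi p x) := by
    refine edgeFun_of_hasDerivAt (fun x => ?_) (decays_id_mul_phi hp) ?_
    · refine ((hasDerivAt_id x).mul (hasDerivAt_phi' hp x)).congr_deriv ?_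
      simp only [id]; ring
    · simpa [sub_eq_add_neg] using (decays_phi hp).add ((decays_id_mul_psi hp).const_mul (-1))
  obtain ⟨K, hK⟩ := (decays_phi hp).bounded
  have e := hx.integral_by_parts (hasDerivAt_phi' hp) (continuous_psi hp).neg hK
    (decays_phi hp).memLp (edgeFun_phi hp).memLp'
  have i1 : IntegrableOn (fun x => phi p x ^ 2) (Ioi 0) := (edgeFun_phi hp).sq_integrable
  have i2 : IntegrableOn (fun x => phi p x * (x * psi p x)) (Ioi 0) :=
    (decays_phi hp).memLp.mul_integrable (decays_id_mul_psi hp).memLp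
  have e1 : (∫ x in Ioi 0, phi p x * (phi p x - x * psi p x)) =
      (∫ x in Ioi 0, phi p x ^ 2) - ∫ x in Ioi 0, phi p x * (x * psi p x) := by
    rw [← integral_sub i1 i2]
    refine integral_congr_ae (Eventually.of_forall fun x => ?_)
    simp only
    ring
  have e2 : (∫ x in Ioi 0, -psi p x * (x * phi p x)) =
      -∫ x in Ioi 0, phi p x * (x * psi p x) := by
    rw [← integral_neg]
    refine integral_congr_ae (Eventually.of_forall fun x => ?_)
    simp only
    ring
  have e3 : (∫ x in Ioi 0, phi p x * eta p x) =
      1 / (2 * p) * (∫ x in Ioi 0, phi p x ^ 2) -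
        1 / 2 * ∫ x in Ioi 0, phi p x * (x * psi p x) := by
    rw [← integral_const_mul, ← integral_const_mul,
      ← integral_sub (i1.const_mul _) (i2.const_mul _)]
    refine integral_congr_ae (Eventually.of_forall fun x => ?_)
    simp only [eta]
    ring
  rw [e1, e2] at e
  rw [e3]
  linarith

end StarGraph

/-! ### Spectral gaps from Riccati supersolutions -/

namespace StarGraph

theorem tanh_mul_nonneg {p x : ℝ} (hp : 0 < p) (hx : 0 ≤ x) : 0 ≤ Real.tanh (p * x) := by
  rw [Real.tanh_eq_sinh_div_cosh]
  exact div_nonneg (Real.sinh_nonneg_iff.2 (by positivity)) (Real.cosh_pos _).le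

theorem tanh_mul_pos {p x : ℝ} (hp : 0 < p) (hx : 0 < x) : 0 < Real.tanh (p * x) := by
  rw [Real.tanh_eq_sinh_div_cosh]
  exact div_pos (Real.sinh_pos_iff.2 (by positivity)) (Real.cosh_pos _)

theorem sechSq_anti {p x y : ℝ} (hp : 0 < p) (hx : 0 ≤ x) (hxy : x ≤ y) :
    sechSq p y ≤ sechSq p x := by
  have h : Real.cosh (p * x) ≤ Real.cosh (p * y) := by
    rw [Real.cosh_le_cosh, abs_of_nonneg (by positivity),
      abs_of_nonneg (mul_nonneg hp.le (hx.trans hxy))]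
    gcongr
  have := Real.cosh_pos (p * x)
  unfold sechSq
  gcongr

theorem tanh_mul_mono {p x y : ℝ} (hp : 0 < p) (hx : 0 ≤ x) (hxy : x ≤ y) :
    Real.tanh (p * x) ≤ Real.tanh (p * y) := by
  have := sechSq_anti hp hx hxy
  refine le_of_sq_le_sq ?_ (tanh_mul_nonneg hp (hx.trans hxy))
  rw [tanh_sq, tanh_sq]; linarith

/-- `-∂² + 1 - (p+1) sech²(p x)` with a Dirichlet condition at `0` has a spectral gap. -/
theorem edgeQuad_gap_imag {p : ℝ} (hp : 0 < p) : ∃ κ > 0, ∀ f g : ℝ → ℝ, EdgeFun f g → f 0 = 0 →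
    κ * (∫ x in Ioi 0, f x ^ 2) ≤ edgeQuad p (p + 1) f g := by
  -- A uniform lower bound for e^{-x} + 2 tanh(px): the first term serves on [0, 1], the second
  -- beyond 1.
  obtain ⟨c, hc0, hc1, hc2⟩ : ∃ c : ℝ, 0 < c ∧ c ≤ Real.exp (-1) ∧ c ≤ 2 * Real.tanh (p * 1) :=
    ⟨min (Real.exp (-1)) (2 * Real.tanh (p * 1)),
      lt_min (Real.exp_pos _) (by have := tanh_mul_pos hp one_pos; linarith),
      min_le_left _ _, min_le_right _ _⟩
  have hc : ∀ x, 0 ≤ x → c ≤ Real.exp (-x) + 2 * Real.tanh (p * x) := by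
    intro x hx
    rcases le_total x 1 with h | h
    · have h1 : Real.exp (-1) ≤ Real.exp (-x) := Real.exp_le_exp.2 (by linarith)
      have := tanh_mul_nonneg hp hx
      linarith
    · have := tanh_mul_mono hp zero_le_one h
      have := Real.exp_pos (-x)
      linarith
  have hc8 : c ≤ 1 := hc1.trans (Real.exp_le_one_iff.2 (by norm_num))
  refine ⟨c ^ 2 / 16, by positivity, fun f g h hf => ?_⟩
  -- -tanh(px) = φ'/φ solves the Riccati equation of L₋ exactly. The correction (c/8)(1 + e^{-x})
  -- lowers S' + S² by at least c²/8 through its linear part and raises it by at most c²/16 through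
  -- its square, hence the gap c²/16.
  have hd : ∀ x : ℝ, HasDerivAt (fun x => -Real.tanh (p * x) + c / 8 * (1 + Real.exp (-x)))
      (-(p * sechSq p x) + c / 8 * (-Real.exp (-x))) x := fun x => by
    have h1 : HasDerivAt (fun x : ℝ => Real.exp (-x)) (-Real.exp (-x)) x := by
      simpa using (hasDerivAt_neg x).exp
    exact (hasDerivAt_tanh_mul p x).neg.add ((h1.const_add 1).const_mul (c / 8))
  refine h.riccati_Ioi le_rfl hf (K := 2) (fun x _ => hd x) ?_ ?_
    (continuous_const.sub ((continuous_sechSq p).const_mul (p + 1)))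
    (abs_sechSq_mul_sub_one_le p (p + 1)) ?_
  · have := continuous_sechSq p
    fun_prop
  · intro x hx
    have h1 := (abs_lt.1 (Real.abs_tanh_lt_one (p * x)))
    have h2 := Real.exp_pos (-x)
    have h3 : Real.exp (-x) ≤ 1 := Real.exp_le_one_iff.2 (by linarith)
    rw [abs_le]
    constructor <;> nlinarith
  · intro x hx
    have h2 := Real.exp_pos (-x)
    have h3 : Real.exp (-x) ≤ 1 := Real.exp_le_one_iff.2 (by linarith)
    have h4 := hc x hx
    have h5 := tanh_sq p x
    have h6 := tanh_mul_nonneg hp hx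
    have h7 : (1 + Real.exp (-x)) ^ 2 ≤ 4 := by nlinarith
    have h8 : 0 ≤ c * (Real.tanh (p * x) * Real.exp (-x)) := by positivity
    have h9 := mul_le_mul_of_nonneg_left h4 hc0.le
    have h10 := mul_le_mul_of_nonneg_left h7 (sq_nonneg c)
    nlinarith

/-- Cauchy–Schwarz, read off from the nonnegative variance of g about its mean f(x)/x on (0, x). It
makes f²/x vanish as x → 0, which tames the 1/x singularity of ψ'/ψ at the vertex. -/
theorem sq_le_mul_integral_sq {f g : ℝ → ℝ} (h : EdgeFun f g) (hf : f 0 = 0) {x : ℝ}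
    (hx : 0 < x) : f x ^ 2 ≤ x * ∫ t in (0 : ℝ)..x, g t ^ 2 := by
  have hi : IntervalIntegrable g volume 0 x := (h.primOn le_rfl hx.le).int
  have hi2 : IntervalIntegrable (fun t => g t ^ 2) volume 0 x := by
    rw [intervalIntegrable_iff_integrableOn_Ioc_of_le hx.le]
    exact h.sq_integrable'.mono_set Ioc_subset_Ioi_self
  have e := h.eq x hx.le
  rw [hf, zero_add] at e
  have h0 : 0 ≤ ∫ t in (0 : ℝ)..x, (g t - f x / x) ^ 2 :=
    intervalIntegral.integral_nonneg hx.le fun t _ => sq_nonneg _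
  have e1 : (∫ t in (0 : ℝ)..x, (g t - f x / x) ^ 2) =
      (∫ t in (0 : ℝ)..x, g t ^ 2) - 2 * (f x / x) * f x + (f x / x) ^ 2 * x := by
    have : ∀ t, (g t - f x / x) ^ 2 = g t ^ 2 - 2 * (f x / x) * g t + (f x / x) ^ 2 :=
      fun t => by ring
    simp_rw [this]
    rw [intervalIntegral.integral_add (hi2.sub (hi.const_mul _)) (by simp),
      intervalIntegral.integral_sub hi2 (hi.const_mul _), intervalIntegral.integral_const_mul, ← e,
      intervalIntegral.integral_const]
    simp only [smul_eq_mul]; ring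
  rw [e1] at h0
  have e2 : (∫ t in (0 : ℝ)..x, g t ^ 2) - 2 * (f x / x) * f x + (f x / x) ^ 2 * x =
    (∫ t in (0 : ℝ)..x, g t ^ 2) - f x ^ 2 / x := by field_simp; ring
  rw [e2, sub_nonneg, div_le_iff₀ hx] at h0
  linarith

/-- A Riccati supersolution on `(0, b]` with a singularity `1/x` at `0` yields a spectral gap for
functions vanishing at `0` and `b`. -/
theorem riccati_Ioc {f g : ℝ → ℝ} (h : EdgeFun f g) {b : ℝ} (hb : 0 < b) (hf0 : f 0 = 0)
    (hfb : f b = 0) {S S' V : ℝ → ℝ} {κ C : ℝ}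
    (hS : ∀ x, 0 < x → HasDerivAt S (S' x) x) (hS' : ContinuousOn S' (Ioi 0))
    (hS1 : ∀ x, 0 < x → S x ≤ 1 / x) (hV : Continuous V) (hVC : ∀ x, |V x| ≤ C)
    (hSV : ∀ x, 0 < x → x ≤ b → S' x + S x ^ 2 ≤ V x - κ) :
    κ * (∫ x in (0 : ℝ)..b, f x ^ 2) ≤ ∫ x in (0 : ℝ)..b, (g x ^ 2 + V x * f x ^ 2) := by
  have i1 := h.sq_integrable
  have i2 := h.sq_integrable'
  have i3 : IntegrableOn (fun x => V x * f x ^ 2) (Ioi 0) :=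
    i1.bdd_mul hV.aestronglyMeasurable (Eventually.of_forall hVC)
  have I : ∀ {u : ℝ → ℝ}, IntegrableOn u (Ioi 0) → ∀ {x y : ℝ}, 0 ≤ x → x ≤ y →
      IntervalIntegrable u volume x y := fun hu x y hx hxy => by
    rw [intervalIntegrable_iff_integrableOn_Ioc_of_le hxy]
    exact hu.mono_set fun t ht => lt_of_le_of_lt hx ht.1
  have i4 : IntegrableOn (fun x => g x ^ 2 + (V x - κ) * f x ^ 2) (Ioi 0) := by
    have := (i2.add i3).sub (i1.const_mul κ)
    refine this.congr (Eventually.of_forall fun x => ?_)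
    simp only [Pi.add_apply, Pi.sub_apply]; ring
  have e : (∫ x in (0 : ℝ)..b, (g x ^ 2 + (V x - κ) * f x ^ 2)) =
      (∫ x in (0 : ℝ)..b, (g x ^ 2 + V x * f x ^ 2)) - κ * ∫ x in (0 : ℝ)..b, f x ^ 2 := by
    rw [← intervalIntegral.integral_const_mul]
    refine Eq.trans ?_ (intervalIntegral.integral_sub (I (i2.add i3) le_rfl hb.le)
      (I (i1.const_mul κ) le_rfl hb.le))
    congr 1
    funext x
    ring
  suffices 0 ≤ ∫ x in (0 : ℝ)..b, (g x ^ 2 + (V x - κ) * f x ^ 2) by linarith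
  have key : ∀ x, 0 < x → x < b → -(∫ t in (0 : ℝ)..x, g t ^ 2) ≤
      (∫ t in (0 : ℝ)..b, (g t ^ 2 + (V t - κ) * f t ^ 2)) -
        ∫ t in (0 : ℝ)..x, (g t ^ 2 + (V t - κ) * f t ^ 2) := by
    intro x hx hxb
    rw [intervalIntegral.integral_interval_sub_left (I i4 le_rfl hb.le) (I i4 le_rfl hx.le)]
    have := (h.primOn hx.le hxb.le).riccati hxb.le (PrimOn.of_hasDerivAt hxb.le
      (fun y hy => hS y (hx.trans_le hy.1)) (hS'.mono fun y hy => hx.trans_le hy.1))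
      (V := fun x => V x - κ) (by fun_prop) (fun y hy => hSV y (hx.trans_le hy.1) hy.2)
      (I i2 hx.le hxb.le)
    refine le_trans ?_ this
    -- The boundary term at x satisfies S(x) f(x)² ≤ f(x)²/x ≤ ∫₀ˣ g², which tends to 0 with x.
    have h1 := sq_le_mul_integral_sq h hf0 hx
    have h2 := mul_le_mul_of_nonneg_right (hS1 x hx) (sq_nonneg (f x))
    have h3 := mul_le_mul_of_nonneg_left h1 (by positivity : 0 ≤ 1 / x)
    have h4 : 1 / x * (x * ∫ t in (0 : ℝ)..x, g t ^ 2) = ∫ t in (0 : ℝ)..x, g t ^ 2 := by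
      field_simp
    rw [hfb]
    linarith
  have lim : ∀ {u : ℝ → ℝ}, IntegrableOn u (Ioi 0) →
      Tendsto (fun x => ∫ t in (0 : ℝ)..x, u t) (𝓝[>] 0) (𝓝 0) := fun {u} hu => by
    have hc := intervalIntegral.continuousOn_primitive_interval (a := 0) (b := 1) (f := u)
      (μ := volume) (by
        rw [uIcc_of_le zero_le_one]
        exact (intervalIntegrable_iff_integrableOn_Icc_of_le zero_le_one).1 (I hu le_rfl zero_le_one))
    have := (hc 0 left_mem_uIcc).tendsto
    rw [intervalIntegral.integral_same, uIcc_of_le zero_le_one] at this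
    refine this.mono_left ?_
    rw [nhdsWithin_le_iff]
    exact mem_of_superset (Ioc_mem_nhdsGT zero_lt_one) Ioc_subset_Icc_self
  have t1 := (lim i2).neg
  have t2 := (lim i4).const_sub (∫ t in (0 : ℝ)..b, (g t ^ 2 + (V t - κ) * f t ^ 2))
  rw [neg_zero] at t1
  rw [sub_zero] at t2
  refine le_of_tendsto_of_tendsto t1 t2 ?_
  filter_upwards [Ioo_mem_nhdsGT hb] with x hx using key x hx.1 hx.2

/-- `ψ'/ψ`. -/
noncomputable def psiLog (p x : ℝ) : ℝ := p * sechSq p x / Real.tanh (p * x) - Real.tanh (p * x)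

/-- Riccati equation attached to L₊ψ = 0; it holds only for x > 0 because ψ vanishes at 0. -/
theorem hasDerivAt_psiLog {p : ℝ} (hp : 0 < p) {x : ℝ} (hx : 0 < x) :
    HasDerivAt (psiLog p) (1 - (p + 1) * (2 * p + 1) * sechSq p x - psiLog p x ^ 2) x := by
  have ht := (tanh_mul_pos hp hx).ne'
  refine ((((hasDerivAt_sechSq p x).const_mul p).div (hasDerivAt_tanh_mul p x) ht).sub
    (hasDerivAt_tanh_mul p x)).congr_deriv ?_
  have h := tanh_sq p x
  rw [psiLog]
  field_simp
  rw [h]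
  ring

/-- The singular part equals p / (sinh(px) cosh(px)), and sinh y cosh y ≥ y for y ≥ 0. -/
theorem psiLog_le {p : ℝ} (hp : 0 < p) {x : ℝ} (hx : 0 < x) : psiLog p x ≤ 1 / x := by
  have ht := tanh_mul_pos hp hx
  have hs : Real.sinh (p * x) ≥ p * x := Real.self_le_sinh_iff.2 (by positivity)
  have hc := Real.one_le_cosh (p * x)
  have hpx : 0 < p * x := by positivity
  have e : p * sechSq p x / Real.tanh (p * x) = p / (Real.sinh (p * x) * Real.cosh (p * x)) := by
    rw [sechSq, Real.tanh_eq_sinh_div_cosh]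
    have : 0 < Real.sinh (p * x) := hpx.trans_le hs
    field_simp
  rw [psiLog, e]
  have h1 : p / (Real.sinh (p * x) * Real.cosh (p * x)) ≤ p / (p * x) :=
    div_le_div_of_nonneg_left hp.le hpx (by nlinarith)
  have h2 : p / (p * x) = 1 / x := by field_simp
  linarith

/-- `-∂² + 1 - (p+1)(2p+1) sech²(p x)` has a spectral gap on functions which vanish at `0` and at
a suitable interior point. -/
theorem edgeQuad_gap_real {p : ℝ} (hp : 0 < p) : ∃ κ > 0, ∃ x₀ > 0, ∀ f g : ℝ → ℝ, EdgeFun f g →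
    f 0 = 0 → f x₀ = 0 →
    κ * (∫ x in Ioi 0, f x ^ 2) ≤ edgeQuad p ((p + 1) * (2 * p + 1)) f g := by
  -- Beyond b one has p sech² ≤ tanh²/2, so ψ'/ψ stays below -T/2 there, with T = tanh(pb).
  obtain ⟨b, hb, hsb⟩ : ∃ b : ℝ, 0 < b ∧ sechSq p b ≤ 1 / (2 * p + 1) := by
    refine ⟨(2 * p + 1) / p, by positivity, ?_⟩
    have e : p * ((2 * p + 1) / p) = 2 * p + 1 := by field_simp
    have hs : Real.sinh (2 * p + 1) ≥ 2 * p + 1 := Real.self_le_sinh_iff.2 (by positivity)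
    have hc := Real.cosh_sq (2 * p + 1)
    rw [sechSq, e, ← one_div]
    gcongr
    nlinarith
  have hV : Continuous fun x => 1 - (p + 1) * (2 * p + 1) * sechSq p x :=
    continuous_const.sub ((continuous_sechSq p).const_mul _)
  have hVC := abs_sechSq_mul_sub_one_le p ((p + 1) * (2 * p + 1))
  set T := Real.tanh (p * b) with hT
  have hT0 : 0 < T := tanh_mul_pos hp hb
  have hT1 : T < 1 := (abs_lt.1 (Real.abs_tanh_lt_one (p * b))).2
  have hcontS : ContinuousOn (psiLog p) (Ioi 0) := fun x hx =>
    (hasDerivAt_psiLog hp hx).continuousAt.continuousWithinAt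
  have hlow : ∀ x, 0 < x → -1 ≤ psiLog p x := fun x hx => by
    have h1 := tanh_mul_pos hp hx
    have h2 := (abs_lt.1 (Real.abs_tanh_lt_one (p * x))).2
    have h3 := sechSq_pos p x
    have : 0 ≤ p * sechSq p x / Real.tanh (p * x) := by positivity
    rw [psiLog]; linarith
  have hup : ∀ x, b ≤ x → psiLog p x ≤ -(T / 2) := fun x hx => by
    have hx0 := hb.trans_le hx
    have h1 := tanh_mul_pos hp hx0
    have h2 : T ≤ Real.tanh (p * x) := tanh_mul_mono hp hb.le hx
    have h3 := (sechSq_anti hp hb.le hx).trans hsb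
    have h4 := tanh_sq p x
    have h5 : p * sechSq p x / Real.tanh (p * x) ≤ Real.tanh (p * x) / 2 := by
      rw [div_le_iff₀ h1]
      rw [le_div_iff₀ (by positivity)] at h3
      nlinarith
    rw [psiLog]; linarith
  refine ⟨min (T ^ 2 / 4) (Real.exp (-(3 * b)) / 4),
    lt_min (by positivity) (by have := Real.exp_pos (-(3 * b)); positivity), b, hb,
    fun f g h hf0 hfb => ?_⟩
  -- Shifting S = ψ'/ψ by T/2 changes S² by T S + T²/4 ≤ -T²/4, since S ≤ -T/2 on [b, ∞).
  have h1 := h.riccati_Ioi hb.le hfb (S := fun x => psiLog p x + T / 2) (κ := T ^ 2 / 4) (K := 2)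
    (fun x hx => (hasDerivAt_psiLog hp (hb.trans_le hx)).add_const (T / 2))
    ((hV.continuousOn.sub (hcontS.pow 2)).mono fun x hx => hb.trans_le hx)
    (fun x hx => by
      have := hup x hx
      have := hlow x (hb.trans_le hx)
      rw [abs_le]; constructor <;> linarith) hV hVC
    (fun x hx => by
      have := hup x hx
      nlinarith)
  -- On (0, b] the term σ = ε e^{3x} is subtracted. The change in S' + S² is -3σ - 2σ ψ'/ψ + σ²;
  -- since ψ'/ψ ≥ -1 and σ ≤ 1/2 there, it is at most -σ/2 ≤ -ε/2. The rate 3 is what beats the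
  -- lower bound -1, and ε is scaled so that σ ≤ 1/2 up to x = b.
  set ε := Real.exp (-(3 * b)) / 2 with hε
  have hε0 : 0 < ε := by have := Real.exp_pos (-(3 * b)); positivity
  have hexp : ∀ x : ℝ, HasDerivAt (fun x : ℝ => Real.exp (3 * x)) (3 * Real.exp (3 * x)) x :=
    fun x => by
      have := ((hasDerivAt_id x).const_mul 3).exp
      simpa [mul_comm] using this
  have h2 := riccati_Ioc h hb hf0 hfb (S := fun x => psiLog p x - ε * Real.exp (3 * x))
    (κ := Real.exp (-(3 * b)) / 4)
    (fun x hx => (hasDerivAt_psiLog hp hx).sub ((hexp x).const_mul ε))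
    ((hV.continuousOn.sub (hcontS.pow 2)).sub (by fun_prop))
    (fun x hx => by
      have := psiLog_le hp hx
      have : 0 ≤ ε * Real.exp (3 * x) := by positivity
      linarith) hV hVC
    (fun x hx hxb => by
      have h3 := hlow x hx
      have h4 : Real.exp (-(3 * b)) * Real.exp (3 * x) ≤ 1 := by
        rw [← Real.exp_add]; exact Real.exp_le_one_iff.2 (by linarith)
      have h5 : 1 ≤ Real.exp (3 * x) := Real.one_le_exp (by positivity)
      set σ := ε * Real.exp (3 * x) with hσ
      have h6 : σ ≤ 1 / 2 := by rw [hσ, hε]; linarith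
      have h7 : ε ≤ σ := le_mul_of_one_le_right hε0.le h5
      have h8 : Real.exp (-(3 * b)) / 4 = ε / 2 := by rw [hε]; ring
      rw [h8]
      rw [show ε * (3 * Real.exp (3 * x)) = 3 * σ by rw [hσ]; ring]
      nlinarith)
  have i0 := edgeQuad_integrable p ((p + 1) * (2 * p + 1)) h
  have split : ∀ {u : ℝ → ℝ}, IntegrableOn u (Ioi 0) →
      (∫ x in Ioi 0, u x) = (∫ x in (0 : ℝ)..b, u x) + ∫ x in Ioi b, u x := fun {u} hu => by
    rw [intervalIntegral.integral_of_le hb.le, ← setIntegral_union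
      (Ioc_disjoint_Ioi le_rfl) measurableSet_Ioi (hu.mono_set Ioc_subset_Ioi_self)
      (hu.mono_set (Ioi_subset_Ioi hb.le)), Ioc_union_Ioi_eq_Ioi hb.le]
  rw [edgeQuad, split i0, split h.sq_integrable, mul_add]
  refine add_le_add (le_trans ?_ h2) (le_trans ?_ h1)
  · exact mul_le_mul_of_nonneg_right (min_le_right _ _)
      (intervalIntegral.integral_nonneg hb.le fun x _ => sq_nonneg _)
  · exact mul_le_mul_of_nonneg_right (min_le_left _ _) (integral_nonneg fun x => sq_nonneg _)

end StarGraph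

/-! ### Pointwise estimates of the nonlinearity -/

namespace StarGraph

/-- Bernoulli's inequality for (a/b)^r, that is, the convexity of the power function. -/
theorem rpow_sub_rpow_le {a b r : ℝ} (ha : 0 ≤ a) (hb : 0 < b) (hr : 1 ≤ r) :
    b ^ r - a ^ r ≤ r * b ^ (r - 1) * (b - a) := by
  have h := one_add_mul_self_le_rpow_one_add (s := a / b - 1) (by
    have : 0 ≤ a / b := by positivity
    linarith) hr
  rw [show 1 + (a / b - 1) = a / b by ring, Real.div_rpow ha hb.le,
    le_div_iff₀ (by positivity)] at h
  rw [Real.rpow_sub_one hb.ne']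
  have e : (1 + r * (a / b - 1)) * b ^ r = b ^ r - r * (b ^ r / b) * (b - a) := by
    field_simp; ring
  linarith

/-- The derivative of `z ↦ ‖z‖ ^ r • z`. -/
noncomputable def powDeriv (r : ℝ) (z : ℂ) : ℂ →L[ℝ] ℂ :=
  ‖z‖ ^ r • ContinuousLinearMap.id ℝ ℂ + (r * ‖z‖ ^ (r - 2)) • (innerSL ℝ z).smulRight z

theorem powDeriv_apply (r : ℝ) (z w : ℂ) :
    powDeriv r z w = ‖z‖ ^ r • w + (r * ‖z‖ ^ (r - 2)) • (⟪z, w⟫_ℝ • z) := by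
  simp [powDeriv]

/-- Away from 0 this is the product rule for (‖z‖²)^{r/2} z. At 0 the map is o(‖z‖) because ‖w‖^r ≤
‖w‖ near 0. -/
theorem hasFDerivAt_norm_rpow_smul {r : ℝ} (hr : 1 ≤ r) (z : ℂ) :
    HasFDerivAt (fun z : ℂ => ‖z‖ ^ r • z) (powDeriv r z) z := by
  rcases eq_or_ne z 0 with rfl | hz
  · have h0 : powDeriv r 0 = 0 := by
      ext w; all_goals simp [powDeriv_apply, Real.zero_rpow (by linarith : r ≠ 0)]
    rw [h0, hasFDerivAt_iff_isLittleO_nhds_zero]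
    simp only [zero_add, norm_zero, smul_zero, sub_zero, zero_apply]
    rw [Asymptotics.isLittleO_iff]
    intro c hc
    have : ∀ᶠ w : ℂ in 𝓝 0, ‖w‖ < min c 1 := by
      have := Metric.ball_mem_nhds (0 : ℂ) (lt_min hc one_pos)
      filter_upwards [this] with w hw using by simpa using hw
    filter_upwards [this] with w hw
    rw [norm_smul, Real.norm_of_nonneg (by positivity)]
    refine mul_le_mul_of_nonneg_right ?_ (norm_nonneg _)
    have h1 : ‖w‖ ^ r ≤ ‖w‖ ^ (1 : ℝ) :=
      Real.rpow_le_rpow_of_exponent_ge_of_imp (norm_nonneg _) (hw.le.trans (min_le_right _ _)) hr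
        (by intro _ h; linarith)
    rw [Real.rpow_one] at h1
    exact h1.trans (hw.le.trans (min_le_left _ _))
  · have hz' : 0 < ‖z‖ := norm_pos_iff.2 hz
    have h1 : HasFDerivAt (fun z : ℂ => ‖z‖ ^ 2) (2 • innerSL ℝ z) z :=
      (hasStrictFDerivAt_norm_sq z).hasFDerivAt
    have h2 := h1.rpow_const (p := r / 2) (Or.inl (by positivity))
    have e : ∀ s : ℝ, ∀ w : ℂ, (‖w‖ ^ 2) ^ (s / 2) = ‖w‖ ^ s := fun s w => by
      rw [← Real.rpow_natCast, ← Real.rpow_mul (norm_nonneg _)]; congr 1; push_cast; ring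
    simp only [e] at h2
    rw [show r / 2 - 1 = (r - 2) / 2 by ring, e] at h2
    refine (h2.smul (hasFDerivAt_id z)).congr_fderiv ?_
    ext w
    all_goals
      simp [powDeriv]
      ring

/-- The larger modulus carries all the powers. For r < 2 the factor ‖z‖^{r-2} is singular at 0, but
it always meets two further factors of modulus, so only ‖z‖^{r-1} survives; this needs r ≥ 1. -/
theorem norm_powDeriv_sub_le_aux {r : ℝ} (hr : 1 ≤ r) {z z' : ℂ} (hz : z ≠ 0)
    (hzz : ‖z'‖ ≤ ‖z‖) (w : ℂ) :
    ‖powDeriv r z w - powDeriv r z' w‖ ≤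
      ‖z‖ ^ (r - 1) * (r * (r + 5)) * ‖z - z'‖ * ‖w‖ := by
  set b := ‖z‖ with hb
  set a := ‖z'‖ with ha
  have hb0 : 0 < b := norm_pos_iff.2 hz
  have ha0 : 0 ≤ a := norm_nonneg _
  have hd : b - a ≤ ‖z - z'‖ := norm_sub_norm_le _ _
  have hd0 : 0 ≤ b - a := by linarith
  have hB : 0 < b ^ (r - 1) := by positivity
  have h1 : b ^ r - a ^ r ≤ r * b ^ (r - 1) * (b - a) := rpow_sub_rpow_le ha0 hb0 hr
  have h1' : 0 ≤ b ^ r - a ^ r := sub_nonneg.2 (Real.rpow_le_rpow ha0 hzz (by linarith))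
  have e1 : b ^ (r - 2) * b = b ^ (r - 1) := by
    rw [← Real.rpow_add_one hb0.ne']; congr 1; ring
  have e2 : b ^ (r - 2) * b ^ 2 = b ^ r := by
    rw [← Real.rpow_natCast, ← Real.rpow_add hb0]; congr 1; push_cast; ring
  -- At a = 0 both sides vanish, whatever value `rpow` gives to 0^(r-2).
  have e3 : a ^ (r - 2) * a ^ 2 = a ^ r := by
    rcases ha0.eq_or_lt with h | h
    · rw [← h, Real.zero_rpow (by linarith : r ≠ 0)]; simp
    · rw [← Real.rpow_natCast, ← Real.rpow_add h]; congr 1; push_cast; ring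
  have hbr : 0 < b ^ (r - 2) := by positivity
  have h2 : |b ^ (r - 2) - a ^ (r - 2)| * a ^ 2 ≤ (r + 2) * b ^ (r - 1) * (b - a) := by
    rw [show |b ^ (r - 2) - a ^ (r - 2)| * a ^ 2 = |(b ^ (r - 2) - a ^ (r - 2)) * a ^ 2| by
      rw [abs_mul, abs_of_nonneg (sq_nonneg a)], sub_mul, e3, abs_le]
    have h3 : b ^ (r - 2) * a ^ 2 ≤ b ^ (r - 2) * b ^ 2 := by gcongr
    have h5 : b ^ (r - 2) * (b ^ 2 - a ^ 2) ≤ b ^ (r - 2) * (2 * b * (b - a)) :=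
      mul_le_mul_of_nonneg_left (by nlinarith) hbr.le
    have h6 : b ^ (r - 2) * (2 * b * (b - a)) = 2 * b ^ (r - 1) * (b - a) := by rw [← e1]; ring
    have h7 : 0 ≤ b ^ (r - 1) * (b - a) := by positivity
    have h8 : 0 ≤ r * (b ^ (r - 1) * (b - a)) := by positivity
    constructor <;> nlinarith
  -- Telescoping in one factor at a time: first the scalar powers, then the two occurrences of z in
  -- ⟪z, w⟫ z.
  have key : powDeriv r z w - powDeriv r z' w = (b ^ r - a ^ r) • w +
      r • ((b ^ (r - 2) - a ^ (r - 2)) • (⟪z', w⟫_ℝ • z') +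
        b ^ (r - 2) • (⟪z - z', w⟫_ℝ • z + ⟪z', w⟫_ℝ • (z - z'))) := by
    rw [powDeriv_apply, powDeriv_apply, inner_sub_left]
    simp only [smul_sub, sub_smul, smul_add, smul_smul, sub_mul]
    simp only [← hb, ← ha]
    module
  have n1 : ‖(b ^ r - a ^ r) • w‖ ≤ r * b ^ (r - 1) * ‖z - z'‖ * ‖w‖ := by
    rw [norm_smul, Real.norm_of_nonneg h1']
    refine mul_le_mul_of_nonneg_right (h1.trans ?_) (norm_nonneg _)
    gcongr
  have n2 : ‖(b ^ (r - 2) - a ^ (r - 2)) • (⟪z', w⟫_ℝ • z')‖ ≤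
      (r + 2) * b ^ (r - 1) * ‖z - z'‖ * ‖w‖ := by
    rw [norm_smul, norm_smul, Real.norm_eq_abs, Real.norm_eq_abs]
    have hi : |⟪z', w⟫_ℝ| ≤ a * ‖w‖ := abs_real_inner_le_norm _ _
    calc |b ^ (r - 2) - a ^ (r - 2)| * (|⟪z', w⟫_ℝ| * ‖z'‖)
        ≤ |b ^ (r - 2) - a ^ (r - 2)| * (a * ‖w‖ * a) := by gcongr
      _ = |b ^ (r - 2) - a ^ (r - 2)| * a ^ 2 * ‖w‖ := by ring
      _ ≤ (r + 2) * b ^ (r - 1) * (b - a) * ‖w‖ := by gcongr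
      _ ≤ _ := by gcongr
  have n3 : ‖b ^ (r - 2) • (⟪z - z', w⟫_ℝ • z + ⟪z', w⟫_ℝ • (z - z'))‖ ≤
      2 * b ^ (r - 1) * ‖z - z'‖ * ‖w‖ := by
    rw [norm_smul, Real.norm_of_nonneg hbr.le]
    have hi : |⟪z', w⟫_ℝ| ≤ b * ‖w‖ := (abs_real_inner_le_norm _ _).trans (by gcongr)
    have hi' : |⟪z - z', w⟫_ℝ| ≤ ‖z - z'‖ * ‖w‖ := abs_real_inner_le_norm _ _
    calc b ^ (r - 2) * ‖⟪z - z', w⟫_ℝ • z + ⟪z', w⟫_ℝ • (z - z')‖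
        ≤ b ^ (r - 2) * (‖z - z'‖ * ‖w‖ * b + b * ‖w‖ * ‖z - z'‖) := by
          refine mul_le_mul_of_nonneg_left ((norm_add_le _ _).trans ?_) hbr.le
          rw [norm_smul, norm_smul, Real.norm_eq_abs, Real.norm_eq_abs]
          gcongr
      _ = 2 * (b ^ (r - 2) * b) * ‖z - z'‖ * ‖w‖ := by ring
      _ = _ := by rw [e1]
  rw [key]
  have hr0 : 0 ≤ r := by linarith
  calc _ ≤ r * b ^ (r - 1) * ‖z - z'‖ * ‖w‖ + r * ((r + 2) * b ^ (r - 1) * ‖z - z'‖ * ‖w‖ +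
        2 * b ^ (r - 1) * ‖z - z'‖ * ‖w‖) := by
        refine (norm_add_le _ _).trans (add_le_add n1 ?_)
        rw [norm_smul, Real.norm_of_nonneg hr0]
        exact mul_le_mul_of_nonneg_left ((norm_add_le _ _).trans (add_le_add n2 n3)) hr0
    _ = _ := by ring

/-- `powDeriv r` is Lipschitz on bounded sets when `1 ≤ r`. -/
theorem norm_powDeriv_sub_le {r M : ℝ} (hr : 1 ≤ r) {z z' : ℂ} (hz : ‖z‖ ≤ M) (hz' : ‖z'‖ ≤ M) :
    ‖powDeriv r z - powDeriv r z'‖ ≤ M ^ (r - 1) * (r * (r + 5)) * ‖z - z'‖ := by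
  have hM : 0 ≤ M := (norm_nonneg _).trans hz
  refine ContinuousLinearMap.opNorm_le_bound _ (by positivity) fun w => ?_
  rw [sub_apply]
  wlog h : ‖z'‖ ≤ ‖z‖ generalizing z z'
  · have := this hz' hz (le_of_not_ge h)
    rwa [norm_sub_rev, norm_sub_rev z'] at this
  rcases eq_or_ne z 0 with rfl | h0
  · have : z' = 0 := by simpa using h
    simp [this]
  refine (norm_powDeriv_sub_le_aux hr h0 h w).trans ?_
  gcongr

/-- The remainder `N(s + v) - N(s) - N'(s) v` for `N(z) = ‖z‖ ^ r z`, at a positive real `s`. -/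
noncomputable def gradRem (r s : ℝ) (v : ℂ) : ℂ :=
  ‖(s : ℂ) + v‖ ^ r • ((s : ℂ) + v) - ((s ^ (r + 1) : ℝ) : ℂ) - s ^ r • (v + ((r * v.re : ℝ) : ℂ))

/-- The remainder of the second-order expansion of `‖s + v‖ ^ (r + 2)` at a positive real `s`. -/
noncomputable def potRem (r s : ℝ) (v : ℂ) : ℝ :=
  ‖(s : ℂ) + v‖ ^ (r + 2) - s ^ (r + 2) - (r + 2) * (s ^ (r + 1) * v.re) -
    (r + 2) / 2 * (s ^ r * (‖v‖ ^ 2 + r * v.re ^ 2))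

theorem gradRem_zero {r s : ℝ} (hs : 0 < s) : gradRem r s 0 = 0 := by
  simp [gradRem, abs_of_pos hs, Real.rpow_add_one hs.ne']

theorem potRem_zero {r s : ℝ} (hs : 0 < s) : potRem r s 0 = 0 := by
  simp [potRem, abs_of_pos hs]

theorem powDeriv_ofReal {r s : ℝ} (hs : 0 < s) (v : ℂ) :
    powDeriv r (s : ℂ) v = s ^ r • (v + ((r * v.re : ℝ) : ℂ)) := by
  have e : s ^ r = s ^ (r - 2) * (s * s) := by
    rw [← sq, ← Real.rpow_natCast, ← Real.rpow_add hs]; congr 1; push_cast; ring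
  rw [powDeriv_apply, Complex.norm_real, Real.norm_of_nonneg hs.le, Complex.inner, smul_add]
  congr 1
  rw [Complex.conj_ofReal, mul_comm v, Complex.re_ofReal_mul, Complex.real_smul, e]
  simp only [Complex.real_smul]
  push_cast
  ring

/-- `gradRem` is N minus its affine Taylor polynomial at s, so on the ball of radius ρ its
derivative is N'(s + v) - N'(s) = O(ρ). The constant does not depend on s in (0, 1], as it must not,
because s will be φ(x), which tends to 0. -/
theorem gradRem_lipschitz {r : ℝ} (hr : 1 ≤ r) : ∃ L > 0, ∀ s : ℝ, 0 < s → s ≤ 1 →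
    ∀ ρ ≤ (1 : ℝ), ∀ v v' : ℂ, ‖v‖ ≤ ρ → ‖v'‖ ≤ ρ →
      ‖gradRem r s v - gradRem r s v'‖ ≤ L * ρ * ‖v - v'‖ := by
  refine ⟨2 ^ (r - 1) * (r * (r + 5)), by positivity, fun s hs hs1 ρ hρ v v' hv hv' => ?_⟩
  have hns : ‖(s : ℂ)‖ ≤ 2 := by rw [Complex.norm_real, Real.norm_of_nonneg hs.le]; linarith
  have h := Convex.norm_image_sub_le_of_norm_hasFDerivWithin_le' (𝕜 := ℝ)
    (f := fun z : ℂ => ‖z‖ ^ r • z) (f' := powDeriv r) (φ := powDeriv r s)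
    (s := Metric.closedBall (s : ℂ) ρ) (x := s + v') (y := s + v)
    (C := 2 ^ (r - 1) * (r * (r + 5)) * ρ)
    (fun z _ => (hasFDerivAt_norm_rpow_smul hr z).hasFDerivWithinAt)
    (fun z hz => by
      have hz1 : ‖z - s‖ ≤ ρ := by simpa [dist_eq_norm] using hz
      have hz2 : ‖z‖ ≤ 2 := by
        have := norm_add_le (z - s) (s : ℂ)
        rw [sub_add_cancel, Complex.norm_real, Real.norm_of_nonneg hs.le] at this
        linarith
      refine (norm_powDeriv_sub_le hr hz2 hns).trans ?_
      gcongr)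
    (convex_closedBall _ _) (by simpa [dist_eq_norm] using hv') (by simpa [dist_eq_norm] using hv)
  rw [add_sub_add_left_eq_sub] at h
  refine le_trans (le_of_eq ?_) h
  congr 1
  rw [powDeriv_ofReal hs]
  simp only [gradRem, Complex.real_smul, Complex.sub_re]
  push_cast
  ring

/-- The gradient of `potRem` is (r + 2) times `gradRem`, so bounds on the potential follow from
bounds on the gradient along segments. -/
theorem hasDerivAt_potRem {r : ℝ} (hr : 1 ≤ r) (s : ℝ) (m d : ℂ) (t : ℝ) :
    HasDerivAt (fun t : ℝ => potRem r s (m + t • d))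
      ((r + 2) * ⟪gradRem r s (m + t • d), d⟫_ℝ) t := by
  have hl : HasDerivAt (fun t : ℝ => m + t • d) d t := by
    simpa using ((hasDerivAt_id t).smul_const d).const_add m
  have hl2 : HasDerivAt (fun t : ℝ => (s : ℂ) + (m + t • d)) d t := hl.const_add _
  have h1 := (hasFDerivAt_norm_rpow ((s : ℂ) + (m + t • d)) (p := r + 2)
    (by linarith)).comp_hasDerivAt t hl2
  have h2 : HasDerivAt (fun t : ℝ => (m + t • d).re) d.re t :=
    Complex.reCLM.hasFDerivAt.comp_hasDerivAt t hl
  have h3 := hl.norm_sq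
  refine (((h1.sub_const (s ^ (r + 2))).sub ((h2.const_mul (s ^ (r + 1))).const_mul (r + 2))).sub
    (((h3.add ((h2.pow 2).const_mul r)).const_mul (s ^ r)).const_mul ((r + 2) / 2))).congr_deriv ?_
  have e : r + 2 - 2 = r := by ring
  rw [e]
  rw [smul_apply, innerSL_apply_apply, gradRem]
  generalize m + t • d = v
  generalize ‖(s : ℂ) + v‖ ^ r = K
  simp only [Complex.inner, smul_eq_mul, Complex.real_smul, Complex.mul_re, Complex.conj_re,
    Complex.conj_im, Complex.sub_re, Complex.sub_im, Complex.add_re, Complex.add_im,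
    Complex.mul_im, Complex.ofReal_re, Complex.ofReal_im]
  push_cast
  ring

/-- Pointwise estimates for the remainder of `‖s + v‖ ^ (r + 2)`, uniform in `0 < s ≤ 1`. -/
theorem potRem_estimates {r : ℝ} (hr : 1 ≤ r) : ∃ C > 0, ∀ s : ℝ, 0 < s → s ≤ 1 →
    (∀ v v' : ℂ, ∀ ρ ≤ (1 : ℝ), ‖v‖ ≤ ρ → ‖v'‖ ≤ ρ →
      |potRem r s v - potRem r s v'| ≤ C * ρ ^ 2 * ‖v - v'‖) ∧
    (∀ a b : ℂ, ∀ ρ ≤ (1 : ℝ), ‖a‖ ≤ ρ → ‖b‖ ≤ ρ →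
      potRem r s a + potRem r s b - 2 * potRem r s ((1 / 2 : ℝ) • (a + b)) ≤
        C * ρ * ‖a - b‖ ^ 2) ∧
    (∀ v : ℂ, ‖v‖ ≤ 1 → ‖gradRem r s v‖ ≤ C * ‖v‖ ^ 2) := by
  obtain ⟨L, hL, hlip⟩ := gradRem_lipschitz hr
  have hC : L ≤ (r + 2) * L := by nlinarith
  refine ⟨(r + 2) * L, by positivity, fun s hs hs1 => ?_⟩
  have hg : ∀ ρ ≤ (1 : ℝ), ∀ v : ℂ, ‖v‖ ≤ ρ → ‖gradRem r s v‖ ≤ L * ρ * ρ := by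
    intro ρ hρ v hv
    have h0 : 0 ≤ ρ := (norm_nonneg _).trans hv
    have := hlip s hs hs1 ρ hρ v 0 hv (by simpa using h0)
    rw [gradRem_zero hs, sub_zero, sub_zero] at this
    exact this.trans (by gcongr)
  refine ⟨?_, ?_, ?_⟩
  · intro v v' ρ hρ hv hv'
    have h0 : 0 ≤ ρ := (norm_nonneg _).trans hv
    have h := norm_image_sub_le_of_norm_deriv_le_segment_01'
      (f := fun t : ℝ => potRem r s (v' + t • (v - v')))
      (f' := fun t => (r + 2) * ⟪gradRem r s (v' + t • (v - v')), v - v'⟫_ℝ)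
      (C := (r + 2) * L * ρ ^ 2 * ‖v - v'‖)
      (fun t _ => (hasDerivAt_potRem hr s v' (v - v') t).hasDerivWithinAt)
      (fun t ht => by
        have hb : ‖v' + t • (v - v')‖ ≤ ρ := by
          have := (convex_closedBall (0 : ℂ) ρ).add_smul_sub_mem (x := v') (y := v)
            (by simpa using hv') (by simpa using hv) ⟨ht.1, ht.2.le⟩
          simpa using this
        rw [norm_mul, Real.norm_of_nonneg (by positivity), mul_assoc, mul_assoc]
        refine mul_le_mul_of_nonneg_left ((norm_inner_le_norm _ _).trans ?_) (by positivity)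
        have := mul_le_mul_of_nonneg_right (hg ρ hρ _ hb) (norm_nonneg (v - v'))
        linarith)
    simpa using h
  · intro a b ρ hρ ha hb
    have h0 : 0 ≤ ρ := (norm_nonneg _).trans ha
    set m : ℂ := (1 / 2 : ℝ) • (a + b) with hm
    set d : ℂ := (1 / 2 : ℝ) • (b - a) with hd
    have e1 : m + (1 : ℝ) • d = b := by rw [hm, hd]; module
    have e2 : m + (1 : ℝ) • (-d) = a := by rw [hm, hd]; module
    have nd : ‖d‖ = ‖a - b‖ / 2 := by
      rw [hd, norm_smul, norm_sub_rev]; norm_num; ring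
    have hball : ∀ t ∈ Icc (0 : ℝ) 1, ‖m + t • d‖ ≤ ρ ∧ ‖m + t • (-d)‖ ≤ ρ := by
      intro t ht
      have hm' : m ∈ Metric.closedBall (0 : ℂ) ρ := by
        have := (convex_closedBall (0 : ℂ) ρ) (x := a) (y := b) (by simpa using ha)
          (by simpa using hb) (a := 1 / 2) (b := 1 / 2) (by norm_num) (by norm_num) (by norm_num)
        rwa [← smul_add] at this
      have h1 := (convex_closedBall (0 : ℂ) ρ).add_smul_sub_mem (x := m) (y := b) hm'
        (by simpa using hb) ht
      have h2 := (convex_closedBall (0 : ℂ) ρ).add_smul_sub_mem (x := m) (y := a) hm'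
        (by simpa using ha) ht
      rw [show b - m = d by rw [hm, hd]; module] at h1
      rw [show a - m = -d by rw [hm, hd]; module] at h2
      exact ⟨by simpa using h1, by simpa using h2⟩
    -- The symmetrized function runs from twice the midpoint value at t = 0 to the sum of the end
    -- values at t = 1. Its derivative is a difference of gradients at points 2t‖d‖ apart, hence of
    -- second order in ‖a - b‖.
    have h := norm_image_sub_le_of_norm_deriv_le_segment_01'
      (f := fun t : ℝ => potRem r s (m + t • d) + potRem r s (m + t • (-d)))
      (f' := fun t => (r + 2) * ⟪gradRem r s (m + t • d), d⟫_ℝ +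
        (r + 2) * ⟪gradRem r s (m + t • (-d)), -d⟫_ℝ)
      (C := (r + 2) * (L * ρ * (2 * ‖d‖) * ‖d‖))
      (fun t _ => ((hasDerivAt_potRem hr s m d t).add
        (hasDerivAt_potRem hr s m (-d) t)).hasDerivWithinAt)
      (fun t ht => by
        obtain ⟨hb1, hb2⟩ := hball t ⟨ht.1, ht.2.le⟩
        rw [inner_neg_right, ← mul_add, ← sub_eq_add_neg, ← inner_sub_left, norm_mul,
          Real.norm_of_nonneg (by positivity)]
        refine mul_le_mul_of_nonneg_left ((norm_inner_le_norm _ _).trans ?_) (by positivity)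
        refine mul_le_mul_of_nonneg_right ((hlip s hs hs1 ρ hρ _ _ hb1 hb2).trans ?_)
          (norm_nonneg _)
        refine mul_le_mul_of_nonneg_left ?_ (by positivity)
        rw [show m + t • d - (m + t • (-d)) = (2 * t) • d by module, norm_smul,
          Real.norm_of_nonneg (by linarith [ht.1])]
        nlinarith [norm_nonneg d, ht.2])
    simp only [e1, e2, zero_smul, add_zero] at h
    have h' := (le_abs_self _).trans h
    rw [nd] at h'
    have hpos : 0 ≤ (r + 2) * L * ρ * ‖a - b‖ ^ 2 := by positivity
    have : (r + 2) * (L * ρ * (2 * (‖a - b‖ / 2)) * (‖a - b‖ / 2)) =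
      (r + 2) * L * ρ * ‖a - b‖ ^ 2 / 2 := by ring
    linarith
  · intro v hv
    refine (hg ‖v‖ hv v le_rfl).trans ?_
    rw [mul_assoc, ← sq]
    exact mul_le_mul_of_nonneg_right hC (sq_nonneg _)

end StarGraph

/-! ### Abstract minimization and reduction -/

section Minimization

variable {E : Type*} [NormedAddCommGroup E] [NormedSpace ℝ E]

/-- A functional `J` on a closed convex set which satisfies a strengthened midpoint inequality
attains its infimum. -/
theorem exists_isMinOn_of_midpoint [CompleteSpace E] {K : Set E} (hK : IsClosed K)
    (hconv : Convex ℝ K) (hne : K.Nonempty) {J : E → ℝ} (hJ : ContinuousOn J K)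
    (hbdd : BddBelow (J '' K)) {κ : ℝ} (hκ : 0 < κ)
    (hmid : ∀ a ∈ K, ∀ b ∈ K,
      κ * ‖a - b‖ ^ 2 ≤ J a + J b - 2 * J ((1 / 2 : ℝ) • (a + b))) :
    ∃ w ∈ K, IsMinOn J K w := by
  set m := sInf (J '' K) with hm
  have hle : ∀ a ∈ K, m ≤ J a := fun a ha => csInf_le hbdd ⟨a, ha, rfl⟩
  have hhalf : ∀ a ∈ K, ∀ b ∈ K, (1 / 2 : ℝ) • (a + b) ∈ K := fun a ha b hb => by
    rw [smul_add]; exact hconv ha hb (by norm_num) (by norm_num) (by norm_num)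
  have hseq : ∀ n : ℕ, ∃ a ∈ K, J a < m + 1 / ((n : ℝ) + 1) := fun n => by
    obtain ⟨_, ⟨a, ha, rfl⟩, h⟩ := exists_lt_of_csInf_lt (hne.image J)
      (show sInf (J '' K) < m + 1 / ((n : ℝ) + 1) by
        have : (0 : ℝ) < 1 / ((n : ℝ) + 1) := by positivity
        linarith)
    exact ⟨a, ha, h⟩
  choose w hwK hw using hseq
  -- The strengthened midpoint inequality makes any minimizing sequence Cauchy, so no weak
  -- compactness is involved.
  have hdist : ∀ n k N : ℕ, N ≤ n → N ≤ k →
      dist (w n) (w k) ≤ Real.sqrt (2 / κ * (1 / ((N : ℝ) + 1))) := by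
    intro n k N hn hk
    refine Real.le_sqrt_of_sq_le ?_
    rw [dist_eq_norm]
    have h1 := hmid _ (hwK n) _ (hwK k)
    have h2 := hle _ (hhalf _ (hwK n) _ (hwK k))
    have h3 : 1 / ((n : ℝ) + 1) ≤ 1 / ((N : ℝ) + 1) := by gcongr
    have h4 : 1 / ((k : ℝ) + 1) ≤ 1 / ((N : ℝ) + 1) := by gcongr
    have h5 := hw n
    have h6 := hw k
    rw [div_mul_eq_mul_div, le_div_iff₀ hκ]
    linarith
  have hlim : Tendsto (fun N : ℕ => Real.sqrt (2 / κ * (1 / ((N : ℝ) + 1)))) atTop (𝓝 0) := by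
    have := (tendsto_one_div_add_atTop_nhds_zero_nat (𝕜 := ℝ)).const_mul (2 / κ)
    rw [mul_zero] at this
    simpa using this.sqrt
  obtain ⟨W, hW⟩ := cauchySeq_tendsto_of_complete (cauchySeq_of_le_tendsto_0 _ hdist hlim)
  have hWK : W ∈ K := hK.mem_of_tendsto hW (Eventually.of_forall hwK)
  refine ⟨W, hWK, fun a ha => ?_⟩
  have h1 : Tendsto (fun n => J (w n)) atTop (𝓝 (J W)) :=
    (hJ W hWK).tendsto.comp (tendsto_nhdsWithin_iff.2 ⟨hW, Eventually.of_forall hwK⟩)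
  have h2 : Tendsto (fun n : ℕ => m + 1 / ((n : ℝ) + 1)) atTop (𝓝 m) := by
    simpa using (tendsto_one_div_add_atTop_nhds_zero_nat (𝕜 := ℝ)).const_add m
  exact (le_of_tendsto_of_tendsto' h1 h2 fun n => (hw n).le).trans (hle a ha)

/-- Lyapunov–Schmidt type reduction: minimization of a coercive quadratic form plus a small
superquadratic perturbation `R` shifted by a small vector `u`. -/
theorem exists_reduction [CompleteSpace E] (S : Submodule ℝ E) (hS : IsClosed (S : Set E))
    {Q R : E → ℝ} {κ C ρ₀ : ℝ} (hκ : 0 < κ) (hC : 0 < C) (hρ₀ : 0 < ρ₀) (hQc : Continuous Q)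
    (hQpar : ∀ a b, Q a + Q b = 2 * Q ((1 / 2 : ℝ) • (a + b)) + 1 / 2 * Q (a - b))
    (hQ : ∀ w ∈ S, κ * ‖w‖ ^ 2 ≤ Q w)
    (hR : ∀ ρ ≤ ρ₀, ∀ a b, ‖a‖ ≤ ρ → ‖b‖ ≤ ρ → |R a - R b| ≤ C * ρ ^ 2 * ‖a - b‖)
    (hRmid : ∀ ρ ≤ ρ₀, ∀ a b, ‖a‖ ≤ ρ → ‖b‖ ≤ ρ →
      -(C * ρ * ‖a - b‖ ^ 2) ≤ R a + R b - 2 * R ((1 / 2 : ℝ) • (a + b))) :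
    ∃ r > 0, ∃ A > 0, ∀ u : E, ‖u‖ ≤ r →
      ∃ W ∈ {w : E | w ∈ S ∧ ‖w‖ ≤ r},
        IsMinOn (fun w => Q w + R (u + w)) {w : E | w ∈ S ∧ ‖w‖ ≤ r} W ∧
        (∀ W' ∈ {w : E | w ∈ S ∧ ‖w‖ ≤ r},
          IsMinOn (fun w => Q w + R (u + w)) {w : E | w ∈ S ∧ ‖w‖ ≤ r} W' → W' = W) ∧
        ‖W‖ ≤ A * ‖u‖ ^ 2 ∧ |Q W + R (u + W) - R u| ≤ A * ‖u‖ ^ 4 := by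
  -- All arguments u + w have norm at most 2r. The bound C(2r) ≤ κ/4 lets half of the convexity κ/2
  -- of Q survive the concavity of R.
  obtain ⟨r, hr0, hr1, hr2⟩ : ∃ r : ℝ, 0 < r ∧ 2 * r ≤ ρ₀ ∧ C * (2 * r) ≤ κ / 4 := by
    refine ⟨min (ρ₀ / 2) (κ / (8 * C)), lt_min (by positivity) (by positivity), ?_, ?_⟩
    · have := min_le_left (ρ₀ / 2) (κ / (8 * C)); linarith
    · have := min_le_right (ρ₀ / 2) (κ / (8 * C))
      calc C * (2 * min (ρ₀ / 2) (κ / (8 * C))) ≤ C * (2 * (κ / (8 * C))) := by gcongr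
        _ = κ / 4 := by field_simp; norm_num
  set A₁ := 4 * C / κ with hA₁
  have hA₁0 : 0 < A₁ := by positivity
  set A₂ := C * (1 + A₁ * r) ^ 2 * A₁ with hA₂
  have hA₂0 : 0 < A₂ := by positivity
  refine ⟨r, hr0, A₁ + A₂, by positivity, fun u hu => ?_⟩
  set K : Set E := {w : E | w ∈ S ∧ ‖w‖ ≤ r} with hKdef
  have hQ0 : Q 0 = 0 := by have := hQpar 0 0; simp at this; linarith
  have h0K : (0 : E) ∈ K := ⟨S.zero_mem, by simpa using hr0.le⟩
  have hu2 : ∀ w ∈ K, ‖u + w‖ ≤ 2 * r := fun w hw => by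
    have := norm_add_le u w
    have := hw.2
    linarith
  have hKc : IsClosed K := hS.inter (isClosed_le continuous_norm continuous_const)
  have hKconv : Convex ℝ K := by
    have := S.convex.inter (convex_closedBall (0 : E) r)
    convert this using 1
    ext w; simp [hKdef]
  have hmid : ∀ a ∈ K, ∀ b ∈ K, κ / 4 * ‖a - b‖ ^ 2 ≤
      (Q a + R (u + a)) + (Q b + R (u + b)) -
        2 * (Q ((1 / 2 : ℝ) • (a + b)) + R (u + (1 / 2 : ℝ) • (a + b))) := by
    intro a ha b hb
    have h1 := hRmid (2 * r) hr1 _ _ (hu2 a ha) (hu2 b hb)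
    rw [show (1 / 2 : ℝ) • (u + a + (u + b)) = u + (1 / 2 : ℝ) • (a + b) by module,
      add_sub_add_left_eq_sub] at h1
    have h2 := hQpar a b
    have h3 := hQ _ (S.sub_mem ha.1 hb.1)
    have h4 := mul_le_mul_of_nonneg_right hr2 (sq_nonneg ‖a - b‖)
    linarith
  have hJc : ContinuousOn (fun w => Q w + R (u + w)) K := by
    refine hQc.continuousOn.add ?_
    have : LipschitzOnWith (Real.toNNReal (C * (2 * r) ^ 2)) (fun w => R (u + w)) K := by
      refine LipschitzOnWith.of_dist_le_mul fun a ha b hb => ?_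
      rw [Real.coe_toNNReal _ (by positivity), Real.dist_eq, dist_eq_norm]
      have := hR (2 * r) hr1 _ _ (hu2 a ha) (hu2 b hb)
      rwa [add_sub_add_left_eq_sub] at this
    exact this.continuousOn
  have hdiff : ∀ w ∈ K, |R (u + w) - R u| ≤ C * (‖u‖ + ‖w‖) ^ 2 * ‖w‖ := fun w hw => by
    have := hR (‖u‖ + ‖w‖) (by linarith [hw.2]) (u + w) u (norm_add_le _ _)
      (by linarith [norm_nonneg w])
    rwa [add_sub_cancel_left] at this
  have hbdd : BddBelow ((fun w => Q w + R (u + w)) '' K) := by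
    refine ⟨R u - C * (2 * r) ^ 2 * r, ?_⟩
    rintro _ ⟨w, hw, rfl⟩
    have h1 := (abs_le.1 (hdiff w hw)).1
    have h2 := hQ w hw.1
    have h3 : 0 ≤ κ * ‖w‖ ^ 2 := by positivity
    have h4 : C * (‖u‖ + ‖w‖) ^ 2 * ‖w‖ ≤ C * (2 * r) ^ 2 * r := by
      have := hw.2
      gcongr
      linarith
    simp only
    linarith
  obtain ⟨W, hWK, hWmin⟩ := exists_isMinOn_of_midpoint hKc hKconv ⟨0, h0K⟩ hJc hbdd
    (by positivity : 0 < κ / 4) hmid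
  -- Comparison with the competitor w = 0; this also gives the upper half of the estimate on the
  -- minimal value.
  have hW0 : Q W + R (u + W) ≤ R u := by
    have := hWmin h0K
    simpa [hQ0] using this
  -- Comparison with 0 gives κ‖W‖² ≤ C(‖u‖ + ‖W‖)²‖W‖. After division by ‖W‖, the part quadratic in
  -- ‖W‖ is absorbed by means of ‖W‖ ≤ r, leaving ‖W‖ = O(‖u‖²).
  have hWn : ‖W‖ ≤ A₁ * ‖u‖ ^ 2 := by
    rcases (norm_nonneg W).eq_or_lt with h | h
    · rw [← h]; positivity
    have h1 := (abs_le.1 (hdiff W hWK)).1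
    have h2 := hQ W hWK.1
    have h3 : (κ * ‖W‖) * ‖W‖ ≤ (C * (‖u‖ + ‖W‖) ^ 2) * ‖W‖ := by nlinarith
    have h4 := le_of_mul_le_mul_right h3 h
    have h5 : (‖u‖ + ‖W‖) ^ 2 ≤ 2 * ‖u‖ ^ 2 + 2 * r * ‖W‖ := by
      nlinarith [sq_nonneg (‖u‖ - ‖W‖), hWK.2]
    have h6 := mul_le_mul_of_nonneg_left h5 hC.le
    have h7 := mul_le_mul_of_nonneg_right hr2 h.le
    rw [hA₁, div_mul_eq_mul_div, le_div_iff₀ hκ]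
    nlinarith
  refine ⟨W, hWK, hWmin, fun W' hW'K hW'min => ?_, ?_, ?_⟩
  · have h1 : Q W' + R (u + W') ≤ Q W + R (u + W) := hW'min hWK
    have hm : (1 / 2 : ℝ) • (W' + W) ∈ K := by
      rw [smul_add]; exact hKconv hW'K hWK (by norm_num) (by norm_num) (by norm_num)
    have h2 : Q W + R (u + W) ≤ _ := hWmin hm
    have h3 := hmid W' hW'K W hWK
    have h4 : κ / 4 * ‖W' - W‖ ^ 2 ≤ 0 := by linarith
    have h5 : ‖W' - W‖ ^ 2 ≤ 0 := by
      by_contra hcon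
      push Not at hcon
      have : 0 < κ / 4 * ‖W' - W‖ ^ 2 := by positivity
      linarith
    have h6 : ‖W' - W‖ = 0 := by
      have := le_antisymm h5 (sq_nonneg _)
      simpa using this
    exact sub_eq_zero.1 (norm_eq_zero.1 h6)
  · exact hWn.trans (by gcongr; linarith)
  · have h1 := hdiff W hWK
    have h2 := hQ W hWK.1
    have h3 : 0 ≤ κ * ‖W‖ ^ 2 := by positivity
    -- Since ‖W‖ = O(‖u‖²), replacing R(u + W) by R(u) costs ‖u‖²·‖u‖² = ‖u‖⁴, one order beyond the
    -- cubic term.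
    have h4 : C * (‖u‖ + ‖W‖) ^ 2 * ‖W‖ ≤ A₂ * ‖u‖ ^ 4 := by
      have h5 : ‖u‖ + ‖W‖ ≤ (1 + A₁ * r) * ‖u‖ := by
        have : A₁ * ‖u‖ ^ 2 ≤ A₁ * (r * ‖u‖) := by
          rw [sq]; gcongr
        linarith
      calc C * (‖u‖ + ‖W‖) ^ 2 * ‖W‖ ≤ C * ((1 + A₁ * r) * ‖u‖) ^ 2 * (A₁ * ‖u‖ ^ 2) := by
            gcongr
        _ = A₂ * ‖u‖ ^ 4 := by rw [hA₂]; ring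
    have h6 : A₂ * ‖u‖ ^ 4 ≤ (A₁ + A₂) * ‖u‖ ^ 4 := by gcongr; linarith
    rw [abs_le] at h1 ⊢
    constructor <;> linarith [h1.1]

end Minimization

/-! ### The energy space: vertex values, Sobolev bound, completeness -/

namespace StarGraph

variable {N : ℕ}

/-- `z` is the common value at the vertex of the components of `V`, and `V.snd` their derivative. -/
def IsVertex (V : WithLp 2 (L2 N × L2 N)) (z : ℂ) : Prop :=
  ∀ j : Fin N, ∀ᵐ x ∂halfLine, V.fst j x = z + ∫ t in (0 : ℝ)..x, V.snd j t

theorem mem_H1_iff {V : WithLp 2 (L2 N × L2 N)} : V ∈ H1 N ↔ ∃ z, IsVertex V z := Iff.rfl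

theorem Lp_intervalIntegrable (f : Lp ℂ 2 halfLine) {x : ℝ} (hx : 0 ≤ x) :
    IntervalIntegrable f volume 0 x := by
  rw [intervalIntegrable_iff_integrableOn_Ioc_of_le hx]
  have := (Lp.memLp f).restrict (Ioc 0 x)
  rw [Measure.restrict_restrict measurableSet_Ioc,
    inter_eq_left.2 Ioc_subset_Ioi_self] at this
  exact this.integrable (by norm_num)

theorem intervalIntegral_congr_halfLine {f g : ℝ → ℂ} (h : f =ᵐ[halfLine] g) {x : ℝ}
    (hx : 0 ≤ x) : ∫ t in (0 : ℝ)..x, f t = ∫ t in (0 : ℝ)..x, g t := by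
  rw [intervalIntegral.integral_of_le hx, intervalIntegral.integral_of_le hx]
  exact integral_congr_ae (ae_restrict_of_ae_restrict_of_subset Ioc_subset_Ioi_self h)

theorem IsVertex.sub {V W : WithLp 2 (L2 N × L2 N)} {z w : ℂ} (hV : IsVertex V z)
    (hW : IsVertex W w) : IsVertex (V - W) (z - w) := by
  intro j
  have h1 := Lp.coeFn_sub (V.fst j) (W.fst j)
  have h2 := Lp.coeFn_sub (V.snd j) (W.snd j)
  filter_upwards [h1, hV j, hW j, ae_restrict_mem measurableSet_Ioi] with x hx hV hW hx0
  have hx0 : 0 ≤ x := le_of_lt hx0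
  change (V.fst j - W.fst j : Lp ℂ 2 halfLine) x =
    z - w + ∫ t in (0 : ℝ)..x, (V.snd j - W.snd j : Lp ℂ 2 halfLine) t
  rw [intervalIntegral_congr_halfLine h2 hx0, hx, Pi.sub_apply, hV, hW]
  simp only [Pi.sub_apply]
  rw [intervalIntegral.integral_sub (Lp_intervalIntegrable _ hx0) (Lp_intervalIntegrable _ hx0)]
  ring

theorem Lp_norm_sq (f : Lp ℂ 2 halfLine) :
    ‖f‖ ^ 2 = (∫ x in Ioi 0, (f x).re ^ 2) + ∫ x in Ioi 0, (f x).im ^ 2 := by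
  have h1 : IntegrableOn (fun x => (f x).re ^ 2) (Ioi 0) :=
    MemLp.sq_integrableOn (f := fun x => (f x).re) (Lp.memLp f).re
  have h2 : IntegrableOn (fun x => (f x).im ^ 2) (Ioi 0) :=
    MemLp.sq_integrableOn (f := fun x => (f x).im) (Lp.memLp f).im
  rw [← integral_add h1 h2, ← real_inner_self_eq_norm_sq, L2.inner_def]
  refine integral_congr_ae (Eventually.of_forall fun x => ?_)
  simp only [Complex.inner, Complex.mul_re, Complex.conj_re, Complex.conj_im]
  ring

theorem L2_norm_sq (Ψ : L2 N) : ‖Ψ‖ ^ 2 = ∑ j, ‖Ψ j‖ ^ 2 := PiLp.norm_sq_eq_of_L2 _ Ψ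

theorem norm_sq_eq (V : WithLp 2 (L2 N × L2 N)) : ‖V‖ ^ 2 = ‖V.fst‖ ^ 2 + ‖V.snd‖ ^ 2 :=
  WithLp.prod_norm_sq_eq_of_L2 V

theorem H1_norm_sq (V : H1 N) : ‖V‖ ^ 2 = ‖val V‖ ^ 2 + ‖der V‖ ^ 2 := norm_sq_eq _

/-- The representatives are the primitives of the weak derivative started at the vertex value; real
and imaginary parts are separated because L₊ and L₋ act on them separately. -/
theorem IsVertex.exists_edgeFun {V : WithLp 2 (L2 N × L2 N)} {z : ℂ} (hV : IsVertex V z) :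
    ∃ u w : Fin N → ℝ → ℝ, ∀ j, EdgeFun (u j) (fun x => (V.snd j x).re) ∧
      EdgeFun (w j) (fun x => (V.snd j x).im) ∧ u j 0 = z.re ∧ w j 0 = z.im ∧
      ∀ᵐ x ∂halfLine, (V.fst j x).re = u j x ∧ (V.fst j x).im = w j x := by
  refine ⟨fun j x => z.re + ∫ t in (0 : ℝ)..x, (V.snd j t).re,
    fun j x => z.im + ∫ t in (0 : ℝ)..x, (V.snd j t).im, fun j => ?_⟩
  have hae : ∀ᵐ x ∂halfLine, (V.fst j x).re = z.re + (∫ t in (0 : ℝ)..x, (V.snd j t).re) ∧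
      (V.fst j x).im = z.im + ∫ t in (0 : ℝ)..x, (V.snd j t).im := by
    filter_upwards [hV j, ae_restrict_mem measurableSet_Ioi] with x hx hx0
    have hi := Lp_intervalIntegrable (V.snd j) (le_of_lt hx0)
    have e1 := Complex.reCLM.intervalIntegral_comp_comm hi
    have e2 := Complex.imCLM.intervalIntegral_comp_comm hi
    simp only [Complex.reCLM_apply, Complex.imCLM_apply] at e1 e2
    rw [e1, e2, hx]
    simp
  have m1 : MemLp (fun x => (V.fst j x).re) 2 halfLine := (Lp.memLp (V.fst j)).re
  have m2 : MemLp (fun x => (V.fst j x).im) 2 halfLine := (Lp.memLp (V.fst j)).im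
  refine ⟨⟨m1.ae_eq (hae.mono fun x hx => hx.1), (Lp.memLp (V.snd j)).re, fun x _ => by simp⟩,
    ⟨m2.ae_eq (hae.mono fun x hx => hx.2), (Lp.memLp (V.snd j)).im, fun x _ => by simp⟩,
    by simp, by simp, hae⟩

theorem IsVertex.sq_le {V : WithLp 2 (L2 N × L2 N)} {z : ℂ} {u w : Fin N → ℝ → ℝ}
    (h : ∀ j, EdgeFun (u j) (fun x => (V.snd j x).re) ∧
      EdgeFun (w j) (fun x => (V.snd j x).im) ∧ u j 0 = z.re ∧ w j 0 = z.im ∧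
      ∀ᵐ x ∂halfLine, (V.fst j x).re = u j x ∧ (V.fst j x).im = w j x) (j : Fin N) {x : ℝ}
    (hx : 0 ≤ x) : u j x ^ 2 + w j x ^ 2 ≤ ‖V‖ ^ 2 := by
  obtain ⟨hu, hw, -, -, hae⟩ := h j
  have h1 := hu.sq_le hx
  have h2 := hw.sq_le hx
  have e1 : (∫ t in Ioi 0, u j t ^ 2) = ∫ t in Ioi 0, (V.fst j t).re ^ 2 :=
    integral_congr_ae (hae.mono fun x hx => by simp only [hx.1])
  have e2 : (∫ t in Ioi 0, w j t ^ 2) = ∫ t in Ioi 0, (V.fst j t).im ^ 2 :=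
    integral_congr_ae (hae.mono fun x hx => by simp only [hx.2])
  have h3 := Lp_norm_sq (V.fst j)
  have h4 := Lp_norm_sq (V.snd j)
  have h5 : ‖V.fst j‖ ^ 2 ≤ ‖V.fst‖ ^ 2 := by
    rw [L2_norm_sq]
    exact Finset.single_le_sum (f := fun j => ‖V.fst j‖ ^ 2) (fun _ _ => by positivity)
      (Finset.mem_univ j)
  have h6 : ‖V.snd j‖ ^ 2 ≤ ‖V.snd‖ ^ 2 := by
    rw [L2_norm_sq V.snd]
    exact Finset.single_le_sum (f := fun j => ‖V.snd j‖ ^ 2) (fun _ _ => by positivity)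
      (Finset.mem_univ j)
  rw [norm_sq_eq]
  linarith

/-- The vertex value is the trace at 0 of any one component, so the Sobolev bound applies. At least
one edge is needed, since otherwise z is arbitrary. -/
theorem IsVertex.norm_le (hN : 0 < N) {V : WithLp 2 (L2 N × L2 N)} {z : ℂ} (hV : IsVertex V z) :
    ‖z‖ ≤ ‖V‖ := by
  obtain ⟨u, w, h⟩ := hV.exists_edgeFun
  have h1 := IsVertex.sq_le h ⟨0, hN⟩ le_rfl
  obtain ⟨-, -, e1, e2, -⟩ := h ⟨0, hN⟩
  rw [e1, e2] at h1
  refine le_of_sq_le_sq ?_ (norm_nonneg _)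
  rw [Complex.sq_norm, Complex.normSq_apply]
  linarith

/-- Sobolev embedding: elements of `H¹_Γ` are bounded by their norm. -/
theorem ae_norm_le (V : H1 N) (j : Fin N) : ∀ᵐ x ∂halfLine, ‖val V j x‖ ≤ ‖V‖ := by
  obtain ⟨z, hz⟩ := mem_H1_iff.1 V.2
  obtain ⟨u, w, h⟩ := IsVertex.exists_edgeFun hz
  filter_upwards [(h j).2.2.2.2, ae_restrict_mem measurableSet_Ioi] with x hx hx0
  have h1 := IsVertex.sq_le h j (le_of_lt hx0)
  refine le_of_sq_le_sq ?_ (norm_nonneg _)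
  rw [Complex.sq_norm, Complex.normSq_apply]
  change (V.1.fst j x).re * (V.1.fst j x).re + (V.1.fst j x).im * (V.1.fst j x).im ≤ ‖V.1‖ ^ 2
  rw [hx.1, hx.2]
  linarith

/-- The integral over (0, x] is the inner product with an indicator function, which lies in L²
because the interval is bounded. -/
theorem continuous_intervalIntegral_Lp {x : ℝ} (hx : 0 ≤ x) :
    Continuous fun f : Lp ℂ 2 halfLine => ∫ t in (0 : ℝ)..x, f t := by
  have hμ : halfLine (Ioc 0 x) ≠ ⊤ := by
    rw [Measure.restrict_apply measurableSet_Ioc]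
    exact ((measure_mono inter_subset_left).trans_lt measure_Ioc_lt_top).ne
  have e : (fun f : Lp ℂ 2 halfLine => ∫ t in (0 : ℝ)..x, f t) = fun f =>
      ⟪indicatorConstLp 2 measurableSet_Ioc hμ (1 : ℂ), f⟫_ℂ := by
    funext f
    rw [L2.inner_indicatorConstLp_one, intervalIntegral.integral_of_le hx,
      Measure.restrict_restrict measurableSet_Ioc, inter_eq_left.2 Ioc_subset_Ioi_self]
  rw [e]
  exact continuous_const.inner continuous_id

/-- The trace bound makes the vertex values of a convergent sequence Cauchy, and the defining
identity passes to the limit on each edge. -/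
theorem isClosed_H1 (hN : 0 < N) : IsClosed (H1 N : Set (WithLp 2 (L2 N × L2 N))) := by
  refine IsSeqClosed.isClosed fun V W hV hVW => ?_
  choose z hz using fun n => mem_H1_iff.1 (hV n)
  have hcau : CauchySeq z := by
    have h := hVW.cauchySeq
    rw [Metric.cauchySeq_iff] at h ⊢
    intro ε hε
    obtain ⟨M, hM⟩ := h ε hε
    refine ⟨M, fun m hm n hn => lt_of_le_of_lt ?_ (hM m hm n hn)⟩
    rw [dist_eq_norm, dist_eq_norm]
    exact ((hz m).sub (hz n)).norm_le hN
  obtain ⟨z₀, hz₀⟩ := cauchySeq_tendsto_of_complete hcau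
  refine ⟨z₀, fun j => ?_⟩
  have hfst : Tendsto (fun n => (V n).fst j) atTop (𝓝 (W.fst j)) := by
    have : Continuous fun V : WithLp 2 (L2 N × L2 N) => V.fst j :=
      (PiLp.continuous_apply 2 _ j).comp (WithLp.continuous_fst 2 _ _)
    exact (this.tendsto W).comp hVW
  have hsnd : Tendsto (fun n => (V n).snd j) atTop (𝓝 (W.snd j)) := by
    have : Continuous fun V : WithLp 2 (L2 N × L2 N) => V.snd j :=
      (PiLp.continuous_apply 2 _ j).comp (WithLp.continuous_snd 2 _ _)
    exact (this.tendsto W).comp hVW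
  -- L² convergence yields pointwise convergence almost everywhere only along a subsequence; the
  -- other side of the identity converges for every x.
  obtain ⟨ns, hns, hae⟩ := (tendstoInMeasure_of_tendsto_Lp hfst).exists_seq_tendsto_ae
  have hall : ∀ᵐ x ∂halfLine, ∀ n, (V n).fst j x = z n + ∫ t in (0 : ℝ)..x, (V n).snd j t :=
    ae_all_iff.2 fun n => hz n j
  filter_upwards [hae, hall, ae_restrict_mem measurableSet_Ioi] with x hx hx' hx0
  refine tendsto_nhds_unique hx ?_
  have h1 := ((continuous_intervalIntegral_Lp (le_of_lt hx0)).tendsto (W.snd j)).comp hsnd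
  have h2 := (hz₀.add h1).comp hns.tendsto_atTop
  refine h2.congr fun n => ?_
  simp only [Function.comp_apply]
  exact (hx' (ns n)).symm

theorem completeSpace_H1 (hN : 0 < N) : CompleteSpace (H1 N) :=
  (isClosed_H1 hN).completeSpace_coe

end StarGraph

/-! ### Coercivity over the whole graph -/

namespace StarGraph

/-- Cauchy–Schwarz through the discriminant of t ↦ ∫ (g + t f)². -/
theorem sq_integral_mul_le {μ : Measure ℝ} {f g : ℝ → ℝ} (hf : MemLp f 2 μ) (hg : MemLp g 2 μ) :
    (∫ x, f x * g x ∂μ) ^ 2 ≤ (∫ x, f x ^ 2 ∂μ) * ∫ x, g x ^ 2 ∂μ := by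
  have hff : Integrable (fun x => f x ^ 2) μ := hf.integrable_sq
  have hgg : Integrable (fun x => g x ^ 2) μ := hg.integrable_sq
  have hfg : Integrable (fun x => f x * g x) μ := hf.mul_integrable hg
  set A := ∫ x, f x ^ 2 ∂μ with hA
  set B := ∫ x, f x * g x ∂μ with hB
  set C := ∫ x, g x ^ 2 ∂μ with hC
  have key : ∀ t : ℝ, 0 ≤ A * (t * t) + (2 * B) * t + C := fun t => by
    have h := integral_add_mul_add_mul hgg hfg hff (2 * t) (t * t)
    have h0 : 0 ≤ ∫ x, (g x ^ 2 + 2 * t * (f x * g x) + t * t * f x ^ 2) ∂μ :=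
      integral_nonneg fun x => by
        have := sq_nonneg (g x + t * f x)
        simp only [Pi.zero_apply]
        nlinarith
    rw [h] at h0
    linarith
  have := discrim_le_zero key
  rw [discrim] at this
  nlinarith

theorem abs_integral_mul_le {f g : ℝ → ℝ} (hf : MemLp f 2 halfLine) (hg : MemLp g 2 halfLine)
    {h : ℝ} (h0 : 0 ≤ h) (hh : ∫ x in Ioi 0, g x ^ 2 ≤ h ^ 2) :
    |∫ x in Ioi 0, f x * g x| ≤ Real.sqrt (∫ x in Ioi 0, f x ^ 2) * h := by
  have h1 : 0 ≤ ∫ x in Ioi 0, f x ^ 2 := integral_nonneg fun x => sq_nonneg _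
  refine abs_le_of_sq_le_sq ?_ (by positivity)
  rw [mul_pow, Real.sq_sqrt h1]
  exact (sq_integral_mul_le hf hg).trans (mul_le_mul_of_nonneg_left hh h1)

/-- Splitting off the soliton from an imaginary part. -/
theorem imag_edge_decomposition {p : ℝ} (hp : 0 < p) {f g : ℝ → ℝ} (h : EdgeFun f g) :
    edgeQuad p (p + 1) f g = edgeQuad p (p + 1) (fun x => f x + -(f 0) * phi p x)
      (fun x => g x + -(f 0) * -psi p x) := by
  have hy := h.add ((edgeFun_phi hp).const_mul (-(f 0)))
  have e := edgeQuad_add_const_mul p (p + 1) (f 0) hy (edgeFun_phi hp)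
  have e0 : edgeQuad p (p + 1) (phi p) (fun x => -psi p x) = 0 := by
    rw [← edgeBilin_phi hp (edgeFun_phi hp), edgeQuad, edgeBilin]
    simp only [sq]
  rw [edgeBilin_phi hp hy, e0, mul_zero, mul_zero, add_zero, add_zero] at e
  rw [← e]
  congr 1 <;> funext x <;> ring

/-- Subtracting zφ, with z the common vertex value, gives Dirichlet components yⱼ and leaves the
form unchanged since φ is null for L₋. The gap controls the yⱼ, and the constraint then controls z
through N z ‖φ‖² = -∑ⱼ ∫ φ yⱼ. -/
theorem imag_coercive {N : ℕ} (hN : 0 < N) {p : ℝ} (hp : 0 < p) : ∃ κ > 0, ∀ w w' : Fin N → ℝ → ℝ,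
    (∀ j, EdgeFun (w j) (w' j)) → (∃ z, ∀ j, w j 0 = z) →
    ∑ j, ∫ x in Ioi 0, phi p x * w j x = 0 →
    κ * ∑ j, ∫ x in Ioi 0, w j x ^ 2 ≤ ∑ j, edgeQuad p (p + 1) (w j) (w' j) := by
  obtain ⟨κ, hκ, hgap⟩ := edgeQuad_gap_imag hp
  have hΦ := integral_phi_sq_pos hp
  set Φ2 := ∫ x in Ioi 0, phi p x ^ 2 with hΦ2
  have hN' : (0 : ℝ) < N := Nat.cast_pos.2 hN
  refine ⟨κ / (2 * (N + 1)), by positivity, fun w w' hw ⟨z, hz⟩ hc => ?_⟩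
  set y : Fin N → ℝ → ℝ := fun j x => w j x + -z * phi p x with hy
  set y' : Fin N → ℝ → ℝ := fun j x => w' j x + -z * -psi p x with hy'
  have hye : ∀ j, EdgeFun (y j) (y' j) := fun j => (hw j).add ((edgeFun_phi hp).const_mul (-z))
  have hQ : ∀ j, κ * (∫ x in Ioi 0, y j x ^ 2) ≤ edgeQuad p (p + 1) (w j) (w' j) := fun j => by
    rw [imag_edge_decomposition hp (hw j), hz j]
    exact hgap _ _ (hye j) (by simp [hy, hz j, phi_zero])
  set H := ∑ j, ∫ x in Ioi 0, y j x ^ 2 with hH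
  have hyn : ∀ j, 0 ≤ ∫ x in Ioi 0, y j x ^ 2 := fun j => integral_nonneg fun x => sq_nonneg _
  have hH0 : 0 ≤ H := Finset.sum_nonneg fun j _ => hyn j
  have hyH : ∀ j, ∫ x in Ioi 0, y j x ^ 2 ≤ Real.sqrt H ^ 2 := fun j => by
    rw [Real.sq_sqrt hH0]
    exact Finset.single_le_sum (f := fun j => ∫ x in Ioi 0, y j x ^ 2) (fun j _ => hyn j)
      (Finset.mem_univ j)
  have hwy : ∀ j, ∫ x in Ioi 0, phi p x * w j x = (∫ x in Ioi 0, phi p x * y j x) + z * Φ2 := by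
    intro j
    have := integral_add_mul_add_mul ((decays_phi hp).memLp.mul_integrable (hye j).memLp)
      (edgeFun_phi hp).sq_integrable (edgeFun_phi hp).sq_integrable z 0
    rw [zero_mul, add_zero] at this
    rw [← this]
    refine integral_congr_ae (Eventually.of_forall fun x => ?_)
    simp only [hy]; ring
  have hzb : |z| * Φ2 ≤ Real.sqrt Φ2 * Real.sqrt H := by
    simp_rw [hwy] at hc
    rw [Finset.sum_add_distrib, Finset.sum_const, Finset.card_univ, Fintype.card_fin,
      nsmul_eq_mul] at hc
    have h1 : |∑ j, ∫ x in Ioi 0, phi p x * y j x| ≤ N * (Real.sqrt Φ2 * Real.sqrt H) := by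
      refine (Finset.abs_sum_le_sum_abs _ _).trans ?_
      refine (Finset.sum_le_sum fun j _ => abs_integral_mul_le (decays_phi hp).memLp
        (hye j).memLp (Real.sqrt_nonneg H) (hyH j)).trans ?_
      simp [hΦ2]
    have h2 : |∑ j, ∫ x in Ioi 0, phi p x * y j x| = N * (|z| * Φ2) := by
      rw [eq_neg_of_add_eq_zero_left hc, abs_neg, abs_mul, abs_mul, abs_of_pos hN', abs_of_pos hΦ]
    rw [h2] at h1
    exact le_of_mul_le_mul_left h1 hN'
  have hz2 : z ^ 2 * Φ2 ≤ H := by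
    have h1 : (|z| * Φ2) ^ 2 ≤ (Real.sqrt Φ2 * Real.sqrt H) ^ 2 := by gcongr
    rw [mul_pow, mul_pow, Real.sq_sqrt hΦ.le, Real.sq_sqrt hH0, sq_abs] at h1
    have : Φ2 * (z ^ 2 * Φ2) ≤ Φ2 * H := by linarith
    exact le_of_mul_le_mul_left this hΦ
  have hw2 : ∀ j, ∫ x in Ioi 0, w j x ^ 2 ≤ 2 * (∫ x in Ioi 0, y j x ^ 2) + 2 * H := by
    intro j
    have := integral_add_mul_add_mul (hye j).sq_integrable (hye j).sq_integrable
      (edgeFun_phi hp).sq_integrable 1 (2 * z ^ 2)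
    have hle : ∫ x in Ioi 0, w j x ^ 2 ≤
        ∫ x in Ioi 0, (y j x ^ 2 + 1 * y j x ^ 2 + 2 * z ^ 2 * phi p x ^ 2) := by
      refine integral_mono (hw j).sq_integrable
        (((hye j).sq_integrable.add ((hye j).sq_integrable.const_mul 1)).add
          ((edgeFun_phi hp).sq_integrable.const_mul (2 * z ^ 2))) fun x => ?_
      have h1 : w j x = y j x + z * phi p x := by simp only [hy]; ring
      rw [h1]
      simp only
      nlinarith [sq_nonneg (y j x - z * phi p x)]
    rw [this] at hle
    linarith
  have hsum : ∑ j, ∫ x in Ioi 0, w j x ^ 2 ≤ 2 * (N + 1) * H := by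
    refine (Finset.sum_le_sum fun j _ => hw2 j).trans ?_
    rw [Finset.sum_add_distrib, ← Finset.mul_sum, Finset.sum_const, Finset.card_univ,
      Fintype.card_fin, nsmul_eq_mul]
    linarith
  have hfin : κ * H ≤ ∑ j, edgeQuad p (p + 1) (w j) (w' j) := by
    rw [hH, Finset.mul_sum]
    exact Finset.sum_le_sum fun j _ => hQ j
  refine le_trans ?_ hfin
  rw [div_mul_eq_mul_div, div_le_iff₀ (by positivity)]
  nlinarith

theorem integral_phi_psi_pos {p : ℝ} (hp : 0 < p) : 0 < ∫ x in Ioi 0, phi p x * psi p x :=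
  setIntegral_Ioi_pos ((decays_phi hp).memLp.mul_integrable (decays_psi hp).memLp)
    fun x hx => mul_pos (phi_pos p x) (psi_pos hp hx)

theorem integral_psi_sq_pos {p : ℝ} (hp : 0 < p) : 0 < ∫ x in Ioi 0, psi p x ^ 2 :=
  setIntegral_Ioi_pos (edgeFun_psi hp).sq_integrable fun _ hx => pow_pos (psi_pos hp hx) 2

theorem integral_phi_eta_pos {p : ℝ} (hp : 0 < p) (hp₂ : p < 2) :
    0 < ∫ x in Ioi 0, phi p x * eta p x := by
  rw [integral_phi_eta hp]
  refine mul_pos ?_ (integral_phi_sq_pos hp)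
  rw [sub_pos]
  exact one_div_lt_one_div_of_lt (by positivity) (by linarith)

/-- Splitting off the components along `η` and `ψ` from a real part. -/
theorem real_edge_decomposition {p : ℝ} (hp : 0 < p) : ∃ κ > 0, ∀ f g : ℝ → ℝ, EdgeFun f g →
    ∃ (a : ℝ) (k k' : ℝ → ℝ), EdgeFun k k' ∧
      (∀ x, f x = k x + a * psi p x + 2 * p * f 0 * eta p x) ∧
      (∀ x, g x = k' x + a * dpsi p x + 2 * p * f 0 * deta p x) ∧
      κ * (∫ x in Ioi 0, k x ^ 2) ≤ edgeQuad p ((p + 1) * (2 * p + 1)) k k' ∧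
      edgeQuad p ((p + 1) * (2 * p + 1)) f g = edgeQuad p ((p + 1) * (2 * p + 1)) k k' -
        2 * (2 * p * f 0) * (∫ x in Ioi 0, phi p x * f x) +
          (2 * p * f 0) ^ 2 * ∫ x in Ioi 0, phi p x * eta p x := by
  obtain ⟨κ, hκ, x₀, hx₀, hgap⟩ := edgeQuad_gap_real hp
  refine ⟨κ, hκ, fun f g h => ?_⟩
  -- As η(0) = 1/(2p), subtracting bη kills the value at 0.
  set b := 2 * p * f 0 with hb
  have hψ := psi_pos hp hx₀
  have hy := h.add ((edgeFun_eta hp).const_mul (-b))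
  have hy0 : f 0 + -b * eta p 0 = 0 := by rw [eta_zero, hb]; field_simp; ring
  -- As ψ(0) = 0 and ψ(x₀) > 0, subtracting aψ kills the value at x₀ without disturbing the one at
  -- 0.
  set a := (f x₀ + -b * eta p x₀) / psi p x₀ with ha
  have hk := hy.add ((edgeFun_psi hp).const_mul (-a))
  have hk0 : f 0 + -b * eta p 0 + -a * psi p 0 = 0 := by rw [hy0, psi_zero]; ring
  have hkx : f x₀ + -b * eta p x₀ + -a * psi p x₀ = 0 := by rw [ha]; field_simp; ring
  refine ⟨a, _, _, hk, fun x => by ring, fun x => by ring, hgap _ _ hk hk0 hkx, ?_⟩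
  set c := (p + 1) * (2 * p + 1) with hc
  have e1 := edgeQuad_add_const_mul p c a hk (edgeFun_psi hp)
  have e2 := edgeQuad_add_const_mul p c b hy (edgeFun_eta hp)
  have eψ : edgeQuad p c (psi p) (dpsi p) = 0 := by
    rw [← edgeBilin_psi hp (edgeFun_psi hp) (psi_zero p), edgeQuad, edgeBilin]
    simp only [sq, hc]
  have eη : edgeQuad p c (eta p) (deta p) = -∫ x in Ioi 0, phi p x * eta p x := by
    rw [← edgeBilin_eta hp (edgeFun_eta hp), edgeQuad, edgeBilin]
    simp only [sq, hc]
  rw [edgeBilin_psi hp hk hk0, eψ, mul_zero, mul_zero, add_zero, add_zero] at e1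
  rw [edgeBilin_eta hp hy, eη] at e2
  have e3 : (fun x => f x + -b * eta p x + b * eta p x) = f := by funext x; ring
  have e4 : (fun x => g x + -b * deta p x + b * deta p x) = g := by funext x; ring
  have e5 : (fun x => f x + -b * eta p x + -a * psi p x + a * psi p x) =
    fun x => f x + -b * eta p x := by funext x; ring
  have e6 : (fun x => g x + -b * deta p x + -a * dpsi p x + a * dpsi p x) =
    fun x => g x + -b * deta p x := by funext x; ring
  rw [e3, e4] at e2
  rw [e5, e6] at e1
  have i1 := (decays_phi hp).memLp.mul_integrable h.memLp
  have i2 := (decays_phi hp).memLp.mul_integrable (decays_eta hp).memLp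
  have e7 : (∫ x in Ioi 0, phi p x * (f x + -b * eta p x)) =
      (∫ x in Ioi 0, phi p x * f x) - b * ∫ x in Ioi 0, phi p x * eta p x := by
    have := integral_add_mul_add_mul i1 i2 i2 (-b) 0
    rw [zero_mul, add_zero] at this
    refine Eq.trans ?_ (this.trans (by ring))
    refine integral_congr_ae (Eventually.of_forall fun x => ?_)
    simp only
    ring
  rw [e2, e1, e7]
  ring

/-- The decomposition of the real parts over the whole graph, under the mass constraint. -/
theorem real_decomposition {N : ℕ} {p : ℝ} (hp : 0 < p) : ∃ κ > 0, ∀ u u' : Fin N → ℝ → ℝ,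
    (∀ j, EdgeFun (u j) (u' j)) → ∀ z, (∀ j, u j 0 = z) →
    ∑ j, ∫ x in Ioi 0, phi p x * u j x = 0 →
    ∃ (a : Fin N → ℝ) (k k' : Fin N → ℝ → ℝ), (∀ j, EdgeFun (k j) (k' j)) ∧
      (∀ j x, u j x = k j x + a j * psi p x + 2 * p * z * eta p x) ∧
      (∀ j x, u' j x = k' j x + a j * dpsi p x + 2 * p * z * deta p x) ∧
      (∀ j, κ * (∫ x in Ioi 0, k j x ^ 2) ≤ edgeQuad p ((p + 1) * (2 * p + 1)) (k j) (k' j)) ∧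
      ∑ j, edgeQuad p ((p + 1) * (2 * p + 1)) (u j) (u' j) =
        (∑ j, edgeQuad p ((p + 1) * (2 * p + 1)) (k j) (k' j)) +
          N * ((2 * p * z) ^ 2 * ∫ x in Ioi 0, phi p x * eta p x) := by
  obtain ⟨κ, hκ, hdec⟩ := real_edge_decomposition hp
  refine ⟨κ, hκ, fun u u' hu z hz hc => ?_⟩
  choose a k k' hk h1 h2 h3 h4 using fun j => hdec (u j) (u' j) (hu j)
  simp only [hz] at h1 h2 h4
  refine ⟨a, k, k', hk, h1, h2, h3, ?_⟩
  simp_rw [h4]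
  -- The cross term carries the same factor 2pz on every edge, so the mass constraint cancels it in
  -- the sum; the constraint is not available edge by edge.
  rw [Finset.sum_add_distrib, Finset.sum_sub_distrib, ← Finset.mul_sum, hc, Finset.sum_const,
    Finset.card_univ, Fintype.card_fin, nsmul_eq_mul]
  ring

theorem real_nonneg {N : ℕ} {p : ℝ} (hp : 0 < p) (hp₂ : p < 2) {u u' : Fin N → ℝ → ℝ}
    (hu : ∀ j, EdgeFun (u j) (u' j)) {z : ℝ} (hz : ∀ j, u j 0 = z)
    (hc : ∑ j, ∫ x in Ioi 0, phi p x * u j x = 0) :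
    0 ≤ ∑ j, edgeQuad p ((p + 1) * (2 * p + 1)) (u j) (u' j) := by
  obtain ⟨κ, hκ, hdec⟩ := real_decomposition (N := N) hp
  obtain ⟨a, k, k', hk, h1, h2, h3, h4⟩ := hdec u u' hu z hz hc
  rw [h4]
  have := integral_phi_eta_pos hp hp₂
  refine add_nonneg (Finset.sum_nonneg fun j _ => le_trans ?_ (h3 j)) (by positivity)
  exact mul_nonneg hκ.le (integral_nonneg fun x => sq_nonneg _)

/-- The potential is bounded below by -(1 + |c|), so control of the form and of the L² norm is
control of the H¹ norm. -/
theorem integral_der_sq_le (p c : ℝ) {f g : ℝ → ℝ} (h : EdgeFun f g) :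
    ∫ x in Ioi 0, g x ^ 2 ≤ edgeQuad p c f g + (1 + |c|) * ∫ x in Ioi 0, f x ^ 2 := by
  have := integral_add_mul_add_mul (edgeQuad_integrable p c h) h.sq_integrable h.sq_integrable
    (1 + |c|) 0
  rw [zero_mul, add_zero] at this
  rw [edgeQuad, ← this]
  refine integral_mono h.sq_integrable' (((edgeQuad_integrable p c h).add
    (h.sq_integrable.const_mul _)).add (h.sq_integrable.const_mul 0)) fun x => ?_
  have h1 := (abs_le.1 (abs_sechSq_mul_sub_one_le p c x)).1
  have h2 := mul_le_mul_of_nonneg_right h1 (sq_nonneg (f x))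
  simp only
  linarith

theorem ae_eq_zero_of_integral_sq {f : ℝ → ℝ} (hf : MemLp f 2 halfLine)
    (h : ∫ x in Ioi 0, f x ^ 2 ≤ 0) : ∀ᵐ x ∂halfLine, f x = 0 := by
  have h0 : ∫ x in Ioi 0, f x ^ 2 = 0 := le_antisymm h (integral_nonneg fun x => sq_nonneg _)
  have := (integral_eq_zero_iff_of_nonneg (fun x => sq_nonneg (f x)) hf.sq_integrableOn).1 h0
  filter_upwards [this] with x hx
  simpa using hx

/-- Both parts of the decomposition are nonnegative, so z = 0 and the Dirichlet parts vanish. What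
is left on each edge is aⱼψ, and the constraint reads (∑ aⱼ) ∫ φψ = 0 with ∫ φψ > 0. -/
theorem real_zero {N : ℕ} (hN : 0 < N) {p : ℝ} (hp : 0 < p) (hp₂ : p < 2) {u u' : Fin N → ℝ → ℝ}
    (hu : ∀ j, EdgeFun (u j) (u' j)) {z : ℝ} (hz : ∀ j, u j 0 = z)
    (hc : ∑ j, ∫ x in Ioi 0, phi p x * u j x = 0)
    (h0 : ∑ j, edgeQuad p ((p + 1) * (2 * p + 1)) (u j) (u' j) ≤ 0) :
    ∃ a : Fin N → ℝ, ∑ j, a j = 0 ∧ ∀ j, ∀ᵐ x ∂halfLine, u j x = a j * psi p x ∧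
      u' j x = a j * dpsi p x := by
  obtain ⟨κ, hκ, hdec⟩ := real_decomposition (N := N) hp
  obtain ⟨a, k, k', hk, h1, h2, h3, h4⟩ := hdec u u' hu z hz hc
  have hγ := integral_phi_eta_pos hp hp₂
  have hN' : (0 : ℝ) < N := Nat.cast_pos.2 hN
  have hkn : ∀ j, 0 ≤ ∫ x in Ioi 0, k j x ^ 2 := fun j => integral_nonneg fun x => sq_nonneg _
  have hQn : ∀ j, 0 ≤ edgeQuad p ((p + 1) * (2 * p + 1)) (k j) (k' j) := fun j =>
    (mul_nonneg hκ.le (hkn j)).trans (h3 j)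
  have hQs := Finset.sum_nonneg fun j (_ : j ∈ Finset.univ) => hQn j
  rw [h4] at h0
  have hz0 : z = 0 := by
    by_contra hne
    have h5 : 0 < (2 * p * z) ^ 2 := by positivity
    have h6 : 0 < (N : ℝ) * ((2 * p * z) ^ 2 * ∫ x in Ioi 0, phi p x * eta p x) :=
      mul_pos hN' (mul_pos h5 hγ)
    linarith
  have hQ0 : ∀ j, edgeQuad p ((p + 1) * (2 * p + 1)) (k j) (k' j) = 0 := fun j => by
    have : ∑ j, edgeQuad p ((p + 1) * (2 * p + 1)) (k j) (k' j) = 0 := by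
      rw [hz0] at h0
      simp only [mul_zero, ne_eq, OfNat.ofNat_ne_zero, not_false_eq_true, zero_pow, zero_mul,
        add_zero] at h0
      exact le_antisymm h0 hQs
    exact (Finset.sum_eq_zero_iff_of_nonneg fun j _ => hQn j).1 this j (Finset.mem_univ j)
  have hk0 : ∀ j, ∫ x in Ioi 0, k j x ^ 2 = 0 := fun j => by
    have := h3 j
    rw [hQ0 j] at this
    by_contra hne
    have : 0 < κ * ∫ x in Ioi 0, k j x ^ 2 := mul_pos hκ (lt_of_le_of_ne (hkn j) (Ne.symm hne))
    linarith
  have hkz : ∀ j, ∀ᵐ x ∂halfLine, k j x = 0 := fun j =>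
    ae_eq_zero_of_integral_sq (hk j).memLp (hk0 j).le
  have hkz' : ∀ j, ∀ᵐ x ∂halfLine, k' j x = 0 := fun j =>
    ae_eq_zero_of_integral_sq (hk j).memLp' (by
      have := integral_der_sq_le p ((p + 1) * (2 * p + 1)) (hk j)
      rw [hQ0 j, hk0 j] at this
      linarith)
  refine ⟨a, ?_, fun j => ?_⟩
  · have e : ∀ j, ∫ x in Ioi 0, phi p x * u j x = a j * ∫ x in Ioi 0, phi p x * psi p x := by
      intro j
      rw [← integral_const_mul]
      refine integral_congr_ae ?_
      filter_upwards [hkz j] with x hx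
      rw [h1, hx, hz0]; ring
    simp_rw [e] at hc
    rw [← Finset.sum_mul] at hc
    exact (mul_eq_zero.1 hc).resolve_right (integral_phi_psi_pos hp).ne'
  · filter_upwards [hkz j, hkz' j] with x hx hx'
    rw [h1, h2, hx, hx', hz0]
    constructor <;> ring

/-- The form controls the Dirichlet parts kⱼ and b = 2pz but does not see the amplitudes aⱼ.
Equality of the moments ∫ ψuⱼ, which encodes orthogonality to the kernel, bounds the differences aᵢ
- aⱼ, and the mass constraint bounds ∑ aⱼ; together they bound every aᵢ. -/
theorem real_coercive {N : ℕ} (hN : 0 < N) {p : ℝ} (hp : 0 < p) (hp₂ : p < 2) :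
    ∃ κ > 0, ∀ u u' : Fin N → ℝ → ℝ,
    (∀ j, EdgeFun (u j) (u' j)) → (∃ z, ∀ j, u j 0 = z) →
    ∑ j, ∫ x in Ioi 0, phi p x * u j x = 0 →
    (∀ i j, ∫ x in Ioi 0, psi p x * u i x = ∫ x in Ioi 0, psi p x * u j x) →
    κ * ∑ j, ∫ x in Ioi 0, u j x ^ 2 ≤
      ∑ j, edgeQuad p ((p + 1) * (2 * p + 1)) (u j) (u' j) := by
  obtain ⟨κ, hκ, hdec⟩ := real_decomposition (N := N) hp
  have hγ := integral_phi_eta_pos hp hp₂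
  have hP := integral_phi_psi_pos hp
  have hΨ := integral_psi_sq_pos hp
  have hN' : (0 : ℝ) < N := Nat.cast_pos.2 hN
  set γ := ∫ x in Ioi 0, phi p x * eta p x with hγd
  set P := ∫ x in Ioi 0, phi p x * psi p x with hPd
  set Ψ2 := ∫ x in Ioi 0, psi p x ^ 2 with hΨd
  set sφ := Real.sqrt (∫ x in Ioi 0, phi p x ^ 2) with hsφ
  set sψ := Real.sqrt Ψ2 with hsψ
  set E2 := ∫ x in Ioi 0, eta p x ^ 2 with hE2
  have hE20 : 0 ≤ E2 := integral_nonneg fun x => sq_nonneg _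
  have hsφ0 : 0 ≤ sφ := Real.sqrt_nonneg _
  have hsψ0 : 0 ≤ sψ := Real.sqrt_nonneg _
  -- The first summand comes from the differences aᵢ - aⱼ, the second from the mean of the aⱼ.
  set c := 2 * sψ / Ψ2 + (γ + sφ) / P with hcdef
  have hc0 : 0 ≤ c := by positivity
  set D := 3 * (N * (c ^ 2 * Ψ2 + E2) + 1) with hD
  have hD0 : 0 < D := by positivity
  set κ' := min κ (N * γ) with hκ'
  have hκ'0 : 0 < κ' := lt_min hκ (by positivity)
  refine ⟨κ' / D, by positivity, fun u u' hu ⟨z, hz⟩ hc hψ => ?_⟩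
  obtain ⟨a, k, k', hk, h1, h2, h3, h4⟩ := hdec u u' hu z hz hc
  set b := 2 * p * z with hb
  have hkn : ∀ j, 0 ≤ ∫ x in Ioi 0, k j x ^ 2 := fun j => integral_nonneg fun x => sq_nonneg _
  set K := ∑ j, ∫ x in Ioi 0, k j x ^ 2 with hK
  have hK0 : 0 ≤ K := Finset.sum_nonneg fun j _ => hkn j
  -- h measures what the form controls: b and the L² norms of the kⱼ.
  set h := Real.sqrt (b ^ 2 + K) with hh
  have hh2 : h ^ 2 = b ^ 2 + K := Real.sq_sqrt (by positivity)
  have hh0 : 0 ≤ h := Real.sqrt_nonneg _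
  have hkh : ∀ j, ∫ x in Ioi 0, k j x ^ 2 ≤ h ^ 2 := fun j => by
    rw [hh2]
    have := Finset.single_le_sum (f := fun j => ∫ x in Ioi 0, k j x ^ 2) (fun j _ => hkn j)
      (Finset.mem_univ j)
    have := sq_nonneg b
    linarith
  have hbh : |b| ≤ h := abs_le_of_sq_le_sq (by linarith) hh0
  have expand : ∀ {m : ℝ → ℝ}, MemLp m 2 halfLine → ∀ j, ∫ x in Ioi 0, m x * u j x =
      (∫ x in Ioi 0, m x * k j x) + a j * (∫ x in Ioi 0, m x * psi p x) +
        b * ∫ x in Ioi 0, m x * eta p x := by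
    intro m hm j
    rw [← integral_add_mul_add_mul (hm.mul_integrable (hk j).memLp)
      (hm.mul_integrable (decays_psi hp).memLp) (hm.mul_integrable (decays_eta hp).memLp)]
    refine integral_congr_ae (Eventually.of_forall fun x => ?_)
    simp only [h1]
    ring
  have hdiff : ∀ i j, |a i - a j| ≤ 2 * sψ / Ψ2 * h := by
    intro i j
    have e := hψ i j
    rw [expand (decays_psi hp).memLp, expand (decays_psi hp).memLp] at e
    have e2 : ∫ x in Ioi 0, psi p x * psi p x = Ψ2 := by simp only [hΨd, sq]
    rw [e2] at e
    have x1 := abs_le.1 (abs_integral_mul_le (decays_psi hp).memLp (hk i).memLp hh0 (hkh i))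
    have x2 := abs_le.1 (abs_integral_mul_le (decays_psi hp).memLp (hk j).memLp hh0 (hkh j))
    have e3 : (a i - a j) * Ψ2 =
      (∫ x in Ioi 0, psi p x * k j x) - ∫ x in Ioi 0, psi p x * k i x := by linarith
    rw [div_mul_eq_mul_div, le_div_iff₀ hΨ]
    rw [show |a i - a j| * Ψ2 = |(a i - a j) * Ψ2| by rw [abs_mul, abs_of_pos hΨ], e3, abs_le]
    constructor <;> linarith [x1.1, x1.2, x2.1, x2.2]
  have hsum : |∑ j, a j| ≤ N * ((γ + sφ) / P * h) := by
    simp_rw [expand (decays_phi hp).memLp] at hc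
    rw [Finset.sum_add_distrib, Finset.sum_add_distrib, ← Finset.sum_mul, Finset.sum_const,
      Finset.card_univ, Fintype.card_fin, nsmul_eq_mul] at hc
    have x1 : |∑ j, ∫ x in Ioi 0, phi p x * k j x| ≤ N * (sφ * h) := by
      refine (Finset.abs_sum_le_sum_abs _ _).trans ?_
      refine (Finset.sum_le_sum fun j _ => abs_integral_mul_le (decays_phi hp).memLp
        (hk j).memLp hh0 (hkh j)).trans ?_
      simp [hsφ]
    have e3 : (∑ j, a j) * P = -(∑ j, ∫ x in Ioi 0, phi p x * k j x) - N * (b * γ) := by linarith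
    have x2 : |(∑ j, a j) * P| ≤ N * (sφ * h) + N * (h * γ) := by
      rw [e3]
      refine (abs_sub _ _).trans (add_le_add (by rwa [abs_neg]) ?_)
      rw [abs_mul, abs_mul, abs_of_pos hN', abs_of_pos hγ]
      gcongr
    rw [abs_mul, abs_of_pos hP] at x2
    rw [div_mul_eq_mul_div, mul_div_assoc', le_div_iff₀ hP]
    linarith
  have ha : ∀ i, |a i| ≤ c * h := by
    intro i
    have e : N * a i = (∑ j, (a i - a j)) + ∑ j, a j := by
      rw [← Finset.sum_add_distrib]; simp
    have x1 : |∑ j, (a i - a j)| ≤ N * (2 * sψ / Ψ2 * h) := by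
      refine (Finset.abs_sum_le_sum_abs _ _).trans ?_
      refine (Finset.sum_le_sum fun j _ => hdiff i j).trans ?_
      simp
    have x2 : N * |a i| ≤ N * (c * h) := by
      rw [show N * |a i| = |N * a i| by rw [abs_mul, abs_of_pos hN'], e]
      refine (abs_add_le _ _).trans ((add_le_add x1 hsum).trans (le_of_eq ?_))
      rw [hcdef]; ring
    exact le_of_mul_le_mul_left x2 hN'
  have ha2 : ∀ i, a i ^ 2 ≤ c ^ 2 * h ^ 2 := fun i => by
    rw [← mul_pow, ← sq_abs]
    gcongr
    exact ha i
  have hu2 : ∀ j, ∫ x in Ioi 0, u j x ^ 2 ≤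
      3 * (∫ x in Ioi 0, k j x ^ 2) + 3 * (c ^ 2 * h ^ 2) * Ψ2 + 3 * h ^ 2 * E2 := by
    intro j
    rw [← integral_const_mul, hΨd, hE2, ← integral_add_mul_add_mul
      ((hk j).sq_integrable.const_mul 3) (edgeFun_psi hp).sq_integrable
      (edgeFun_eta hp).sq_integrable]
    refine integral_mono (hu j).sq_integrable ((((hk j).sq_integrable.const_mul 3).add
      ((edgeFun_psi hp).sq_integrable.const_mul (3 * (c ^ 2 * h ^ 2)))).add
      ((edgeFun_eta hp).sq_integrable.const_mul (3 * h ^ 2))) fun x => ?_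
    simp only
    rw [h1]
    have y1 := mul_le_mul_of_nonneg_right (ha2 j) (sq_nonneg (psi p x))
    have y2 : b ^ 2 * eta p x ^ 2 ≤ h ^ 2 * eta p x ^ 2 :=
      mul_le_mul_of_nonneg_right (by linarith) (sq_nonneg _)
    nlinarith [sq_nonneg (k j x - a j * psi p x), sq_nonneg (k j x - b * eta p x),
      sq_nonneg (a j * psi p x - b * eta p x)]
  have hU : ∑ j, ∫ x in Ioi 0, u j x ^ 2 ≤ D * h ^ 2 := by
    refine (Finset.sum_le_sum fun j _ => hu2 j).trans ?_
    rw [Finset.sum_add_distrib, Finset.sum_add_distrib, ← Finset.mul_sum, Finset.sum_const,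
      Finset.sum_const, Finset.card_univ, Fintype.card_fin, nsmul_eq_mul, nsmul_eq_mul, hD]
    have : K ≤ h ^ 2 := by have := sq_nonneg b; linarith
    nlinarith
  have hQ : κ' * h ^ 2 ≤ ∑ j, edgeQuad p ((p + 1) * (2 * p + 1)) (u j) (u' j) := by
    rw [h4, hh2, mul_add, add_comm]
    refine add_le_add ?_ ?_
    · rw [hK, Finset.mul_sum]
      exact Finset.sum_le_sum fun j _ => le_trans
        (mul_le_mul_of_nonneg_right (min_le_left _ _) (hkn j)) (h3 j)
    · have := mul_le_mul_of_nonneg_right (min_le_right κ (N * γ)) (sq_nonneg b)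
      linarith
  refine le_trans ?_ hQ
  rw [div_mul_eq_mul_div, div_le_iff₀ hD0]
  have := mul_le_mul_of_nonneg_left hU hκ'0.le
  linarith

end StarGraph

/-! ### The quadratic form on the energy space -/

namespace StarGraph

section edge

variable {f g F G : ℝ → ℝ}

theorem integrable_edgeQuad (p c : ℝ) (hf : MemLp f 2 halfLine) (hg : MemLp g 2 halfLine) :
    IntegrableOn (fun x => g x ^ 2 + (1 - c * sechSq p x) * f x ^ 2) (Ioi 0) :=
  hg.sq_integrableOn.add (integrable_potential_mul p c hf.sq_integrableOn)

theorem edgeQuad_congr (p c : ℝ) (hf : f =ᵐ[halfLine] F) (hg : g =ᵐ[halfLine] G) :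
    edgeQuad p c f g = edgeQuad p c F G := by
  refine integral_congr_ae ?_
  filter_upwards [hf, hg] with x h1 h2
  rw [h1, h2]

theorem edgeQuad_smul (p c t : ℝ) (f g : ℝ → ℝ) :
    edgeQuad p c (fun x => t * f x) (fun x => t * g x) = t ^ 2 * edgeQuad p c f g := by
  rw [edgeQuad, edgeQuad, ← integral_const_mul]
  refine integral_congr_ae (Eventually.of_forall fun x => ?_)
  simp only
  ring

theorem edgeQuad_parallelogram (p c : ℝ) (hf : MemLp f 2 halfLine) (hg : MemLp g 2 halfLine)
    (hF : MemLp F 2 halfLine) (hG : MemLp G 2 halfLine) :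
    edgeQuad p c f g + edgeQuad p c F G =
      1 / 2 * edgeQuad p c (fun x => f x + F x) (fun x => g x + G x) +
      1 / 2 * edgeQuad p c (fun x => f x - F x) (fun x => g x - G x) := by
  have i1 := integrable_edgeQuad p c hf hg
  have i2 := integrable_edgeQuad p c hF hG
  have i3 := integrable_edgeQuad p c (hf.add hF) (hg.add hG)
  have i4 := integrable_edgeQuad p c (hf.sub hF) (hg.sub hG)
  have e1 : edgeQuad p c f g + edgeQuad p c F G = _ := (integral_add i1 i2).symm
  have e2 := (integral_add (i3.const_mul (1 / 2)) (i4.const_mul (1 / 2))).symm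
  rw [integral_const_mul, integral_const_mul] at e2
  refine e1.trans (Eq.trans ?_ e2.symm)
  refine integral_congr_ae (Eventually.of_forall fun x => ?_)
  simp only [Pi.add_apply, Pi.sub_apply]
  ring

/-- From a² - b² = (a - b)(a + b) and Young's inequality with free weight t. Continuity of the form
follows by choosing t, without building the bilinear form on H¹_Γ. -/
theorem edgeQuad_sub_le (p c : ℝ) (hf : MemLp f 2 halfLine) (hg : MemLp g 2 halfLine)
    (hF : MemLp F 2 halfLine) (hG : MemLp G 2 halfLine) {t : ℝ} (ht : 0 < t) :
    |edgeQuad p c f g - edgeQuad p c F G| ≤ (1 + |c|) *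
      (1 / t * ((∫ x in Ioi 0, (f x - F x) ^ 2) + ∫ x in Ioi 0, (g x - G x) ^ 2) +
        t * ((∫ x in Ioi 0, (f x + F x) ^ 2) + ∫ x in Ioi 0, (g x + G x) ^ 2)) := by
  have j1 := (hf.sub hF).sq_integrableOn
  have j2 := (hg.sub hG).sq_integrableOn
  have j3 := (hf.add hF).sq_integrableOn
  have j4 := (hg.add hG).sq_integrableOn
  have j12 : IntegrableOn (fun x => (f x - F x) ^ 2 + (g x - G x) ^ 2) (Ioi 0) := j1.add j2
  have j34 : IntegrableOn (fun x => (f x + F x) ^ 2 + (g x + G x) ^ 2) (Ioi 0) := j3.add j4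
  have e1 := integral_add j1 j2
  have e2 := integral_add j3 j4
  simp only [Pi.add_apply, Pi.sub_apply] at e1 e2
  rw [← e1, ← e2, edgeQuad, edgeQuad, ← integral_sub (integrable_edgeQuad p c hf hg)
    (integrable_edgeQuad p c hF hG), ← integral_const_mul, ← integral_const_mul,
    ← integral_add (j12.const_mul _) (j34.const_mul _), ← integral_const_mul]
  refine (abs_integral_le_integral_abs).trans (integral_mono
    ((integrable_edgeQuad p c hf hg).sub (integrable_edgeQuad p c hF hG)).abs
    (((j12.const_mul _).add (j34.const_mul _)).const_mul _) fun x => ?_)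
  have key : ∀ a b : ℝ, |a ^ 2 - b ^ 2| ≤ 1 / t * (a - b) ^ 2 + t * (a + b) ^ 2 := by
    intro a b
    have h1 : 1 / t * (a - b) ^ 2 + t * (a + b) ^ 2 - 2 * (a - b) * (a + b) =
      1 / t * ((a - b) - t * (a + b)) ^ 2 := by field_simp; ring
    have h2 : 1 / t * (a - b) ^ 2 + t * (a + b) ^ 2 + 2 * (a - b) * (a + b) =
      1 / t * ((a - b) + t * (a + b)) ^ 2 := by field_simp; ring
    have h3 : 0 ≤ 1 / t * ((a - b) - t * (a + b)) ^ 2 := by positivity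
    have h4 : 0 ≤ 1 / t * ((a - b) + t * (a + b)) ^ 2 := by positivity
    have h5 : 0 ≤ 1 / t * (a - b) ^ 2 + t * (a + b) ^ 2 := by positivity
    rw [abs_le]
    constructor <;> nlinarith
  have k1 := key (g x) (G x)
  have k2 := key (f x) (F x)
  have hc := abs_sechSq_mul_sub_one_le p c x
  simp only
  calc |g x ^ 2 + (1 - c * sechSq p x) * f x ^ 2 -
        (G x ^ 2 + (1 - c * sechSq p x) * F x ^ 2)|
      = |(g x ^ 2 - G x ^ 2) + (1 - c * sechSq p x) * (f x ^ 2 - F x ^ 2)| := by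
        congr 1; ring
    _ ≤ 1 * |g x ^ 2 - G x ^ 2| + (1 + |c|) * |f x ^ 2 - F x ^ 2| := by
        refine (abs_add_le _ _).trans ?_
        rw [abs_mul, one_mul]
        gcongr
    _ ≤ (1 + |c|) * (1 / t * (g x - G x) ^ 2 + t * (g x + G x) ^ 2) +
        (1 + |c|) * (1 / t * (f x - F x) ^ 2 + t * (f x + F x) ^ 2) := by
        have : 1 ≤ 1 + |c| := by linarith [abs_nonneg c]
        gcongr
    _ = _ := by ring

end edge

variable {N : ℕ}

theorem val_add (V W : H1 N) : val (V + W) = val V + val W := rfl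
theorem der_add (V W : H1 N) : der (V + W) = der V + der W := rfl
theorem val_sub (V W : H1 N) : val (V - W) = val V - val W := rfl
theorem der_sub (V W : H1 N) : der (V - W) = der V - der W := rfl
theorem val_smul (t : ℝ) (V : H1 N) : val (t • V) = t • val V := rfl
theorem der_smul (t : ℝ) (V : H1 N) : der (t • V) = t • der V := rfl

theorem coeFn_add (Ψ Θ : L2 N) (j : Fin N) :
    ∀ᵐ x ∂halfLine, (Ψ + Θ) j x = Ψ j x + Θ j x := Lp.coeFn_add (Ψ j) (Θ j)

theorem coeFn_sub (Ψ Θ : L2 N) (j : Fin N) :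
    ∀ᵐ x ∂halfLine, (Ψ - Θ) j x = Ψ j x - Θ j x := Lp.coeFn_sub (Ψ j) (Θ j)

theorem coeFn_smul (t : ℝ) (Ψ : L2 N) (j : Fin N) :
    ∀ᵐ x ∂halfLine, (t • Ψ) j x = t * Ψ j x := by
  filter_upwards [Lp.coeFn_smul t (Ψ j)] with x hx
  change (t • Ψ j) x = _
  rw [hx]; simp

theorem coeFn_add_re (Ψ Θ : L2 N) (j : Fin N) :
    (fun x => ((Ψ + Θ) j x).re) =ᵐ[halfLine] fun x => (Ψ j x).re + (Θ j x).re :=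
  (coeFn_add Ψ Θ j).mono fun x hx => by simp only [hx, Complex.add_re]

theorem coeFn_add_im (Ψ Θ : L2 N) (j : Fin N) :
    (fun x => ((Ψ + Θ) j x).im) =ᵐ[halfLine] fun x => (Ψ j x).im + (Θ j x).im :=
  (coeFn_add Ψ Θ j).mono fun x hx => by simp only [hx, Complex.add_im]

theorem coeFn_sub_re (Ψ Θ : L2 N) (j : Fin N) :
    (fun x => ((Ψ - Θ) j x).re) =ᵐ[halfLine] fun x => (Ψ j x).re - (Θ j x).re :=
  (coeFn_sub Ψ Θ j).mono fun x hx => by simp only [hx, Complex.sub_re]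

theorem coeFn_sub_im (Ψ Θ : L2 N) (j : Fin N) :
    (fun x => ((Ψ - Θ) j x).im) =ᵐ[halfLine] fun x => (Ψ j x).im - (Θ j x).im :=
  (coeFn_sub Ψ Θ j).mono fun x hx => by simp only [hx, Complex.sub_im]

theorem coeFn_smul_re (t : ℝ) (Ψ : L2 N) (j : Fin N) :
    (fun x => ((t • Ψ) j x).re) =ᵐ[halfLine] fun x => t * (Ψ j x).re :=
  (coeFn_smul t Ψ j).mono fun x hx => by simp only [hx, Complex.re_ofReal_mul]

theorem coeFn_smul_im (t : ℝ) (Ψ : L2 N) (j : Fin N) :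
    (fun x => ((t • Ψ) j x).im) =ᵐ[halfLine] fun x => t * (Ψ j x).im :=
  (coeFn_smul t Ψ j).mono fun x hx => by simp only [hx, Complex.im_ofReal_mul]

theorem memLp_re (Ψ : L2 N) (j : Fin N) : MemLp (fun x => (Ψ j x).re) 2 halfLine :=
  (Lp.memLp (Ψ j)).re

theorem memLp_im (Ψ : L2 N) (j : Fin N) : MemLp (fun x => (Ψ j x).im) 2 halfLine :=
  (Lp.memLp (Ψ j)).im

theorem H1_norm_sq_eq_sum (V : H1 N) :
    ‖V‖ ^ 2 = ∑ j, (((∫ x in Ioi 0, (val V j x).re ^ 2) + ∫ x in Ioi 0, (der V j x).re ^ 2) +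
      ((∫ x in Ioi 0, (val V j x).im ^ 2) + ∫ x in Ioi 0, (der V j x).im ^ 2)) := by
  rw [H1_norm_sq, L2_norm_sq, L2_norm_sq, ← Finset.sum_add_distrib]
  refine Finset.sum_congr rfl fun j _ => ?_
  rw [Lp_norm_sq, Lp_norm_sq]
  ring

/-- Half the second variation of the action at `Φ`. -/
noncomputable def quadForm (p : ℝ) (V : H1 N) : ℝ :=
  ∑ j, (edgeQuad p ((p + 1) * (2 * p + 1)) (fun x => (val V j x).re) (fun x => (der V j x).re) +
    edgeQuad p (p + 1) (fun x => (val V j x).im) (fun x => (der V j x).im))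

theorem quadForm_smul (p t : ℝ) (V : H1 N) : quadForm p (t • V) = t ^ 2 * quadForm p V := by
  rw [quadForm, quadForm, Finset.mul_sum]
  refine Finset.sum_congr rfl fun j _ => ?_
  rw [val_smul, der_smul, edgeQuad_congr p _ (coeFn_smul_re t (val V) j)
    (coeFn_smul_re t (der V) j), edgeQuad_congr p (p + 1) (coeFn_smul_im t (val V) j)
    (coeFn_smul_im t (der V) j), edgeQuad_smul, edgeQuad_smul]
  ring

/-- The form in which quadraticity of Q enters `exists_reduction`: it measures the midpoint
convexity exactly. -/
theorem quadForm_parallelogram (p : ℝ) (V W : H1 N) :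
    quadForm p V + quadForm p W =
      2 * quadForm p ((1 / 2 : ℝ) • (V + W)) + 1 / 2 * quadForm p (V - W) := by
  have e : quadForm p V + quadForm p W =
      1 / 2 * quadForm p (V + W) + 1 / 2 * quadForm p (V - W) := by
    simp only [quadForm]
    rw [← Finset.sum_add_distrib, Finset.mul_sum, Finset.mul_sum, ← Finset.sum_add_distrib]
    refine Finset.sum_congr rfl fun j _ => ?_
    have q1 := edgeQuad_parallelogram p ((p + 1) * (2 * p + 1)) (memLp_re (val V) j)
      (memLp_re (der V) j) (memLp_re (val W) j) (memLp_re (der W) j)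
    have q2 := edgeQuad_parallelogram p (p + 1) (memLp_im (val V) j)
      (memLp_im (der V) j) (memLp_im (val W) j) (memLp_im (der W) j)
    rw [val_add, der_add, val_sub, der_sub]
    rw [edgeQuad_congr p _ (coeFn_add_re (val V) (val W) j) (coeFn_add_re (der V) (der W) j),
      edgeQuad_congr p (p + 1) (coeFn_add_im (val V) (val W) j) (coeFn_add_im (der V) (der W) j),
      edgeQuad_congr p _ (coeFn_sub_re (val V) (val W) j) (coeFn_sub_re (der V) (der W) j),
      edgeQuad_congr p (p + 1) (coeFn_sub_im (val V) (val W) j) (coeFn_sub_im (der V) (der W) j)]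
    linarith
  rw [e, quadForm_smul]
  ring

theorem quadForm_sub_le (p : ℝ) : ∃ C > 0, ∀ (V W : H1 N) (t : ℝ), 0 < t →
    |quadForm p V - quadForm p W| ≤ C * (1 / t * ‖V - W‖ ^ 2 + t * ‖V + W‖ ^ 2) := by
  refine ⟨1 + |(p + 1) * (2 * p + 1)| + |p + 1|, by positivity, fun V W t ht => ?_⟩
  rw [H1_norm_sq_eq_sum, H1_norm_sq_eq_sum, quadForm, quadForm, ← Finset.sum_sub_distrib,
    Finset.mul_sum, Finset.mul_sum, ← Finset.sum_add_distrib, Finset.mul_sum]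
  refine (Finset.abs_sum_le_sum_abs _ _).trans (Finset.sum_le_sum fun j _ => ?_)
  have q1 := edgeQuad_sub_le p ((p + 1) * (2 * p + 1)) (memLp_re (val V) j)
    (memLp_re (der V) j) (memLp_re (val W) j) (memLp_re (der W) j) ht
  have q2 := edgeQuad_sub_le p (p + 1) (memLp_im (val V) j)
    (memLp_im (der V) j) (memLp_im (val W) j) (memLp_im (der W) j) ht
  have ec : ∀ {u v : ℝ → ℝ}, u =ᵐ[halfLine] v →
      ∫ x in Ioi 0, u x ^ 2 = ∫ x in Ioi 0, v x ^ 2 := fun h =>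
    integral_congr_ae (h.mono fun x hx => by simp only [hx])
  have nn : ∀ u : ℝ → ℝ, 0 ≤ ∫ x in Ioi 0, u x ^ 2 := fun u => integral_nonneg fun x => sq_nonneg _
  rw [val_add, der_add, val_sub, der_sub,
    ec (coeFn_add_re (val V) (val W) j),
    ec (coeFn_add_re (der V) (der W) j),
    ec (coeFn_add_im (val V) (val W) j),
    ec (coeFn_add_im (der V) (der W) j),
    ec (coeFn_sub_re (val V) (val W) j),
    ec (coeFn_sub_re (der V) (der W) j),
    ec (coeFn_sub_im (val V) (val W) j),
    ec (coeFn_sub_im (der V) (der W) j)]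
  rw [add_sub_add_comm]
  refine (abs_add_le _ _).trans ((add_le_add q1 q2).trans ?_)
  have hm : ∀ {c X : ℝ}, 1 + c ≤ 1 + |(p + 1) * (2 * p + 1)| + |p + 1| → 0 ≤ X →
      (1 + c) * X ≤ (1 + |(p + 1) * (2 * p + 1)| + |p + 1|) * X :=
    fun h hX => mul_le_mul_of_nonneg_right h hX
  have nn1 := nn fun x => (val V j x).re - (val W j x).re
  have nn2 := nn fun x => (der V j x).re - (der W j x).re
  have nn3 := nn fun x => (val V j x).re + (val W j x).re
  have nn4 := nn fun x => (der V j x).re + (der W j x).re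
  have nn5 := nn fun x => (val V j x).im - (val W j x).im
  have nn6 := nn fun x => (der V j x).im - (der W j x).im
  have nn7 := nn fun x => (val V j x).im + (val W j x).im
  have nn8 := nn fun x => (der V j x).im + (der W j x).im
  refine (add_le_add (hm (by linarith [abs_nonneg (p + 1)]) (by positivity))
    (hm (by linarith [abs_nonneg ((p + 1) * (2 * p + 1))]) (by positivity))).trans (le_of_eq ?_)
  ring

theorem quadForm_zero (p : ℝ) : quadForm p (0 : H1 N) = 0 := by
  have := quadForm_smul p 0 (0 : H1 N)
  simpa using this

theorem abs_quadForm_le (p : ℝ) : ∃ C > 0, ∀ V : H1 N, |quadForm p V| ≤ C * ‖V‖ ^ 2 := by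
  obtain ⟨C, hC, h⟩ := quadForm_sub_le (N := N) p
  refine ⟨2 * C, by positivity, fun V => ?_⟩
  have := h V 0 1 one_pos
  rw [quadForm_zero, sub_zero, sub_zero, add_zero] at this
  linarith

theorem continuous_quadForm (p : ℝ) : Continuous (quadForm (N := N) p) := by
  obtain ⟨C, hC, h⟩ := quadForm_sub_le (N := N) p
  refine continuous_iff_continuousAt.2 fun W => ?_
  rw [Metric.continuousAt_iff]
  intro ε hε
  set M := (2 * ‖W‖ + 1) ^ 2 with hM
  have hM0 : 0 < M := by positivity
  -- The weight makes the term in ‖V + W‖² small first; the radius is then chosen for the term in ‖V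
  -- - W‖²/t.
  set t := ε / (4 * C * M) with ht
  have ht0 : 0 < t := by positivity
  refine ⟨min 1 (Real.sqrt (t * (ε / (4 * C)))), lt_min one_pos (Real.sqrt_pos.2 (by positivity)),
    fun {V} hV => ?_⟩
  rw [dist_eq_norm] at hV
  have h1 : ‖V - W‖ < 1 := hV.trans_le (min_le_left _ _)
  have h2 : ‖V - W‖ ^ 2 ≤ t * (ε / (4 * C)) := by
    rw [← Real.sq_sqrt (show 0 ≤ t * (ε / (4 * C)) by positivity)]
    gcongr
    exact hV.le.trans (min_le_right _ _)
  have h3 : ‖V + W‖ ^ 2 ≤ M := by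
    rw [hM]
    gcongr
    have : V + W = (V - W) + (W + W) := by abel
    rw [this]
    have := norm_add_le (V - W) (W + W)
    have := norm_add_le W W
    linarith
  rw [Real.dist_eq]
  refine (h V W t ht0).trans_lt ?_
  have h4 : 1 / t * ‖V - W‖ ^ 2 ≤ ε / (4 * C) := by
    rw [div_mul_eq_mul_div, one_mul, div_le_iff₀ ht0]; linarith
  have h5 : t * ‖V + W‖ ^ 2 ≤ ε / (4 * C) := by
    calc t * ‖V + W‖ ^ 2 ≤ t * M := by gcongr
      _ = ε / (4 * C) := by rw [ht]; field_simp
  calc C * (1 / t * ‖V - W‖ ^ 2 + t * ‖V + W‖ ^ 2) ≤ C * (ε / (4 * C) + ε / (4 * C)) := by gcongr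
    _ = ε / 2 := by field_simp; ring
    _ < ε := by linarith

end StarGraph

/-! ### Expansion of the action at the half-soliton -/

namespace StarGraph

variable {N : ℕ}

theorem val_Phi (p : ℝ) (hp : 0 < p) (j : Fin N) :
    ∀ᵐ x ∂halfLine, val (Phi N p hp) j x = (phi p x : ℂ) := (memLp_phi hp).coeFn_toLp

theorem der_Phi (p : ℝ) (hp : 0 < p) (j : Fin N) :
    ∀ᵐ x ∂halfLine, der (Phi N p hp) j x = ((-psi p x : ℝ) : ℂ) := by
  filter_upwards [(memLp_deriv_phi hp).coeFn_toLp] with x hx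
  refine Eq.trans hx ?_
  rw [deriv_phi hp]; rfl

theorem phi_le_one {p : ℝ} (hp : 0 < p) (x : ℝ) : phi p x ≤ 1 := by
  have := Real.one_le_cosh (p * x)
  exact Real.rpow_le_one (by positivity) (inv_le_one_of_one_le₀ this) (by positivity)

theorem integral_norm_sq (f : Lp ℂ 2 halfLine) : ∫ x in Ioi 0, ‖f x‖ ^ 2 = ‖f‖ ^ 2 := by
  have h1 : IntegrableOn (fun x => (f x).re ^ 2) (Ioi 0) :=
    MemLp.sq_integrableOn (f := fun x => (f x).re) (Lp.memLp f).re
  have h2 : IntegrableOn (fun x => (f x).im ^ 2) (Ioi 0) :=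
    MemLp.sq_integrableOn (f := fun x => (f x).im) (Lp.memLp f).im
  rw [Lp_norm_sq, ← integral_add h1 h2]
  refine integral_congr_ae (Eventually.of_forall fun x => ?_)
  simp only
  rw [Complex.sq_norm, Complex.normSq_apply]
  ring

theorem integrable_norm_sq (f : Lp ℂ 2 halfLine) : IntegrableOn (fun x => ‖f x‖ ^ 2) (Ioi 0) :=
  (Lp.memLp f).norm.sq_integrableOn

theorem norm_val_apply_sq_le (V : H1 N) (j : Fin N) : ‖val V j‖ ^ 2 ≤ ‖V‖ ^ 2 := by
  rw [H1_norm_sq, L2_norm_sq]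
  have := Finset.single_le_sum (f := fun j => ‖val V j‖ ^ 2) (fun _ _ => by positivity)
      (Finset.mem_univ j)
  have : 0 ≤ ‖der V‖ ^ 2 := by positivity
  linarith

theorem aestronglyMeasurable_val (V : H1 N) (j : Fin N) :
    AEStronglyMeasurable (fun x => val V j x) halfLine := Lp.aestronglyMeasurable _

/-- By the Sobolev bound, |v|^{2p+2} ≤ ‖V‖^{2p} |v|², which is integrable. -/
theorem integrable_norm_rpow {p : ℝ} (hp : 0 < p) (V : H1 N) (j : Fin N) :
    IntegrableOn (fun x => ‖val V j x‖ ^ (2 * p + 2)) (Ioi 0) := by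
  refine Integrable.mono' ((integrable_norm_sq (val V j)).const_mul (‖V‖ ^ (2 * p)))
    ((aestronglyMeasurable_val V j).norm.aemeasurable.pow_const _).aestronglyMeasurable ?_
  filter_upwards [ae_norm_le V j] with x hx
  rw [Real.norm_of_nonneg (by positivity), Real.rpow_add' (norm_nonneg _) (by positivity)]
  have e : ‖val V j x‖ ^ (2 : ℝ) = ‖val V j x‖ ^ 2 := by norm_cast
  rw [e]
  gcongr

theorem integrable_bounded_mul {b f : ℝ → ℝ} (hb : Continuous b) {K : ℝ} (hK : ∀ x, |b x| ≤ K)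
    (hf : IntegrableOn f (Ioi 0)) : IntegrableOn (fun x => b x * f x) (Ioi 0) :=
  Integrable.bdd_mul hf hb.aestronglyMeasurable (Eventually.of_forall hK)

/-- The part of order at least three of the expansion of the action at `Φ`. -/
noncomputable def remainder (p : ℝ) (V : H1 N) : ℝ :=
  -∑ j, ∫ x in Ioi 0, potRem (2 * p) (phi p x) (val V j x)

theorem phi_rpow_add_one {p : ℝ} (hp : 0 < p) (x : ℝ) :
    phi p x ^ (2 * p + 1) = sechSq p x * phi p x := by
  rw [Real.rpow_add_one (phi_pos p x).ne', phi_rpow_two_mul hp]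

theorem phi_rpow_add_two {p : ℝ} (hp : 0 < p) (x : ℝ) :
    phi p x ^ (2 * p + 2) = sechSq p x * phi p x ^ 2 := by
  rw [Real.rpow_add (phi_pos p x), phi_rpow_two_mul hp]
  norm_cast

theorem integrable_sechSq_mul (p : ℝ) {f : ℝ → ℝ} (hf : IntegrableOn f (Ioi 0)) :
    IntegrableOn (fun x => sechSq p x * f x) (Ioi 0) :=
  integrable_bounded_mul (continuous_sechSq p) (K := 1)
    (fun x => by rw [abs_of_pos (sechSq_pos p x)]; exact sechSq_le_one p x) hf

theorem potRem_eq {p : ℝ} (hp : 0 < p) (x : ℝ) (v : ℂ) :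
    potRem (2 * p) (phi p x) v = ‖(phi p x : ℂ) + v‖ ^ (2 * p + 2) - phi p x ^ (2 * p + 2) -
      (2 * p + 2) * (sechSq p x * (phi p x * v.re)) -
      (p + 1) * (sechSq p x * ((2 * p + 1) * v.re ^ 2 + v.im ^ 2)) := by
  rw [potRem, phi_rpow_add_one hp, phi_rpow_two_mul hp, Complex.sq_norm, Complex.normSq_apply]
  ring

theorem integrable_norm_phi_add {p : ℝ} (hp : 0 < p) (V : H1 N) (j : Fin N) :
    IntegrableOn (fun x => ‖(phi p x : ℂ) + val V j x‖ ^ (2 * p + 2)) (Ioi 0) := by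
  refine (integrable_norm_rpow hp (Phi N p hp + V) j).congr ?_
  filter_upwards [coeFn_add (val (Phi N p hp)) (val V) j, val_Phi p hp j] with x h1 h2
  rw [val_add, h1, h2]

theorem integrable_phi_rpow {p : ℝ} (hp : 0 < p) : IntegrableOn (fun x => phi p x ^ (2 * p + 2)) (Ioi 0) := by
  simp_rw [phi_rpow_add_two hp]
  exact integrable_sechSq_mul p (edgeFun_phi hp).sq_integrable

theorem integrable_linear {p : ℝ} (hp : 0 < p) (V : H1 N) (j : Fin N) :
    IntegrableOn (fun x => sechSq p x * (phi p x * (val V j x).re)) (Ioi 0) :=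
  integrable_sechSq_mul p ((decays_phi hp).memLp.mul_integrable (memLp_re (val V) j))

theorem integrable_quadratic {p : ℝ} (V : H1 N) (j : Fin N) : IntegrableOn (fun x => sechSq p x *
    ((2 * p + 1) * (val V j x).re ^ 2 + (val V j x).im ^ 2)) (Ioi 0) :=
  integrable_sechSq_mul p (((memLp_re (val V) j).sq_integrableOn.const_mul _).add
    (memLp_im (val V) j).sq_integrableOn)

theorem integrable_potRem {p : ℝ} (hp : 0 < p) (V : H1 N) (j : Fin N) :
    IntegrableOn (fun x => potRem (2 * p) (phi p x) (val V j x)) (Ioi 0) := by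
  simp_rw [potRem_eq hp]
  exact (((integrable_norm_phi_add hp V j).sub (integrable_phi_rpow hp)).sub
    ((integrable_linear hp V j).const_mul _)).sub ((integrable_quadratic V j).const_mul _)

theorem integral_potRem {p : ℝ} (hp : 0 < p) (V : H1 N) (j : Fin N) :
    ∫ x in Ioi 0, potRem (2 * p) (phi p x) (val V j x) =
      (∫ x in Ioi 0, ‖val (Phi N p hp + V) j x‖ ^ (2 * p + 2)) -
      (∫ x in Ioi 0, ‖val (Phi N p hp) j x‖ ^ (2 * p + 2)) -
      (2 * p + 2) * (∫ x in Ioi 0, sechSq p x * (phi p x * (val V j x).re)) -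
      (p + 1) * ∫ x in Ioi 0, sechSq p x *
        ((2 * p + 1) * (val V j x).re ^ 2 + (val V j x).im ^ 2) := by
  have e1 : ∫ x in Ioi 0, ‖val (Phi N p hp + V) j x‖ ^ (2 * p + 2) =
      ∫ x in Ioi 0, ‖(phi p x : ℂ) + val V j x‖ ^ (2 * p + 2) := by
    refine integral_congr_ae ?_
    filter_upwards [coeFn_add (val (Phi N p hp)) (val V) j, val_Phi p hp j] with x h1 h2
    rw [val_add, h1, h2]
  have e2 : ∫ x in Ioi 0, ‖val (Phi N p hp) j x‖ ^ (2 * p + 2) =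
      ∫ x in Ioi 0, phi p x ^ (2 * p + 2) := by
    refine integral_congr_ae ?_
    filter_upwards [val_Phi p hp j] with x h2
    rw [h2, Complex.norm_real, Real.norm_of_nonneg (phi_pos p x).le]
  have i1 := integrable_norm_phi_add hp V j
  have i2 := integrable_phi_rpow hp
  have i12 : IntegrableOn (fun x => ‖(phi p x : ℂ) + val V j x‖ ^ (2 * p + 2) -
    phi p x ^ (2 * p + 2)) (Ioi 0) := i1.sub i2
  rw [e1, e2, ← integral_sub i1 i2, sub_eq_add_neg, sub_eq_add_neg, ← neg_mul, ← neg_mul,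
    ← integral_add_mul_add_mul i12 (integrable_linear hp V j) (integrable_quadratic V j)]
  refine integral_congr_ae (Eventually.of_forall fun x => ?_)
  simp only [potRem_eq hp]
  ring

/-- The pairing of a real square-integrable function with a component. -/
theorem inner_toLp_ofReal {f : ℝ → ℝ} (hf : MemLp (fun x => (f x : ℂ)) 2 halfLine)
    (F : Lp ℂ 2 halfLine) (hF : F =ᵐ[halfLine] fun x => (f x : ℂ))
    (G : Lp ℂ 2 halfLine) :
    ⟪F, G⟫_ℂ = ((∫ x in Ioi 0, f x * (G x).re : ℝ) : ℂ) +
      ((∫ x in Ioi 0, f x * (G x).im : ℝ) : ℂ) * Complex.I := by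
  have hi : Integrable (fun x => (f x : ℂ) * G x) halfLine := MemLp.integrable_mul hf (Lp.memLp G)
  have e : ⟪F, G⟫_ℂ = ∫ x, (f x : ℂ) * G x ∂halfLine := by
    rw [L2.inner_def]
    refine integral_congr_ae ?_
    filter_upwards [hF] with x hx
    rw [hx, RCLike.inner_apply, Complex.conj_ofReal, mul_comm]
  have e1 : ∫ x in Ioi 0, f x * (G x).re = ∫ x, RCLike.re ((f x : ℂ) * G x) ∂halfLine :=
    integral_congr_ae (Eventually.of_forall fun x => (Complex.re_ofReal_mul _ _).symm)
  have e2 : ∫ x in Ioi 0, f x * (G x).im = ∫ x, RCLike.im ((f x : ℂ) * G x) ∂halfLine :=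
    integral_congr_ae (Eventually.of_forall fun x => (Complex.im_ofReal_mul _ _).symm)
  rw [e, e1, e2]
  exact (integral_re_add_im (𝕜 := ℂ) hi).symm

theorem inner_Phi (p : ℝ) (hp : 0 < p) (V : H1 N) :
    ⟪val (Phi N p hp), val V⟫_ℂ = ((∑ j, ∫ x in Ioi 0, phi p x * (val V j x).re : ℝ) : ℂ) +
      ((∑ j, ∫ x in Ioi 0, phi p x * (val V j x).im : ℝ) : ℂ) * Complex.I := by
  rw [PiLp.inner_apply]
  push_cast
  rw [Finset.sum_mul, ← Finset.sum_add_distrib]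
  exact Finset.sum_congr rfl fun j _ => inner_toLp_ofReal (memLp_phi hp) _
    (val_Phi p hp j) _

theorem inner_der_Phi_re (p : ℝ) (hp : 0 < p) (V : H1 N) :
    (⟪der (Phi N p hp), der V⟫_ℂ).re = ∑ j, ∫ x in Ioi 0, -psi p x * (der V j x).re := by
  rw [PiLp.inner_apply, Complex.re_sum]
  refine Finset.sum_congr rfl fun j _ => ?_
  have hm : MemLp (fun x => ((-psi p x : ℝ) : ℂ)) 2 halfLine :=
    (Lp.memLp (der (Phi N p hp) j)).ae_eq (der_Phi p hp j)
  rw [inner_toLp_ofReal hm _ (der_Phi p hp j)]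
  simp

/-- The Euler–Lagrange equation of `Φ`, in weak form. -/
theorem euler_lagrange (p : ℝ) (hp : 0 < p) (V : H1 N) (j : Fin N) :
    (∫ x in Ioi 0, -psi p x * (der V j x).re) + (∫ x in Ioi 0, phi p x * (val V j x).re) =
      (p + 1) * ∫ x in Ioi 0, sechSq p x * (phi p x * (val V j x).re) := by
  obtain ⟨z, hz⟩ := mem_H1_iff.1 V.2
  obtain ⟨u, w, h⟩ := IsVertex.exists_edgeFun hz
  obtain ⟨hu, -, -, -, hae⟩ := h j
  have e := edgeBilin_phi hp hu
  have i1 : IntegrableOn (fun x => -psi p x * (der V j x).re) (Ioi 0) :=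
    (edgeFun_phi hp).memLp'.mul_integrable hu.memLp'
  have i2 : IntegrableOn (fun x => phi p x * (val V j x).re) (Ioi 0) :=
    (decays_phi hp).memLp.mul_integrable (memLp_re (val V) j)
  have e2 := integral_add_mul_add_mul i1 i2 (integrable_linear hp V j) 1 (-(p + 1))
  have e3 : ∫ x in Ioi 0, (-psi p x * (der V j x).re + 1 * (phi p x * (val V j x).re) +
      -(p + 1) * (sechSq p x * (phi p x * (val V j x).re))) = 0 := by
    refine Eq.trans (integral_congr_ae ?_) e
    filter_upwards [hae] with x hx
    have hx1 : (val V j x).re = u j x := hx.1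
    have hd : (der V j x).re = ((V : WithLp 2 (L2 N × L2 N)).snd j x).re := rfl
    rw [hx1, hd]
    ring
  rw [e3] at e2
  linarith

theorem quadForm_eq (p : ℝ) (V : H1 N) :
    quadForm p V = ‖V‖ ^ 2 - ∑ j, (p + 1) * ∫ x in Ioi 0, sechSq p x *
        ((2 * p + 1) * (val V j x).re ^ 2 + (val V j x).im ^ 2) := by
  rw [quadForm, H1_norm_sq_eq_sum, ← Finset.sum_sub_distrib]
  refine Finset.sum_congr rfl fun j _ => ?_
  have a1 := (memLp_re (val V) j).sq_integrableOn
  have a2 := (memLp_im (val V) j).sq_integrableOn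
  have a3 := (memLp_re (der V) j).sq_integrableOn
  have a4 := (memLp_im (der V) j).sq_integrableOn
  have b1 := integral_add_mul_add_mul a3 a1 (integrable_sechSq_mul p a1) 1
    (-((p + 1) * (2 * p + 1)))
  have b2 := integral_add_mul_add_mul a4 a2 (integrable_sechSq_mul p a2) 1 (-(p + 1))
  have c := integral_add_mul_add_mul (integrable_sechSq_mul p a2) (integrable_sechSq_mul p a1)
    (integrable_sechSq_mul p a1) (2 * p + 1) 0
  have e1 : edgeQuad p ((p + 1) * (2 * p + 1)) (fun x => (val V j x).re)
      (fun x => (der V j x).re) = _ := Eq.trans (integral_congr_ae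
        (Eventually.of_forall fun x => by simp only; ring)) b1
  have e2 : edgeQuad p (p + 1) (fun x => (val V j x).im)
      (fun x => (der V j x).im) = _ := Eq.trans (integral_congr_ae
        (Eventually.of_forall fun x => by simp only; ring)) b2
  have e3 : ∫ x in Ioi 0, sechSq p x * ((2 * p + 1) * (val V j x).re ^ 2 + (val V j x).im ^ 2) =
      _ := Eq.trans (integral_congr_ae (Eventually.of_forall fun x => by simp only; ring)) c
  rw [e1, e2, e3]
  ring

/-- The identity is exact: the linear terms cancel by `euler_lagrange`, the quadratic ones form Q by
`quadForm_eq`, and `remainder` is by definition what remains. -/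
theorem action_expansion (p : ℝ) (hp : 0 < p) (V : H1 N) :
    action p (Phi N p hp + V) = action p (Phi N p hp) + quadForm p V + remainder p V := by
  have e1 : ‖der (Phi N p hp + V)‖ ^ 2 = ‖der (Phi N p hp)‖ ^ 2 +
      2 * (⟪der (Phi N p hp), der V⟫_ℂ).re + ‖der V‖ ^ 2 := by
    rw [der_add]; exact norm_add_sq (𝕜 := ℂ) _ _
  have e2 : ‖val (Phi N p hp + V)‖ ^ 2 = ‖val (Phi N p hp)‖ ^ 2 +
      2 * (⟪val (Phi N p hp), val V⟫_ℂ).re + ‖val V‖ ^ 2 := by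
    rw [val_add]; exact norm_add_sq (𝕜 := ℂ) _ _
  have e3 : (⟪val (Phi N p hp), val V⟫_ℂ).re = ∑ j, ∫ x in Ioi 0, phi p x * (val V j x).re := by
    rw [inner_Phi, Complex.add_re, Complex.ofReal_re, Complex.re_ofReal_mul]; simp
  have e4 : (∑ j, ∫ x in Ioi 0, -psi p x * (der V j x).re) +
      (∑ j, ∫ x in Ioi 0, phi p x * (val V j x).re) =
      (p + 1) * ∑ j, ∫ x in Ioi 0, sechSq p x * (phi p x * (val V j x).re) := by
    rw [← Finset.sum_add_distrib, Finset.mul_sum]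
    exact Finset.sum_congr rfl fun j _ => euler_lagrange p hp V j
  rw [action, action, energy, energy, mass, mass, e1, e2, e3, inner_der_Phi_re, quadForm_eq,
    remainder, H1_norm_sq]
  simp_rw [integral_potRem hp V]
  rw [Finset.sum_sub_distrib, Finset.sum_sub_distrib, Finset.sum_sub_distrib, ← Finset.mul_sum,
    ← Finset.mul_sum]
  linarith

/-- Local Lipschitz and semiconvexity estimates for the remainder. -/
theorem remainder_estimates {p : ℝ} (hp : 0 < p) (hp₁ : 1 / 2 ≤ p) : ∃ C > 0,
    ∀ ρ ≤ (1 : ℝ), ∀ V W : H1 N, ‖V‖ ≤ ρ → ‖W‖ ≤ ρ →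
      |remainder p V - remainder p W| ≤ C * ρ ^ 2 * ‖V - W‖ ∧
      -(C * ρ * ‖V - W‖ ^ 2) ≤
        remainder p V + remainder p W - 2 * remainder p ((1 / 2 : ℝ) • (V + W)) := by
  obtain ⟨C, hC, hest⟩ := potRem_estimates (r := 2 * p) (by linarith)
  refine ⟨(N + 1) * (4 * C), by positivity, fun ρ hρ V W hV hW => ⟨?_, ?_⟩⟩
  · have hρ0 : 0 ≤ ρ := (norm_nonneg _).trans hV
    have hj : ∀ j, |(∫ x in Ioi 0, potRem (2 * p) (phi p x) (val V j x)) -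
        ∫ x in Ioi 0, potRem (2 * p) (phi p x) (val W j x)| ≤ 4 * C * ρ ^ 2 * ‖V - W‖ := by
      intro j
      rw [← integral_sub (integrable_potRem hp V j) (integrable_potRem hp W j)]
      have hi : IntegrableOn (fun x => 2 * C * ‖V - W‖ * (‖val V j x‖ ^ 2 + ‖val W j x‖ ^ 2))
          (Ioi 0) := ((integrable_norm_sq (val V j)).add (integrable_norm_sq (val W j))).const_mul _
      refine (abs_integral_le_integral_abs).trans ((integral_mono_ae
        ((integrable_potRem hp V j).sub (integrable_potRem hp W j)).abs hi ?_).trans ?_)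
      · filter_upwards [ae_norm_le V j, ae_norm_le W j, ae_norm_le (V - W) j,
          coeFn_sub (val V) (val W) j] with x h1 h2 h3 h4
        rw [val_sub, h4] at h3
        -- The radius in the pointwise estimate is taken at x itself rather than equal to the
        -- constant ρ, because the bound has to be integrable over the half-line; m² ≤ |v|² + |w|²
        -- is.
        set m := max ‖val V j x‖ ‖val W j x‖ with hm
        have hm1 : m ≤ 1 := max_le (h1.trans (hV.trans hρ)) (h2.trans (hW.trans hρ))
        have hm2 : m ^ 2 ≤ ‖val V j x‖ ^ 2 + ‖val W j x‖ ^ 2 := by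
          rcases max_choice ‖val V j x‖ ‖val W j x‖ with h | h <;> rw [hm, h] <;> nlinarith
        have := (hest (phi p x) (phi_pos p x) (phi_le_one hp x)).1 _ _ m hm1
          (le_max_left _ _) (le_max_right _ _)
        refine this.trans ?_
        calc C * m ^ 2 * ‖val V j x - val W j x‖ ≤
            C * (‖val V j x‖ ^ 2 + ‖val W j x‖ ^ 2) * ‖V - W‖ := by gcongr
          _ ≤ 2 * C * ‖V - W‖ * (‖val V j x‖ ^ 2 + ‖val W j x‖ ^ 2) := by
            have : 0 ≤ C * ‖V - W‖ * (‖val V j x‖ ^ 2 + ‖val W j x‖ ^ 2) := by positivity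
            linarith
      · rw [integral_const_mul, integral_add (integrable_norm_sq (val V j))
          (integrable_norm_sq (val W j)), integral_norm_sq, integral_norm_sq]
        have h1 := norm_val_apply_sq_le V j
        have h2 := norm_val_apply_sq_le W j
        have h3 : ‖V‖ ^ 2 ≤ ρ ^ 2 := by gcongr
        have h4 : ‖W‖ ^ 2 ≤ ρ ^ 2 := by gcongr
        calc 2 * C * ‖V - W‖ * (‖val V j‖ ^ 2 + ‖val W j‖ ^ 2) ≤
            2 * C * ‖V - W‖ * (ρ ^ 2 + ρ ^ 2) :=
              mul_le_mul_of_nonneg_left (by linarith) (by positivity)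
          _ = _ := by ring
    rw [remainder, remainder, neg_sub_neg, abs_sub_comm, ← Finset.sum_sub_distrib]
    refine (Finset.abs_sum_le_sum_abs _ _).trans ((Finset.sum_le_sum fun j _ => hj j).trans ?_)
    rw [Finset.sum_const, Finset.card_univ, Fintype.card_fin, nsmul_eq_mul]
    have : 0 ≤ 4 * C * ρ ^ 2 * ‖V - W‖ := by positivity
    linarith
  · have hρ0 : 0 ≤ ρ := (norm_nonneg _).trans hV
    set M : H1 N := (1 / 2 : ℝ) • (V + W) with hM
    have hj : ∀ j, (∫ x in Ioi 0, potRem (2 * p) (phi p x) (val V j x)) +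
        (∫ x in Ioi 0, potRem (2 * p) (phi p x) (val W j x)) -
        2 * (∫ x in Ioi 0, potRem (2 * p) (phi p x) (val M j x)) ≤ 4 * C * ρ * ‖V - W‖ ^ 2 := by
      intro j
      have e := integral_add_mul_add_mul (integrable_potRem hp V j) (integrable_potRem hp W j)
        (integrable_potRem hp M j) 1 (-2)
      have hi := (integrable_norm_sq (val (V - W) j)).const_mul (C * ρ)
      have hle : ∫ x in Ioi 0, (potRem (2 * p) (phi p x) (val V j x) +
          1 * potRem (2 * p) (phi p x) (val W j x) + -2 * potRem (2 * p) (phi p x) (val M j x)) ≤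
          ∫ x in Ioi 0, C * ρ * ‖val (V - W) j x‖ ^ 2 := by
        refine integral_mono_ae (((integrable_potRem hp V j).add
          ((integrable_potRem hp W j).const_mul 1)).add
          ((integrable_potRem hp M j).const_mul (-2))) hi ?_
        filter_upwards [ae_norm_le V j, ae_norm_le W j, coeFn_sub (val V) (val W) j,
          coeFn_smul (1 / 2) (val V + val W) j, coeFn_add (val V) (val W) j] with x h1 h2 h3 h4 h5
        have hm : val M j x = (1 / 2 : ℝ) • (val V j x + val W j x) := by
          rw [Complex.real_smul, ← h5, ← h4]; rfl
        -- Here the constant radius ρ suffices, since the factor |v - w|² already gives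
        -- integrability.
        have := (hest (phi p x) (phi_pos p x) (phi_le_one hp x)).2.1 _ _ ρ hρ (h1.trans hV)
          (h2.trans hW)
        rw [hm, val_sub, h3]
        linarith
      rw [e, integral_const_mul, integral_norm_sq] at hle
      have h1 := norm_val_apply_sq_le (V - W) j
      have h2 : C * ρ * ‖val (V - W) j‖ ^ 2 ≤ C * ρ * ‖V - W‖ ^ 2 := by gcongr
      have h3 : 0 ≤ C * ρ * ‖V - W‖ ^ 2 := by positivity
      linarith
    have hs := Finset.sum_le_sum fun j (_ : j ∈ Finset.univ) => hj j
    rw [Finset.sum_sub_distrib, Finset.sum_add_distrib, ← Finset.mul_sum, Finset.sum_const,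
      Finset.card_univ, Fintype.card_fin, nsmul_eq_mul] at hs
    have : 0 ≤ 4 * C * ρ * ‖V - W‖ ^ 2 := by positivity
    rw [remainder, remainder, remainder]
    linarith

end StarGraph

/-! ### The kernel of the second variation -/

namespace StarGraph

variable {N : ℕ}

theorem H1_ext {V W : H1 N} (h : ∀ j, ∀ᵐ x ∂halfLine, val V j x = val W j x)
    (h' : ∀ j, ∀ᵐ x ∂halfLine, der V j x = der W j x) : V = W := by
  have e1 : val V = val W := by
    ext1 j
    exact Lp.ext (h j)
  have e2 : der V = der W := by
    ext1 j
    exact Lp.ext (h' j)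
  refine Subtype.ext ?_
  exact (WithLp.ofLp_injective 2) (Prod.ext e1 e2)

/-- Absolutely continuous representatives of the real and imaginary parts. -/
theorem exists_edgeFuns (V : H1 N) : ∃ (z : ℂ) (u w : Fin N → ℝ → ℝ),
    (∀ j, EdgeFun (u j) fun x => (der V j x).re) ∧ (∀ j, EdgeFun (w j) fun x => (der V j x).im) ∧
    (∀ j, u j 0 = z.re) ∧ (∀ j, w j 0 = z.im) ∧
    (∀ j, (fun x => (val V j x).re) =ᵐ[halfLine] u j) ∧
    ∀ j, (fun x => (val V j x).im) =ᵐ[halfLine] w j := by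
  obtain ⟨z, hz⟩ := mem_H1_iff.1 V.2
  obtain ⟨u, w, h⟩ := IsVertex.exists_edgeFun hz
  exact ⟨z, u, w, fun j => (h j).1, fun j => (h j).2.1, fun j => (h j).2.2.1,
    fun j => (h j).2.2.2.1, fun j => (h j).2.2.2.2.mono fun _ hx => hx.1,
    fun j => (h j).2.2.2.2.mono fun _ hx => hx.2⟩

theorem memLp_psi {p : ℝ} (hp : 0 < p) : MemLp (fun x => (psi p x : ℂ)) 2 halfLine :=
  (decays_psi hp).memLp.ofReal

theorem memLp_dpsi {p : ℝ} (hp : 0 < p) : MemLp (fun x => (dpsi p x : ℂ)) 2 halfLine :=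
  (decays_dpsi hp).memLp.ofReal

/-- The state `ψ (a₁, …, a_N)`, where `ψ = -φ'`. -/
noncomputable def kink (N : ℕ) (p : ℝ) (hp : 0 < p) (a : Fin N → ℝ) : H1 N :=
  ⟨WithLp.toLp 2 (WithLp.toLp 2 fun j => a j • (memLp_psi hp).toLp _,
      WithLp.toLp 2 fun j => a j • (memLp_dpsi hp).toLp _), by
    refine ⟨0, fun j => ?_⟩
    have h1 := (memLp_psi hp).coeFn_toLp
    have h2 := (memLp_dpsi hp).coeFn_toLp
    have h3 := Lp.coeFn_smul (a j) ((memLp_psi hp).toLp _)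
    have h4 := Lp.coeFn_smul (a j) ((memLp_dpsi hp).toLp _)
    filter_upwards [h1, h3, ae_restrict_mem measurableSet_Ioi] with x hx h3 hx0
    change (a j • (memLp_psi hp).toLp _ : Lp ℂ 2 halfLine) x
      = 0 + ∫ t in (0 : ℝ)..x, (a j • (memLp_dpsi hp).toLp _ : Lp ℂ 2 halfLine) t
    have e : ∫ t in (0 : ℝ)..x, (a j • (memLp_dpsi hp).toLp _ : Lp ℂ 2 halfLine) t
        = ∫ t in (0 : ℝ)..x, ((a j * dpsi p t : ℝ) : ℂ) := by
      refine intervalIntegral_congr_halfLine ?_ (le_of_lt hx0)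
      filter_upwards [h2, h4] with t h2 h4
      rw [h4, Pi.smul_apply, h2, Complex.real_smul, Complex.ofReal_mul]
    have f : ∫ t in (0 : ℝ)..x, dpsi p t = psi p x - psi p 0 :=
      intervalIntegral.integral_eq_sub_of_hasDerivAt (fun y _ => hasDerivAt_psi hp y)
        ((continuous_dpsi hp).intervalIntegrable _ _)
    rw [e, intervalIntegral.integral_ofReal, intervalIntegral.integral_const_mul, f, h3,
      Pi.smul_apply, hx, psi_zero, Complex.real_smul]
    push_cast
    ring⟩

theorem val_kink (p : ℝ) (hp : 0 < p) (a : Fin N → ℝ) (j : Fin N) :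
    ∀ᵐ x ∂halfLine, val (kink N p hp a) j x = ((a j * psi p x : ℝ) : ℂ) := by
  filter_upwards [(memLp_psi hp).coeFn_toLp, Lp.coeFn_smul (a j) ((memLp_psi hp).toLp _)]
    with x h1 h2
  refine Eq.trans h2 ?_
  rw [Pi.smul_apply, h1, Complex.real_smul, Complex.ofReal_mul]

theorem der_kink (p : ℝ) (hp : 0 < p) (a : Fin N → ℝ) (j : Fin N) :
    ∀ᵐ x ∂halfLine, der (kink N p hp a) j x = ((a j * dpsi p x : ℝ) : ℂ) := by
  filter_upwards [(memLp_dpsi hp).coeFn_toLp, Lp.coeFn_smul (a j) ((memLp_dpsi hp).toLp _)]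
    with x h1 h2
  refine Eq.trans h2 ?_
  rw [Pi.smul_apply, h1, Complex.real_smul, Complex.ofReal_mul]

theorem kink_add (p : ℝ) (hp : 0 < p) (a b : Fin N → ℝ) :
    kink N p hp (a + b) = kink N p hp a + kink N p hp b := by
  refine H1_ext (fun j => ?_) fun j => ?_
  · filter_upwards [val_kink p hp a j, val_kink p hp b j, val_kink p hp (a + b) j,
      coeFn_add (val (kink N p hp a)) (val (kink N p hp b)) j] with x h1 h2 h3 h4
    rw [val_add, h4, h1, h2, h3, Pi.add_apply]
    push_cast
    ring
  · filter_upwards [der_kink p hp a j, der_kink p hp b j, der_kink p hp (a + b) j,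
      coeFn_add (der (kink N p hp a)) (der (kink N p hp b)) j] with x h1 h2 h3 h4
    rw [der_add, h4, h1, h2, h3, Pi.add_apply]
    push_cast
    ring

theorem kink_smul (p : ℝ) (hp : 0 < p) (t : ℝ) (a : Fin N → ℝ) :
    kink N p hp (t • a) = t • kink N p hp a := by
  refine H1_ext (fun j => ?_) fun j => ?_
  · filter_upwards [val_kink p hp a j, val_kink p hp (t • a) j,
      coeFn_smul t (val (kink N p hp a)) j] with x h1 h3 h4
    rw [val_smul, h4, h1, h3, Pi.smul_apply, smul_eq_mul]
    push_cast
    ring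
  · filter_upwards [der_kink p hp a j, der_kink p hp (t • a) j,
      coeFn_smul t (der (kink N p hp a)) j] with x h1 h3 h4
    rw [der_smul, h4, h1, h3, Pi.smul_apply, smul_eq_mul]
    push_cast
    ring

/-- The linear map `a ↦ ψ (a₁, …, a_N)`. -/
noncomputable def kinkLin (N : ℕ) (p : ℝ) (hp : 0 < p) : (Fin N → ℝ) →ₗ[ℝ] H1 N where
  toFun := kink N p hp
  map_add' := kink_add p hp
  map_smul' := kink_smul p hp

theorem inner_kink (p : ℝ) (hp : 0 < p) (a : Fin N → ℝ) (V : H1 N) :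
    ⟪val (kink N p hp a), val V⟫_ℂ =
      ((∑ j, a j * ∫ x in Ioi 0, psi p x * (val V j x).re : ℝ) : ℂ) +
      ((∑ j, a j * ∫ x in Ioi 0, psi p x * (val V j x).im : ℝ) : ℂ) * Complex.I := by
  rw [PiLp.inner_apply]
  push_cast
  rw [Finset.sum_mul, ← Finset.sum_add_distrib]
  refine Finset.sum_congr rfl fun j _ => ?_
  have hm : MemLp (fun x => ((a j * psi p x : ℝ) : ℂ)) 2 halfLine :=
    (Lp.memLp (val (kink N p hp a) j)).ae_eq (val_kink p hp a j)
  rw [inner_toLp_ofReal hm _ (val_kink p hp a j)]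
  simp_rw [mul_assoc (a j), integral_const_mul]
  push_cast
  ring

theorem integral_mul_val_kink_re (f : ℝ → ℝ) (p : ℝ) (hp : 0 < p) (a : Fin N → ℝ) (j : Fin N) :
    ∫ x in Ioi 0, f x * (val (kink N p hp a) j x).re = a j * ∫ x in Ioi 0, f x * psi p x := by
  rw [← integral_const_mul]
  refine integral_congr_ae ?_
  filter_upwards [val_kink p hp a j] with x hx
  rw [hx, Complex.ofReal_re]
  ring

theorem integral_mul_val_kink_im (f : ℝ → ℝ) (p : ℝ) (hp : 0 < p) (a : Fin N → ℝ) (j : Fin N) :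
    ∫ x in Ioi 0, f x * (val (kink N p hp a) j x).im = 0 := by
  refine (integral_congr_ae (g := fun _ => (0 : ℝ)) ?_).trans (integral_zero _ _)
  filter_upwards [val_kink p hp a j] with x hx
  rw [hx, Complex.ofReal_im, mul_zero]

theorem inner_kink_kink (p : ℝ) (hp : 0 < p) (a b : Fin N → ℝ) :
    ⟪val (kink N p hp a), val (kink N p hp b)⟫_ℂ =
      (((∑ j, a j * b j) * ∫ x in Ioi 0, psi p x * psi p x : ℝ) : ℂ) := by
  rw [inner_kink]
  simp_rw [integral_mul_val_kink_re, integral_mul_val_kink_im, ← mul_assoc, ← Finset.sum_mul]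
  simp

theorem inner_Phi_eq_zero_iff (p : ℝ) (hp : 0 < p) (V : H1 N) :
    V ∈ constrained N p hp ↔ ∑ j, ∫ x in Ioi 0, phi p x * (val V j x).re = 0 ∧
      ∑ j, ∫ x in Ioi 0, phi p x * (val V j x).im = 0 := by
  change ⟪val (Phi N p hp), val V⟫_ℂ = 0 ↔ _
  rw [inner_Phi, Complex.ext_iff]
  simp

/-- The pairing with Φ is (∑ aⱼ) ∫ φψ, and ∫ φψ > 0. -/
theorem kink_mem_constrained_iff (p : ℝ) (hp : 0 < p) (a : Fin N → ℝ) :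
    kink N p hp a ∈ constrained N p hp ↔ ∑ j, a j = 0 := by
  rw [inner_Phi_eq_zero_iff]
  simp_rw [integral_mul_val_kink_re, integral_mul_val_kink_im, ← Finset.sum_mul]
  simp [(integral_phi_psi_pos hp).ne']

theorem kink_injective (p : ℝ) (hp : 0 < p) {a : Fin N → ℝ} (h : kink N p hp a = 0) : a = 0 := by
  have e := inner_kink_kink p hp a a
  have h0 : val (kink N p hp a) = 0 := by rw [h]; rfl
  rw [h0, inner_zero_left, eq_comm, Complex.ofReal_eq_zero] at e
  have hP := integral_psi_sq_pos hp
  simp_rw [sq] at hP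
  have h1 := (mul_eq_zero.1 e).resolve_right hP.ne'
  rw [Finset.sum_eq_zero_iff_of_nonneg fun _ _ => mul_self_nonneg _] at h1
  exact funext fun j => mul_self_eq_zero.1 (h1 j (Finset.mem_univ j))

theorem dpsi_zero (p : ℝ) : dpsi p 0 = p := by simp [dpsi, phi_zero, sechSq]

/-- Adding an element of the kernel does not change the second variation. -/
theorem quadForm_kink_add (p : ℝ) (hp : 0 < p) {a : Fin N → ℝ} (ha : ∑ j, a j = 0) (W : H1 N) :
    quadForm p (kink N p hp a + W) = quadForm p W := by
  obtain ⟨z, u, w, hu, hw, hu0, hw0, hur, hwi⟩ := exists_edgeFuns W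
  have key : ∀ j, edgeQuad p ((p + 1) * (2 * p + 1)) (fun x => (val (kink N p hp a + W) j x).re)
      (fun x => (der (kink N p hp a + W) j x).re) +
      edgeQuad p (p + 1) (fun x => (val (kink N p hp a + W) j x).im)
      (fun x => (der (kink N p hp a + W) j x).im) =
      edgeQuad p ((p + 1) * (2 * p + 1)) (fun x => (val W j x).re) (fun x => (der W j x).re) +
      edgeQuad p (p + 1) (fun x => (val W j x).im) (fun x => (der W j x).im) +
      -(2 * p * z.re) * a j := by
    intro j
    have e1 : (fun x => (val (kink N p hp a + W) j x).re) =ᵐ[halfLine]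
        fun x => u j x + a j * psi p x := by
      filter_upwards [coeFn_add_re (val (kink N p hp a)) (val W) j, val_kink p hp a j, hur j]
        with x h1 h2 h3
      rw [val_add, h1, h2, h3, Complex.ofReal_re, add_comm]
    have e2 : (fun x => (der (kink N p hp a + W) j x).re) =ᵐ[halfLine]
        fun x => (der W j x).re + a j * dpsi p x := by
      filter_upwards [coeFn_add_re (der (kink N p hp a)) (der W) j, der_kink p hp a j]
        with x h1 h2
      rw [der_add, h1, h2, Complex.ofReal_re, add_comm]
    have e3 : (fun x => (val (kink N p hp a + W) j x).im) =ᵐ[halfLine]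
        fun x => (val W j x).im := by
      filter_upwards [coeFn_add_im (val (kink N p hp a)) (val W) j, val_kink p hp a j]
        with x h1 h2
      rw [val_add, h1, h2, Complex.ofReal_im, zero_add]
    have e4 : (fun x => (der (kink N p hp a + W) j x).im) =ᵐ[halfLine]
        fun x => (der W j x).im := by
      filter_upwards [coeFn_add_im (der (kink N p hp a)) (der W) j, der_kink p hp a j]
        with x h1 h2
      rw [der_add, h1, h2, Complex.ofReal_im, zero_add]
    -- W need not vanish at the vertex, so the boundary term -ψ'(0) u(0) = -p Re z survives. It is
    -- the same on every edge, and its sum against the aⱼ cancels because ∑ aⱼ = 0.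
    have b1 : edgeBilin p ((p + 1) * (2 * p + 1)) (psi p) (dpsi p) (u j)
        (fun x => (der W j x).re) = -(p * z.re) := by
      have dz : Decays fun _ : ℝ => (0 : ℝ) := ⟨continuous_const, 0, fun x _ => by simp⟩
      rw [edgeBilin_eq p _ (k := fun _ => 0) (fun x => by simpa using hasDerivAt_dpsi hp x)
        (decays_psi hp) (decays_dpsi hp) dz (hu j), dpsi_zero, hu0]
      simp
    have b2 : edgeQuad p ((p + 1) * (2 * p + 1)) (psi p) (dpsi p) = 0 := by
      rw [← edgeBilin_psi hp (edgeFun_psi hp) (psi_zero p), edgeQuad, edgeBilin]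
      simp only [sq]
    rw [edgeQuad_congr p _ e1 e2, edgeQuad_congr p _ e3 e4,
      edgeQuad_congr p _ (hur j) (ae_eq_refl fun x => (der W j x).re),
      edgeQuad_add_const_mul p _ (a j) (hu j) (edgeFun_psi hp), b1, b2]
    ring
  rw [quadForm, quadForm, Finset.sum_congr rfl fun j _ => key j, Finset.sum_add_distrib,
    ← Finset.mul_sum, ha, mul_zero, add_zero]

theorem quadForm_kink (p : ℝ) (hp : 0 < p) {a : Fin N → ℝ} (ha : ∑ j, a j = 0) :
    quadForm p (kink N p hp a) = 0 := by
  have := quadForm_kink_add p hp ha (0 : H1 N)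
  rwa [add_zero, quadForm_zero] at this

theorem integral_mul_congr (f : ℝ → ℝ) {g h : ℝ → ℝ} (e : g =ᵐ[halfLine] h) :
    ∫ x in Ioi 0, f x * g x = ∫ x in Ioi 0, f x * h x :=
  integral_congr_ae (e.mono fun x hx => by simp only [hx])

theorem integral_sq_congr {g h : ℝ → ℝ} (e : g =ᵐ[halfLine] h) :
    ∫ x in Ioi 0, g x ^ 2 = ∫ x in Ioi 0, h x ^ 2 :=
  integral_congr_ae (e.mono fun x hx => by simp only [hx])

theorem quadForm_eq_of_edgeFuns (p : ℝ) {V : H1 N} {u w : Fin N → ℝ → ℝ}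
    (hur : ∀ j, (fun x => (val V j x).re) =ᵐ[halfLine] u j)
    (hwi : ∀ j, (fun x => (val V j x).im) =ᵐ[halfLine] w j) :
    quadForm p V = (∑ j, edgeQuad p ((p + 1) * (2 * p + 1)) (u j) fun x => (der V j x).re) +
      ∑ j, edgeQuad p (p + 1) (w j) fun x => (der V j x).im := by
  rw [quadForm, ← Finset.sum_add_distrib]
  refine Finset.sum_congr rfl fun j _ => ?_
  rw [edgeQuad_congr p _ (hur j) (ae_eq_refl _), edgeQuad_congr p _ (hwi j) (ae_eq_refl _)]

/-- The second variation is nonnegative along the constraint. -/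
theorem quadForm_nonneg (hN : 0 < N) {p : ℝ} (hp : 0 < p) (hp₂ : p < 2) {V : H1 N}
    (hV : V ∈ constrained N p hp) : 0 ≤ quadForm p V := by
  obtain ⟨z, u, w, hu, hw, hu0, hw0, hur, hwi⟩ := exists_edgeFuns V
  obtain ⟨c1, c2⟩ := (inner_Phi_eq_zero_iff p hp V).1 hV
  simp_rw [integral_mul_congr _ (hur _)] at c1
  simp_rw [integral_mul_congr _ (hwi _)] at c2
  obtain ⟨κ, hκ, hi⟩ := imag_coercive hN hp
  have h1 := hi w _ hw ⟨_, hw0⟩ c2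
  have h2 := real_nonneg hp hp₂ hu hu0 c1
  have h3 : 0 ≤ κ * ∑ j, ∫ x in Ioi 0, w j x ^ 2 :=
    mul_nonneg hκ.le (Finset.sum_nonneg fun j _ => integral_nonneg fun x => sq_nonneg _)
  rw [quadForm_eq_of_edgeFuns p hur hwi]
  linarith

/-- The null vectors of the second variation along the constraint. -/
theorem quadForm_eq_zero_iff (hN : 0 < N) {p : ℝ} (hp : 0 < p) (hp₂ : p < 2) {V : H1 N}
    (hV : V ∈ constrained N p hp) :
    quadForm p V = 0 ↔ ∃ a : Fin N → ℝ, ∑ j, a j = 0 ∧ V = kink N p hp a := by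
  refine ⟨fun h => ?_, fun ⟨a, ha, e⟩ => e ▸ quadForm_kink p hp ha⟩
  obtain ⟨z, u, w, hu, hw, hu0, hw0, hur, hwi⟩ := exists_edgeFuns V
  obtain ⟨c1, c2⟩ := (inner_Phi_eq_zero_iff p hp V).1 hV
  simp_rw [integral_mul_congr _ (hur _)] at c1
  simp_rw [integral_mul_congr _ (hwi _)] at c2
  obtain ⟨κ, hκ, hi⟩ := imag_coercive hN hp
  have h1 := hi w _ hw ⟨_, hw0⟩ c2
  have h2 := real_nonneg hp hp₂ hu hu0 c1
  have hn : ∀ j, 0 ≤ ∫ x in Ioi 0, w j x ^ 2 := fun j => integral_nonneg fun x => sq_nonneg _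
  have h3 : 0 ≤ ∑ j, ∫ x in Ioi 0, w j x ^ 2 := Finset.sum_nonneg fun j _ => hn j
  rw [quadForm_eq_of_edgeFuns p hur hwi] at h
  have h4 : ∑ j, ∫ x in Ioi 0, w j x ^ 2 = 0 := by nlinarith
  have h5 := (Finset.sum_eq_zero_iff_of_nonneg fun j _ => hn j).1 h4
  obtain ⟨a, ha, hua⟩ := real_zero hN hp hp₂ hu hu0 c1 (by nlinarith)
  have h6 : ∑ j, ∫ x in Ioi 0, (der V j x).im ^ 2 ≤ 0 := by
    have := Finset.sum_le_sum fun j (_ : j ∈ Finset.univ) => integral_der_sq_le p (p + 1) (hw j)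
    rw [Finset.sum_add_distrib, ← Finset.mul_sum, h4] at this
    linarith
  have hn' : ∀ j, 0 ≤ ∫ x in Ioi 0, (der V j x).im ^ 2 :=
    fun j => integral_nonneg fun x => sq_nonneg _
  have h7 : ∀ j, ∫ x in Ioi 0, (der V j x).im ^ 2 ≤ 0 := fun j =>
    (Finset.single_le_sum (fun i _ => hn' i) (Finset.mem_univ j)).trans h6
  refine ⟨a, ha, H1_ext (fun j => ?_) fun j => ?_⟩
  · filter_upwards [hur j, hwi j, hua j, val_kink p hp a j,
      ae_eq_zero_of_integral_sq (hw j).memLp (h5 j (Finset.mem_univ j)).le] with x e1 e2 e3 e4 e5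
    rw [e4]
    refine Complex.ext ?_ ?_
    · rw [e1, e3.1, Complex.ofReal_re]
    · rw [e2, e5, Complex.ofReal_im]
  · filter_upwards [hua j, der_kink p hp a j,
      ae_eq_zero_of_integral_sq (hw j).memLp' (h7 j)] with x e3 e4 e5
    rw [e4]
    refine Complex.ext ?_ ?_
    · rw [e3.2, Complex.ofReal_re]
    · rw [e5, Complex.ofReal_im]

/-- Coercivity of the second variation away from its kernel. -/
theorem quadForm_coercive (hN : 0 < N) {p : ℝ} (hp : 0 < p) (hp₂ : p < 2) :
    ∃ κ > 0, ∀ V ∈ constrained N p hp,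
      (∀ a : Fin N → ℝ, ∑ j, a j = 0 → ⟪val (kink N p hp a), val V⟫_ℂ = 0) →
      κ * ‖V‖ ^ 2 ≤ quadForm p V := by
  obtain ⟨κ₁, hκ₁, hr⟩ := real_coercive hN hp hp₂
  obtain ⟨κ₂, hκ₂, hi⟩ := imag_coercive hN hp
  set κ := min κ₁ κ₂ with hκ
  have hκ0 : 0 < κ := lt_min hκ₁ hκ₂
  set c₁ := (p + 1) * (2 * p + 1) with hc₁
  set K := 1 + |c₁| + |p + 1| with hK
  have hK0 : 0 < K := by positivity
  -- With A the L² part of ‖V‖² and D the derivative part: κA ≤ Q and κD ≤ κQ + KκA ≤ (κ + K)Q.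
  refine ⟨κ / (κ + K + 1), by positivity, fun V hV hk => ?_⟩
  obtain ⟨z, u, w, hu, hw, hu0, hw0, hur, hwi⟩ := exists_edgeFuns V
  obtain ⟨c1, c2⟩ := (inner_Phi_eq_zero_iff p hp V).1 hV
  have hψ : ∀ i j, ∫ x in Ioi 0, psi p x * u i x = ∫ x in Ioi 0, psi p x * u j x := by
    intro i j
    -- Testing with the zero-sum vector eᵢ - eⱼ turns orthogonality to the kernel into equality of
    -- the moments against ψ.
    have h := hk (Pi.single i 1 - Pi.single j 1) (by simp [Finset.sum_sub_distrib])
    rw [inner_kink, Complex.ext_iff] at h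
    have h1 := h.1
    simp only [Pi.sub_apply, sub_mul, Finset.sum_sub_distrib, Pi.single_apply, ite_mul, one_mul,
      zero_mul, Finset.sum_ite_eq', Finset.mem_univ, if_true, Complex.add_re, Complex.ofReal_re,
      Complex.re_ofReal_mul, Complex.I_re, mul_zero, add_zero, Complex.zero_re] at h1
    rw [integral_mul_congr _ (hur i), integral_mul_congr _ (hur j)] at h1
    exact sub_eq_zero.1 h1
  simp_rw [integral_mul_congr _ (hur _)] at c1
  simp_rw [integral_mul_congr _ (hwi _)] at c2
  have h1 := hr u _ hu ⟨_, hu0⟩ c1 hψ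
  have h2 := hi w _ hw ⟨_, hw0⟩ c2
  have hn1 : 0 ≤ ∑ j, ∫ x in Ioi 0, u j x ^ 2 :=
    Finset.sum_nonneg fun j _ => integral_nonneg fun x => sq_nonneg _
  have hn2 : 0 ≤ ∑ j, ∫ x in Ioi 0, w j x ^ 2 :=
    Finset.sum_nonneg fun j _ => integral_nonneg fun x => sq_nonneg _
  have d1 := Finset.sum_le_sum fun j (_ : j ∈ Finset.univ) => integral_der_sq_le p c₁ (hu j)
  have d2 := Finset.sum_le_sum fun j (_ : j ∈ Finset.univ) => integral_der_sq_le p (p + 1) (hw j)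
  rw [Finset.sum_add_distrib, ← Finset.mul_sum] at d1 d2
  have hnorm : ‖V‖ ^ 2 = (∑ j, ∫ x in Ioi 0, u j x ^ 2) + (∑ j, ∫ x in Ioi 0, w j x ^ 2) +
      (∑ j, ∫ x in Ioi 0, (der V j x).re ^ 2) + ∑ j, ∫ x in Ioi 0, (der V j x).im ^ 2 := by
    rw [H1_norm_sq_eq_sum, ← Finset.sum_add_distrib, ← Finset.sum_add_distrib,
      ← Finset.sum_add_distrib]
    refine Finset.sum_congr rfl fun j _ => ?_
    rw [integral_sq_congr (hur j), integral_sq_congr (hwi j)]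
    ring
  rw [quadForm_eq_of_edgeFuns p hur hwi, hnorm]
  set A := ∑ j, ∫ x in Ioi 0, u j x ^ 2
  set B := ∑ j, ∫ x in Ioi 0, w j x ^ 2
  set Q₁ := ∑ j, edgeQuad p c₁ (u j) fun x => (der V j x).re
  set Q₂ := ∑ j, edgeQuad p (p + 1) (w j) fun x => (der V j x).im
  set D₁ := ∑ j, ∫ x in Ioi 0, (der V j x).re ^ 2
  set D₂ := ∑ j, ∫ x in Ioi 0, (der V j x).im ^ 2
  have k1 : κ * A ≤ Q₁ := (mul_le_mul_of_nonneg_right (min_le_left _ _) hn1).trans h1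
  have k2 : κ * B ≤ Q₂ := (mul_le_mul_of_nonneg_right (min_le_right _ _) hn2).trans h2
  have l1 : D₁ ≤ Q₁ + K * A := d1.trans (by
    have := mul_nonneg (abs_nonneg (p + 1)) hn1
    rw [hK]; linarith)
  have l2 : D₂ ≤ Q₂ + K * B := d2.trans (by
    have := mul_nonneg (abs_nonneg c₁) hn2
    rw [hK]; linarith)
  have m1 := mul_le_mul_of_nonneg_left l1 hκ0.le
  have m2 := mul_le_mul_of_nonneg_left l2 hκ0.le
  have m3 := mul_le_mul_of_nonneg_left k1 hK0.le
  have m4 := mul_le_mul_of_nonneg_left k2 hK0.le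
  rw [div_mul_eq_mul_div, div_le_iff₀ (by positivity)]
  linarith

end StarGraph

/-! ### Critical point, second variation and the complement of X_c -/

namespace StarGraph

variable {N : ℕ}

theorem remainder_zero (p : ℝ) : remainder p (0 : H1 N) = 0 := by
  rw [remainder, neg_eq_zero]
  refine Finset.sum_eq_zero fun j _ => ?_
  refine (integral_congr_ae (g := fun _ => (0 : ℝ)) ?_).trans (integral_zero _ _)
  filter_upwards [Lp.coeFn_zero ℂ 2 halfLine] with x hx
  have : val (0 : H1 N) j x = 0 := hx
  rw [this, potRem_zero (phi_pos p x)]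

theorem abs_remainder_le {p : ℝ} (hp : 0 < p) (hp₁ : 1 / 2 ≤ p) : ∃ C > 0, ∀ V : H1 N,
    ‖V‖ ≤ 1 → |remainder p V| ≤ C * ‖V‖ ^ 3 := by
  obtain ⟨C, hC, h⟩ := remainder_estimates (N := N) hp hp₁
  refine ⟨C, hC, fun V hV => ?_⟩
  have := (h ‖V‖ hV V 0 le_rfl (norm_zero.trans_le (norm_nonneg V))).1
  rw [remainder_zero, sub_zero, sub_zero] at this
  calc _ ≤ _ := this
    _ = _ := by ring

/-- `Φ` is a critical point of the action. -/
theorem hasFDerivAt_action {p : ℝ} (hp : 0 < p) (hp₁ : 1 / 2 ≤ p) :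
    HasFDerivAt (action p) (0 : H1 N →L[ℝ] ℝ) (Phi N p hp) := by
  rw [hasFDerivAt_iff_isLittleO_nhds_zero]
  obtain ⟨C₁, hC₁, h₁⟩ := abs_quadForm_le (N := N) p
  obtain ⟨C₂, hC₂, h₂⟩ := abs_remainder_le (N := N) hp hp₁
  have hO : (fun h : H1 N => action p (Phi N p hp + h) - action p (Phi N p hp) -
      (0 : H1 N →L[ℝ] ℝ) h) =O[𝓝 0] fun h => ‖h‖ ^ 2 := by
    refine Asymptotics.IsBigO.of_bound (C₁ + C₂) ?_
    filter_upwards [Metric.closedBall_mem_nhds (0 : H1 N) one_pos] with h hh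
    have hh : ‖h‖ ≤ 1 := mem_closedBall_zero_iff.1 hh
    rw [action_expansion, zero_apply, Real.norm_eq_abs, Real.norm_of_nonneg (by positivity)]
    have e : action p (Phi N p hp) + quadForm p h + remainder p h - action p (Phi N p hp) - 0 =
        quadForm p h + remainder p h := by ring
    have h3 : ‖h‖ ^ 3 ≤ ‖h‖ ^ 2 := pow_le_pow_of_le_one (norm_nonneg h) hh (by norm_num)
    rw [e, add_mul]
    refine (abs_add_le _ _).trans (add_le_add (h₁ h) ((h₂ h hh).trans ?_))
    gcongr
  refine hO.trans_isLittleO ?_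
  refine Asymptotics.isLittleO_norm_right.1 ?_
  have h12 : (fun x : ℝ => x ^ 2) =o[𝓝 0] fun x => x := by
    simpa using Asymptotics.isLittleO_pow_pow (𝕜 := ℝ) (show 1 < 2 by norm_num)
  exact h12.comp_tendsto (tendsto_norm_zero (E := H1 N))

theorem measurable_gradRem (p : ℝ) (v : ℝ → ℂ) (hv : AEStronglyMeasurable v halfLine)
    {f : ℝ → ℝ} (hf : Continuous f) :
    AEStronglyMeasurable (fun x => gradRem (2 * p) (f x) (v x)) halfLine := by
  have h1 := hf.aemeasurable (μ := halfLine)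
  have h2 := hv.aemeasurable
  refine AEMeasurable.aestronglyMeasurable ?_
  unfold gradRem
  fun_prop

/-- The remainder is differentiable along lines through `0`, with quadratically small
derivative. -/
theorem hasDerivAt_remainder {p : ℝ} (hp : 0 < p) (hp₁ : 1 / 2 ≤ p) (V : H1 N) :
    ∃ K, ∀ t₀ : ℝ, |t₀| * (‖V‖ + 1) < 1 →
      ∃ d, HasDerivAt (fun t : ℝ => remainder p (t • V)) d t₀ ∧ |d| ≤ K * t₀ ^ 2 := by
  obtain ⟨C, hC, hest⟩ := potRem_estimates (r := 2 * p) (by linarith)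
  -- The exceptional null set is independent of t, as differentiation under the integral requires.
  -- The condition on t keeps both |t| ≤ 1 and |t v(x)| ≤ 1.
  have hbd : ∀ j, ∀ᵐ x ∂halfLine, ∀ t : ℝ, |t| * (‖V‖ + 1) < 1 →
      ‖(2 * p + 2) * ⟪gradRem (2 * p) (phi p x) (0 + t • val V j x), val V j x⟫_ℝ‖ ≤
        (2 * p + 2) * C * ‖V‖ * t ^ 2 * ‖val V j x‖ ^ 2 := by
    intro j
    filter_upwards [ae_norm_le V j] with x hx t ht
    have h1 : ‖t • val V j x‖ ≤ 1 := by
      rw [norm_smul, Real.norm_eq_abs]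
      have : |t| * ‖val V j x‖ ≤ |t| * (‖V‖ + 1) :=
        mul_le_mul_of_nonneg_left (by linarith) (abs_nonneg t)
      linarith
    have h2 := (hest (phi p x) (phi_pos p x) (phi_le_one hp x)).2.2 _ h1
    have h3 := norm_inner_le_norm (𝕜 := ℝ) (gradRem (2 * p) (phi p x) (t • val V j x)) (val V j x)
    rw [zero_add, norm_mul, Real.norm_of_nonneg (by positivity : 0 ≤ 2 * p + 2)]
    rw [norm_smul, mul_pow, Real.norm_eq_abs, sq_abs] at h2
    calc _ ≤ (2 * p + 2) * (C * (t ^ 2 * ‖val V j x‖ ^ 2) * ‖V‖) := by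
          refine mul_le_mul_of_nonneg_left (h3.trans ?_) (by positivity)
          gcongr
      _ = _ := by ring
  have hderiv : ∀ j, ∀ t₀ : ℝ, |t₀| * (‖V‖ + 1) < 1 →
      HasDerivAt (fun t : ℝ => ∫ x in Ioi 0, potRem (2 * p) (phi p x) (0 + t • val V j x))
        (∫ x in Ioi 0, (2 * p + 2) *
          ⟪gradRem (2 * p) (phi p x) (0 + t₀ • val V j x), val V j x⟫_ℝ) t₀ := by
    intro j t₀ ht₀
    have hs : {t : ℝ | |t| * (‖V‖ + 1) < 1} ∈ 𝓝 t₀ :=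
      (isOpen_lt (by fun_prop) continuous_const).mem_nhds ht₀
    have hint : ∀ t : ℝ, IntegrableOn
        (fun x => potRem (2 * p) (phi p x) (0 + t • val V j x)) (Ioi 0) := by
      intro t
      refine (integrable_potRem hp (t • V) j).congr ?_
      filter_upwards [coeFn_smul t (val V) j] with x hx
      rw [val_smul, hx, zero_add, Complex.real_smul]
    refine (hasDerivAt_integral_of_dominated_loc_of_deriv_le (μ := halfLine) hs
      (F := fun t x => potRem (2 * p) (phi p x) (0 + t • val V j x))
      (F' := fun t x => (2 * p + 2) *
          ⟪gradRem (2 * p) (phi p x) (0 + t • val V j x), val V j x⟫_ℝ)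
      (bound := fun x => (2 * p + 2) * C * ‖V‖ * ‖val V j x‖ ^ 2)
      (Eventually.of_forall fun t => (hint t).aestronglyMeasurable) (hint t₀) ?_ ?_
      ((integrable_norm_sq (val V j)).const_mul _) ?_).2
    · have h1 := aestronglyMeasurable_val V j
      have h2 := measurable_gradRem p (fun x => 0 + t₀ • val V j x)
        (aestronglyMeasurable_const.add (h1.const_smul t₀)) (continuous_phi hp)
      exact (h2.inner (𝕜 := ℝ) h1).const_mul _
    · filter_upwards [hbd j] with x hx t ht
      refine (hx t ht).trans ?_
      have h1 : |t| ≤ 1 := by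
        have : |t| * 1 ≤ |t| * (‖V‖ + 1) :=
          mul_le_mul_of_nonneg_left (by linarith [norm_nonneg V]) (abs_nonneg t)
        have ht' : |t| * (‖V‖ + 1) < 1 := ht
        linarith
      have h2 : t ^ 2 ≤ 1 := by rw [← sq_abs]; exact pow_le_one₀ (abs_nonneg t) h1
      have h3 : 0 ≤ (2 * p + 2) * C * ‖V‖ * ‖val V j x‖ ^ 2 := by positivity
      nlinarith
    · exact Eventually.of_forall fun x t _ =>
        hasDerivAt_potRem (by linarith) (phi p x) 0 (val V j x) t
  refine ⟨∑ j : Fin N, (2 * p + 2) * C * ‖V‖ * ‖val V j‖ ^ 2, fun t₀ ht₀ =>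
    ⟨-∑ j, ∫ x in Ioi 0, (2 * p + 2) *
      ⟪gradRem (2 * p) (phi p x) (0 + t₀ • val V j x), val V j x⟫_ℝ, ?_, ?_⟩⟩
  · have h := (HasDerivAt.fun_sum fun j (_ : j ∈ Finset.univ) => hderiv j t₀ ht₀).fun_neg
    refine h.congr_of_eventuallyEq (Eventually.of_forall fun t => ?_)
    simp only [remainder]
    congr 1
    refine Finset.sum_congr rfl fun j _ => integral_congr_ae ?_
    filter_upwards [coeFn_smul t (val V) j] with x hx
    rw [val_smul, hx, zero_add, Complex.real_smul]
  · rw [abs_neg, Finset.sum_mul]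
    refine (Finset.abs_sum_le_sum_abs _ _).trans (Finset.sum_le_sum fun j _ => ?_)
    have h1 := norm_integral_le_of_norm_le (μ := halfLine)
      ((integrable_norm_sq (val V j)).const_mul ((2 * p + 2) * C * ‖V‖ * t₀ ^ 2))
      ((hbd j).mono fun x hx => hx t₀ ht₀)
    rw [integral_const_mul (_ : ℝ) (fun x => ‖val V j x‖ ^ 2), integral_norm_sq,
      Real.norm_eq_abs] at h1
    refine h1.trans (le_of_eq ?_)
    ring

/-- Along a line the derivative of the remainder is O(t²), so its own derivative at 0 is 0 and only
t² Q(V) contributes. No higher differentiability of the nonlinearity is needed. -/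
theorem secondVariation_eq {p : ℝ} (hp : 0 < p) (hp₁ : 1 / 2 ≤ p) (V : H1 N) :
    secondVariation N p hp V = 2 * quadForm p V := by
  obtain ⟨K, hK⟩ := hasDerivAt_remainder hp hp₁ V
  have e : (fun t : ℝ => action p (Phi N p hp + t • V)) = fun t =>
      action p (Phi N p hp) + t ^ 2 * quadForm p V + remainder p (t • V) := by
    funext t
    rw [action_expansion, quadForm_smul]
  have h00 : |(0 : ℝ)| * (‖V‖ + 1) < 1 := by rw [abs_zero, zero_mul]; exact one_pos
  have hs : ∀ᶠ t : ℝ in 𝓝 0, |t| * (‖V‖ + 1) < 1 :=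
    (isOpen_lt (by fun_prop) continuous_const).mem_nhds h00
  set D : ℝ → ℝ := fun t => deriv (fun t : ℝ => remainder p (t • V)) t with hD
  have hd : ∀ t : ℝ, |t| * (‖V‖ + 1) < 1 →
      deriv (fun t : ℝ => action p (Phi N p hp + t • V)) t = 2 * t * quadForm p V + D t := by
    intro t ht
    obtain ⟨d, hd, -⟩ := hK t ht
    rw [e, hD]
    simp only
    rw [hd.deriv]
    have := ((((hasDerivAt_pow 2 t).mul_const (quadForm p V)).const_add
      (action p (Phi N p hp))).fun_add hd).deriv
    rw [this]
    norm_num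
  have hDb : ∀ t : ℝ, |t| * (‖V‖ + 1) < 1 → |D t| ≤ K * t ^ 2 := by
    intro t ht
    obtain ⟨d, hd, hb⟩ := hK t ht
    rw [hD]
    simp only
    rwa [hd.deriv]
  have hD0 : D 0 = 0 := by
    have := hDb 0 h00
    rw [zero_pow two_ne_zero, mul_zero] at this
    exact abs_nonpos_iff.1 this
  have hDd : HasDerivAt D 0 0 := by
    rw [hasDerivAt_iff_isLittleO_nhds_zero]
    have hO : (fun h : ℝ => D (0 + h) - D 0 - h • (0 : ℝ)) =O[𝓝 0] fun h => h ^ 2 := by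
      refine Asymptotics.IsBigO.of_bound K ?_
      filter_upwards [hs] with t ht
      rw [zero_add, hD0, sub_zero, smul_zero, sub_zero, Real.norm_eq_abs,
        Real.norm_of_nonneg (by positivity)]
      exact hDb t ht
    refine hO.trans_isLittleO ?_
    simpa using (Asymptotics.isLittleO_pow_pow (𝕜 := ℝ) (show 1 < 2 by norm_num))
  rw [secondVariation, iteratedDeriv_succ, iteratedDeriv_one]
  have h2 : HasDerivAt (fun t => 2 * t * quadForm p V + D t) (2 * quadForm p V + 0) 0 := by
    have := ((hasDerivAt_id (0 : ℝ)).const_mul 2).mul_const (quadForm p V)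
    simpa using this.fun_add hDd
  rw [(h2.congr_of_eventuallyEq (hs.mono fun t ht => hd t ht)).deriv, add_zero]

theorem mem_kernelSet_iff (hN : 0 < N) {p : ℝ} (hp : 0 < p) (hp₁ : 1 / 2 ≤ p) (hp₂ : p < 2)
    {V : H1 N} :
    V ∈ kernelSet N p hp ↔ ∃ a : Fin N → ℝ, ∑ j, a j = 0 ∧ V = kink N p hp a := by
  change V ∈ constrained N p hp ∧ secondVariation N p hp V = 0 ↔ _
  rw [secondVariation_eq hp hp₁]
  constructor
  · rintro ⟨h1, h2⟩
    exact (quadForm_eq_zero_iff hN hp hp₂ h1).1 (by linarith)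
  · rintro ⟨a, ha, rfl⟩
    exact ⟨(kink_mem_constrained_iff p hp a).2 ha, by rw [quadForm_kink p hp ha, mul_zero]⟩

/-- The orthogonal complement of `X_c` within the constraint space, as a real subspace. -/
def complementSubmodule (N : ℕ) (p : ℝ) (hp : 0 < p) : Submodule ℝ (H1 N) where
  carrier := complement N p hp
  zero_mem' := ⟨inner_zero_right _, fun _ _ => inner_zero_right _⟩
  add_mem' := by
    rintro V W ⟨h1, h2⟩ ⟨h3, h4⟩
    refine ⟨?_, fun X hX => ?_⟩
    · change ⟪_, val V + val W⟫_ℂ = 0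
      rw [inner_add_right, h1, h3, add_zero]
    · rw [val_add, inner_add_right, h2 X hX, h4 X hX, add_zero]
  smul_mem' := by
    rintro t V ⟨h1, h2⟩
    refine ⟨?_, fun X hX => ?_⟩
    · change ⟪_, t • val V⟫_ℂ = 0
      rw [inner_smul_right_eq_smul, h1, smul_zero]
    · rw [val_smul, inner_smul_right_eq_smul, h2 X hX, smul_zero]

theorem continuous_val : Continuous (val (N := N)) :=
  (WithLp.prod_continuous_ofLp 2 _ _).fst.comp continuous_subtype_val

theorem isClosed_complement (N : ℕ) (p : ℝ) (hp : 0 < p) : IsClosed (complement N p hp) := by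
  have e : complement N p hp = {V | ⟪val (Phi N p hp), val V⟫_ℂ = 0} ∩
      ⋂ X ∈ kernelSet N p hp, {V | ⟪val X, val V⟫_ℂ = 0} := by
    ext V
    simp only [complement, constrained, mem_ofPred_eq, mem_inter_iff, mem_iInter]
  rw [e]
  have hc : ∀ X : L2 N, IsClosed {V : H1 N | ⟪X, val V⟫_ℂ = 0} := fun X =>
    isClosed_eq (continuous_const.inner continuous_val) continuous_const
  exact (hc _).inter (isClosed_biInter fun X _ => hc _)

end StarGraph

/-! ### Cubic expansion along the kernel -/

theorem one_add_rpow_expansion (q : ℝ) : ∃ K > 0, ∃ δ > 0, ∀ y : ℝ, |y| ≤ δ →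
    |(1 + y) ^ q - (1 + q * y + q * (q - 1) / 2 * y ^ 2 + q * (q - 1) * (q - 2) / 6 * y ^ 3)| ≤
      K * y ^ 4 := by
  -- The binomial series of (1 + y)^q truncated after degree three.
  have h := (Real.one_add_rpow_hasFPowerSeriesAt_zero (a := q)).isBigO_sub_partialSum_pow 4
  obtain ⟨K, hK, h⟩ := h.exists_pos
  rw [Asymptotics.isBigOWith_iff, Metric.eventually_nhds_iff] at h
  obtain ⟨δ, hδ, h⟩ := h
  refine ⟨K, hK, δ / 2, by positivity, fun y hy => ?_⟩
  have hb := h (y := y) (by rw [dist_zero_right, Real.norm_eq_abs]; linarith)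
  have e : (binomialSeries ℝ q).partialSum 4 y =
      1 + q * y + q * (q - 1) / 2 * y ^ 2 + q * (q - 1) * (q - 2) / 6 * y ^ 3 := by
    have h2 : Polynomial.aeval q (2 : Polynomial ℤ) = 2 := map_ofNat _ 2
    simp only [FormalMultilinearSeries.partialSum, Finset.sum_range_succ, binomialSeries_apply,
      Finset.sum_range_zero, Ring.choose_eq_smul]
    simp [descPochhammer_succ_right, Nat.factorial, ← Polynomial.aeval_eq_smeval, h2]
    ring
  have e4 : |‖y‖ ^ 4| = y ^ 4 := by
    rw [Real.norm_eq_abs, abs_of_nonneg (by positivity), Even.pow_abs (by decide)]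
  rwa [zero_add, e, Real.norm_eq_abs, Real.norm_eq_abs, e4] at hb

/-- A function whose leading term at zero is an odd cubic takes both signs. -/
theorem exists_pos_neg_of_cubic {f : ℝ → ℝ} {m B δ : ℝ} (hm : 0 < m) (hδ : 0 < δ)
    (hf : ∀ t, |t| ≤ δ → |f t - t ^ 3 * m| ≤ B * t ^ 4) {ε : ℝ} (hε : 0 < ε) :
    ∃ t, 0 < t ∧ t < ε ∧ 0 < f t ∧ f (-t) < 0 := by
  -- The last entry forces |B| t < m, so the quartic error loses to the cubic term; the others keep
  -- t within the range of validity and below ε.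
  set t := min (min δ (ε / 2)) (m / (2 * (|B| + 1))) with ht
  have ht0 : 0 < t := by positivity
  have ht1 : t ≤ δ := (min_le_left _ _).trans (min_le_left _ _)
  have ht2 : t ≤ ε / 2 := (min_le_left _ _).trans (min_le_right _ _)
  have ht3 : t * (2 * (|B| + 1)) ≤ m := (le_div_iff₀ (by positivity)).1 (min_le_right _ _)
  have h1 := (abs_le.1 (hf t (by rwa [abs_of_pos ht0]))).1
  have h2 := (abs_le.1 (hf (-t) (by rwa [abs_neg, abs_of_pos ht0]))).2
  have h3 : B * t ^ 4 < t ^ 3 * m := by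
    have h4 : B * t ≤ |B| * t := mul_le_mul_of_nonneg_right (le_abs_self B) ht0.le
    have h5 : B * t < m := by nlinarith [mul_nonneg (abs_nonneg B) ht0.le]
    have := mul_lt_mul_of_pos_left h5 (pow_pos ht0 3)
    linarith
  have e4 : (-t) ^ 4 = t ^ 4 := by ring
  have e3 : (-t) ^ 3 = -t ^ 3 := by ring
  rw [e4, e3] at h2
  exact ⟨t, ht0, by linarith, by linarith, by linarith⟩

namespace StarGraph

variable {N : ℕ}

/-- The integral of `φ^{2p-1} ψ³`. -/
noncomputable def cubicIntegral (p : ℝ) : ℝ := ∫ x in Ioi 0, phi p x ^ (2 * p - 1) * psi p x ^ 3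

theorem phi_rpow_mul_psi_cube {p : ℝ} (x : ℝ) :
    phi p x ^ (2 * p - 1) * psi p x ^ 3 = Real.tanh (p * x) ^ 3 * phi p x ^ (2 * p + 2) := by
  have e : phi p x ^ (2 * p + 2) = phi p x ^ (2 * p - 1) * phi p x ^ 3 := by
    rw [← Real.rpow_natCast, ← Real.rpow_add (phi_pos p x)]
    congr 1
    push_cast
    ring
  rw [e, psi]
  ring

theorem integrable_tanh_pow_mul {p : ℝ} (hp : 0 < p) (n : ℕ) :
    IntegrableOn (fun x => Real.tanh (p * x) ^ n * phi p x ^ (2 * p + 2)) (Ioi 0) :=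
  integrable_bounded_mul (K := 1) ((continuous_tanh_mul p).pow n) (fun x => by
    rw [abs_pow]
    exact pow_le_one₀ (abs_nonneg _) (Real.abs_tanh_lt_one _).le) (integrable_phi_rpow hp)

theorem cubicIntegral_pos {p : ℝ} (hp : 0 < p) : 0 < cubicIntegral p := by
  refine setIntegral_Ioi_pos ?_ fun x hx =>
    mul_pos (Real.rpow_pos_of_pos (phi_pos p x) _) (pow_pos (psi_pos hp hx) 3)
  simp_rw [phi_rpow_mul_psi_cube]
  exact integrable_tanh_pow_mul hp 3

/-- The coefficient of the cubic term. -/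
theorem potRem_psi_eq {p : ℝ} (hp : 0 < p) (x : ℝ) {s : ℝ} (hs : |s| ≤ 1) :
    potRem (2 * p) (phi p x) ((s * psi p x : ℝ) : ℂ) =
      phi p x ^ (2 * p + 2) * ((1 + s * Real.tanh (p * x)) ^ (2 * p + 2) -
        (1 + (2 * p + 2) * (s * Real.tanh (p * x)) +
          (2 * p + 2) * (2 * p + 1) / 2 * (s * Real.tanh (p * x)) ^ 2)) := by
  have hT : |s * Real.tanh (p * x)| ≤ 1 := by
    rw [abs_mul]
    exact mul_le_one₀ hs (abs_nonneg _) (Real.abs_tanh_lt_one _).le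
  have h0 : 0 ≤ 1 + s * Real.tanh (p * x) := by linarith [(abs_le.1 hT).1]
  -- Since ψ = φ tanh, the perturbation relative to φ is s tanh(px), bounded by |s| for every x.
  -- This allows a Taylor expansion uniform in x although φ tends to 0.
  have e : ‖(phi p x : ℂ) + ((s * psi p x : ℝ) : ℂ)‖ = phi p x * (1 + s * Real.tanh (p * x)) := by
    rw [← Complex.ofReal_add, Complex.norm_real, psi, Real.norm_of_nonneg]
    · ring
    · have := mul_nonneg (phi_pos p x).le h0
      linarith
  rw [potRem_eq hp, e, Complex.ofReal_re, Complex.ofReal_im, Real.mul_rpow (phi_pos p x).le h0,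
    phi_rpow_add_two hp, psi]
  ring

/-- The cubic expansion of the remainder on kernel directions. -/
theorem remainder_kink_expansion {p : ℝ} (hp : 0 < p) : ∃ B > 0, ∃ δ > 0, ∀ a : Fin N → ℝ,
    (∀ j, |a j| ≤ δ) →
    |remainder p (kink N p hp a) -
      -(2 / 3) * p * (p + 1) * (2 * p + 1) * ((∑ j, a j ^ 3) * cubicIntegral p)| ≤
      B * ∑ j, a j ^ 4 := by
  obtain ⟨K, hK, δ, hδ, hexp⟩ := one_add_rpow_expansion (2 * p + 2)
  set I := ∫ x in Ioi 0, phi p x ^ (2 * p + 2) with hI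
  have hI0 : 0 ≤ I := integral_nonneg fun x => (Real.rpow_pos_of_pos (phi_pos p x) _).le
  refine ⟨K * I + 1, by positivity, min δ 1, by positivity, fun a ha => ?_⟩
  -- c is the binomial coefficient (2p+2)(2p+1)(2p)/6.
  set c := 2 / 3 * p * (p + 1) * (2 * p + 1) with hc
  have hj : ∀ j, |(∫ x in Ioi 0, potRem (2 * p) (phi p x) (val (kink N p hp a) j x)) -
      c * (a j ^ 3 * cubicIntegral p)| ≤ (K * I + 1) * a j ^ 4 := by
    intro j
    have hs := ha j
    have hs1 : |a j| ≤ 1 := hs.trans (min_le_right _ _)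
    have e1 : ∫ x in Ioi 0, potRem (2 * p) (phi p x) (val (kink N p hp a) j x) =
        ∫ x in Ioi 0, potRem (2 * p) (phi p x) ((a j * psi p x : ℝ) : ℂ) := by
      refine integral_congr_ae ?_
      filter_upwards [val_kink p hp a j] with x hx
      rw [hx]
    have i1 : IntegrableOn (fun x => potRem (2 * p) (phi p x) ((a j * psi p x : ℝ) : ℂ))
        (Ioi 0) := by
      refine (integrable_potRem hp (kink N p hp a) j).congr ?_
      filter_upwards [val_kink p hp a j] with x hx
      rw [hx]
    have i2 : IntegrableOn (fun x => c * a j ^ 3 *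
        (Real.tanh (p * x) ^ 3 * phi p x ^ (2 * p + 2))) (Ioi 0) :=
      (integrable_tanh_pow_mul hp 3).const_mul _
    have e2 : c * (a j ^ 3 * cubicIntegral p) = ∫ x in Ioi 0, c * a j ^ 3 *
        (Real.tanh (p * x) ^ 3 * phi p x ^ (2 * p + 2)) := by
      rw [integral_const_mul, cubicIntegral]
      simp_rw [phi_rpow_mul_psi_cube]
      ring
    rw [e1, e2, ← integral_sub i1 i2]
    have hb : ∀ x, ‖potRem (2 * p) (phi p x) ((a j * psi p x : ℝ) : ℂ) -
        c * a j ^ 3 * (Real.tanh (p * x) ^ 3 * phi p x ^ (2 * p + 2))‖ ≤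
        K * a j ^ 4 * phi p x ^ (2 * p + 2) := by
      intro x
      have hT := (Real.abs_tanh_lt_one (p * x)).le
      have hy : |a j * Real.tanh (p * x)| ≤ δ := by
        rw [abs_mul]
        exact (mul_le_of_le_one_right (abs_nonneg _) hT).trans (hs.trans (min_le_left _ _))
      have hq := hexp _ hy
      have hpos := Real.rpow_pos_of_pos (phi_pos p x) (2 * p + 2)
      have e3 : potRem (2 * p) (phi p x) ((a j * psi p x : ℝ) : ℂ) -
          c * a j ^ 3 * (Real.tanh (p * x) ^ 3 * phi p x ^ (2 * p + 2)) =
          phi p x ^ (2 * p + 2) * ((1 + a j * Real.tanh (p * x)) ^ (2 * p + 2) -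
            (1 + (2 * p + 2) * (a j * Real.tanh (p * x)) +
              (2 * p + 2) * (2 * p + 2 - 1) / 2 * (a j * Real.tanh (p * x)) ^ 2 +
              (2 * p + 2) * (2 * p + 2 - 1) * (2 * p + 2 - 2) / 6 *
                (a j * Real.tanh (p * x)) ^ 3)) := by
        rw [potRem_psi_eq hp x hs1, hc]
        ring
      rw [e3, norm_mul, Real.norm_of_nonneg hpos.le, Real.norm_eq_abs, mul_comm]
      refine mul_le_mul_of_nonneg_right (hq.trans ?_) hpos.le
      have hT4 : Real.tanh (p * x) ^ 4 ≤ 1 := by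
        rw [← Even.pow_abs (by decide : Even 4)]
        exact pow_le_one₀ (abs_nonneg _) hT
      have : 0 ≤ K * a j ^ 4 := by positivity
      rw [mul_pow, ← mul_assoc]
      exact mul_le_of_le_one_right this hT4
    refine (norm_integral_le_of_norm_le (μ := halfLine)
      ((integrable_phi_rpow hp).const_mul (K * a j ^ 4)) (Eventually.of_forall hb)).trans ?_
    rw [integral_const_mul, ← hI]
    have : 0 ≤ a j ^ 4 := by positivity
    linarith
  have e : remainder p (kink N p hp a) -
      -(2 / 3) * p * (p + 1) * (2 * p + 1) * ((∑ j, a j ^ 3) * cubicIntegral p) =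
      -∑ j, ((∫ x in Ioi 0, potRem (2 * p) (phi p x) (val (kink N p hp a) j x)) -
        c * (a j ^ 3 * cubicIntegral p)) := by
    rw [remainder, Finset.sum_sub_distrib, ← Finset.mul_sum, ← Finset.sum_mul, hc]
    ring
  rw [e, abs_neg, Finset.mul_sum]
  exact (Finset.abs_sum_le_sum_abs _ _).trans (Finset.sum_le_sum fun j _ => hj j)

/-- Kernel elements are real multiples of the single profile ψ on each edge, so the conjugate is
harmless and the triple sum is the cube of the amplitude of the combined kink. -/
theorem cubicM_kink (p : ℝ) (hp : 0 < p) (a : Fin (N - 1) → Fin N → ℝ)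
    (c : EuclideanSpace ℝ (Fin (N - 1))) :
    cubicM p (fun i => kink N p hp (a i)) c = -(2 / 3) * p * (p + 1) * (2 * p + 1) *
      ((∑ l, (∑ i, c i • a i) l ^ 3) * cubicIntegral p) := by
  have h : ∀ i j k l, (∫ x in Ioi (0 : ℝ), ((phi p x ^ (2 * p - 1) : ℝ) : ℂ) *
      val (kink N p hp (a i)) l x * val (kink N p hp (a j)) l x *
        (starRingEnd ℂ) (val (kink N p hp (a k)) l x)).re =
      a i l * a j l * a k l * cubicIntegral p := by
    intro i j k l
    have e : ∫ x in Ioi (0 : ℝ), ((phi p x ^ (2 * p - 1) : ℝ) : ℂ) *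
        val (kink N p hp (a i)) l x * val (kink N p hp (a j)) l x *
        (starRingEnd ℂ) (val (kink N p hp (a k)) l x) = ∫ x in Ioi (0 : ℝ),
        ((a i l * a j l * a k l * (phi p x ^ (2 * p - 1) * psi p x ^ 3) : ℝ) : ℂ) := by
      refine integral_congr_ae ?_
      filter_upwards [val_kink p hp (a i) l, val_kink p hp (a j) l, val_kink p hp (a k) l]
        with x h1 h2 h3
      rw [h1, h2, h3, Complex.conj_ofReal]
      push_cast
      ring
    have e' : ∫ x in Ioi (0 : ℝ),
        ((a i l * a j l * a k l * (phi p x ^ (2 * p - 1) * psi p x ^ 3) : ℝ) : ℂ) =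
        ((∫ x in Ioi (0 : ℝ), a i l * a j l * a k l *
          (phi p x ^ (2 * p - 1) * psi p x ^ 3) : ℝ) : ℂ) := integral_ofReal
    rw [e, e', Complex.ofReal_re, integral_const_mul, cubicIntegral]
  rw [cubicM]
  simp_rw [h]
  congr 1
  have e : ∀ l, (∑ i, c i • a i) l ^ 3 =
      ∑ i, ∑ j, ∑ k, c i * c j * c k * (a i l * a j l * a k l) := by
    intro l
    rw [Finset.sum_apply, pow_succ, sq, Finset.sum_mul_sum, Finset.sum_mul]
    refine Finset.sum_congr rfl fun i _ => ?_
    rw [Finset.sum_mul]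
    refine Finset.sum_congr rfl fun j _ => ?_
    rw [Finset.mul_sum]
    refine Finset.sum_congr rfl fun k _ => ?_
    simp only [Pi.smul_apply, smul_eq_mul]
    ring
  simp_rw [e, Finset.sum_mul, Finset.mul_sum]
  symm
  rw [Finset.sum_comm]
  refine Finset.sum_congr rfl fun i _ => ?_
  rw [Finset.sum_comm]
  refine Finset.sum_congr rfl fun j _ => ?_
  rw [Finset.sum_comm]
  refine Finset.sum_congr rfl fun k _ => Finset.sum_congr rfl fun l _ => ?_
  ring

end StarGraph

/-! ### Bases of X_c, the saddle property and the reduction -/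

namespace StarGraph

variable {N : ℕ}

theorem sum_smul_kink {ι : Type*} (s : Finset ι) (p : ℝ) (hp : 0 < p) (c : ι → ℝ)
    (a : ι → Fin N → ℝ) :
    ∑ i ∈ s, c i • kink N p hp (a i) = kink N p hp (∑ i ∈ s, c i • a i) := by
  have := map_sum (kinkLin N p hp) (fun i => c i • a i) s
  simp only [map_smul] at this
  exact this.symm

theorem kink_inj (p : ℝ) (hp : 0 < p) {a b : Fin N → ℝ} (h : kink N p hp a = kink N p hp b) :
    a = b := by
  have e : kinkLin N p hp (a - b) = 0 := by
    rw [map_sub]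
    exact sub_eq_zero.2 h
  exact sub_eq_zero.1 (kink_injective p hp e)

/-- Existence of an orthogonal basis of `X_c`. -/
theorem exists_isKernelBasis (hN : 0 < N) {p : ℝ} (hp : 0 < p) (hp₁ : 1 / 2 ≤ p) (hp₂ : p < 2) :
    ∃ U : Fin (N - 1) → H1 N, IsKernelBasis N p hp U := by
  set e : EuclideanSpace ℝ (Fin N) := WithLp.toLp 2 fun _ => 1 with he
  have he0 : e ≠ 0 := fun h => by
    have := congrArg (fun v : EuclideanSpace ℝ (Fin N) => v ⟨0, hN⟩) h
    simp [he] at this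
  set S := (Submodule.span ℝ {e})ᗮ with hS
  -- X_c is modelled on the hyperplane orthogonal to (1, …, 1). L² products of kinks are dot
  -- products of amplitudes times ∫ ψ², so an orthonormal basis of the hyperplane gives an
  -- orthogonal family.
  have hmem : ∀ v : EuclideanSpace ℝ (Fin N), v ∈ S ↔ ∑ j, v j = 0 := by
    intro v
    rw [hS, Submodule.mem_orthogonal_singleton_iff_inner_right, PiLp.inner_apply]
    simp [he]
  have hdim : Module.finrank ℝ S = N - 1 := by
    have h1 := Submodule.finrank_add_finrank_orthogonal (Submodule.span ℝ {e})
    rw [finrank_span_singleton he0, finrank_euclideanSpace, Fintype.card_fin] at h1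
    change 1 + Module.finrank ℝ S = N at h1
    omega
  set b := (stdOrthonormalBasis ℝ S).reindex (finCongr hdim) with hb
  have hin : ∀ i j, ∑ l, (b i : EuclideanSpace ℝ (Fin N)) l *
      (b j : EuclideanSpace ℝ (Fin N)) l = if i = j then 1 else 0 := by
    intro i j
    have h := orthonormal_iff_ite.1 b.orthonormal j i
    rw [Submodule.coe_inner, PiLp.inner_apply] at h
    simp only [RCLike.inner_apply, conj_trivial] at h
    rw [h]
    simp only [eq_comm]
  refine ⟨fun i => kink N p hp (b i : EuclideanSpace ℝ (Fin N)).ofLp, ⟨fun i h => ?_,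
    fun i j hij => ?_, ?_⟩⟩
  · have h0 := kink_injective p hp h
    have h1 := hin i i
    simp [h0] at h1
  · rw [inner_kink_kink, hin, if_neg hij, zero_mul, Complex.ofReal_zero]
  · ext V
    rw [SetLike.mem_coe, Submodule.mem_span_range_iff_exists_fun, mem_kernelSet_iff hN hp hp₁ hp₂]
    constructor
    · rintro ⟨c, rfl⟩
      refine ⟨_, ?_, sum_smul_kink _ p hp _ _⟩
      simp only [Finset.sum_apply, Pi.smul_apply]
      rw [Finset.sum_comm]
      refine Finset.sum_eq_zero fun i _ => ?_
      rw [← Finset.smul_sum, (hmem _).1 (b i).2, smul_zero]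
    · rintro ⟨a, ha, rfl⟩
      have haS : (WithLp.toLp 2 a : EuclideanSpace ℝ (Fin N)) ∈ S := (hmem _).2 ha
      refine ⟨fun i => b.repr ⟨_, haS⟩ i, ?_⟩
      rw [sum_smul_kink]
      congr 1
      have h1 := congrArg (fun v : S => (v : EuclideanSpace ℝ (Fin N)).ofLp)
        (b.sum_repr ⟨_, haS⟩)
      simpa using h1

theorem IsKernelBasis.exists_kink (hN : 0 < N) {p : ℝ} {hp : 0 < p} (hp₁ : 1 / 2 ≤ p)
    (hp₂ : p < 2) {U : Fin (N - 1) → H1 N} (hU : IsKernelBasis N p hp U) :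
    ∃ a : Fin (N - 1) → Fin N → ℝ, (∀ i, ∑ l, a i l = 0) ∧ U = fun i => kink N p hp (a i) := by
  have h : ∀ i, ∃ a : Fin N → ℝ, ∑ l, a l = 0 ∧ U i = kink N p hp a := fun i => by
    rw [← mem_kernelSet_iff hN hp hp₁ hp₂, ← hU.span_eq]
    exact Submodule.subset_span (mem_range_self i)
  choose a ha hU using h
  exact ⟨a, ha, funext hU⟩

theorem sum_sum_smul_eq_zero {a : Fin (N - 1) → Fin N → ℝ} (ha : ∀ i, ∑ l, a i l = 0)
    (c : Fin (N - 1) → ℝ) : ∑ l, (∑ i, c i • a i) l = 0 := by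
  simp only [Finset.sum_apply, Pi.smul_apply]
  rw [Finset.sum_comm]
  refine Finset.sum_eq_zero fun i _ => ?_
  rw [← Finset.smul_sum, ha, smul_zero]

/-- A vector with zero sum whose cubes do not sum to zero. -/
theorem exists_sum_eq_zero_sum_cube_neg (hN : 3 ≤ N) :
    ∃ a : Fin N → ℝ, ∑ l, a l = 0 ∧ ∑ l, a l ^ 3 = -6 := by
  obtain ⟨n, rfl⟩ := Nat.exists_eq_add_of_le' hN
  -- Three edges are needed: for N = 2 zero sum forces the cubes to cancel.
  refine ⟨Fin.cons 1 (Fin.cons 1 (Fin.cons (-2) fun _ => 0)), ?_, ?_⟩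
  · simp [Fin.sum_univ_succ]
    norm_num
  · simp [Fin.sum_univ_succ]
    norm_num

/-- The cubic form is not identically zero. -/
theorem IsKernelBasis.exists_cubicM_ne_zero (hN : 3 ≤ N) {p : ℝ} {hp : 0 < p} (hp₁ : 1 / 2 ≤ p)
    (hp₂ : p < 2) {U : Fin (N - 1) → H1 N} (hU : IsKernelBasis N p hp U) :
    ∃ c : EuclideanSpace ℝ (Fin (N - 1)), 0 < cubicM p U c := by
  have hN0 : 0 < N := by omega
  obtain ⟨v, hv0, hv3⟩ := exists_sum_eq_zero_sum_cube_neg hN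
  have hv : kink N p hp v ∈ (Submodule.span ℝ (range U) : Set (H1 N)) := by
    rw [hU.span_eq, mem_kernelSet_iff hN0 hp hp₁ hp₂]
    exact ⟨v, hv0, rfl⟩
  obtain ⟨c, hc⟩ := (Submodule.mem_span_range_iff_exists_fun ℝ).1 hv
  obtain ⟨a, -, rfl⟩ := hU.exists_kink hN0 hp₁ hp₂
  rw [sum_smul_kink] at hc
  have e := kink_inj p hp hc
  refine ⟨WithLp.toLp 2 c, ?_⟩
  rw [cubicM_kink]
  simp only
  rw [e, hv3]
  have := cubicIntegral_pos hp
  have h : 0 < p * (p + 1) * (2 * p + 1) * cubicIntegral p := by positivity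
  linarith

theorem cubicM_smul (p t : ℝ) (U : Fin (N - 1) → H1 N) (c : EuclideanSpace ℝ (Fin (N - 1))) :
    cubicM p U (t • c) = t ^ 3 * cubicM p U c := by
  simp only [cubicM, PiLp.smul_apply, smul_eq_mul, Finset.mul_sum]
  refine Finset.sum_congr rfl fun i _ => Finset.sum_congr rfl fun j _ =>
    Finset.sum_congr rfl fun k _ => Finset.sum_congr rfl fun l _ => ?_
  ring

/-- The action along kernel directions, up to quartic errors. -/
theorem action_kink_sign (hN : 3 ≤ N) {p : ℝ} (hp : 0 < p) : ∀ ε > 0,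
    (∃ V ∈ constrained N p hp, ‖V‖ < ε ∧ action p (Phi N p hp) < action p (Phi N p hp + V)) ∧
    ∃ V ∈ constrained N p hp, ‖V‖ < ε ∧ action p (Phi N p hp + V) < action p (Phi N p hp) := by
  intro ε hε
  obtain ⟨v, hv0, hv3⟩ := exists_sum_eq_zero_sum_cube_neg hN
  obtain ⟨B, hB, δ, hδ, hexp⟩ := remainder_kink_expansion (N := N) hp
  set L := ∑ j, |v j| with hL
  have hL0 : 0 ≤ L := Finset.sum_nonneg fun _ _ => abs_nonneg _
  have hvL : ∀ j, |v j| ≤ L := fun j =>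
    Finset.single_le_sum (f := fun j => |v j|) (fun _ _ => abs_nonneg _) (Finset.mem_univ j)
  have hJ := cubicIntegral_pos hp
  -- The factor 4 is (-2/3)·(-6), with -6 the sum of the cubes of v.
  have hf : ∀ t : ℝ, |t| ≤ δ / (L + 1) → |remainder p (kink N p hp (t • v)) -
      t ^ 3 * (4 * (p * (p + 1) * (2 * p + 1) * cubicIntegral p))| ≤
      B * (∑ j, v j ^ 4) * t ^ 4 := by
    intro t ht
    rw [le_div_iff₀ (by positivity)] at ht
    have h := hexp (t • v) fun j => by
      rw [Pi.smul_apply, smul_eq_mul, abs_mul]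
      refine le_trans (mul_le_mul_of_nonneg_left ?_ (abs_nonneg t)) ht
      linarith [hvL j]
    simp only [Pi.smul_apply, smul_eq_mul, mul_pow, ← Finset.mul_sum] at h
    rw [hv3] at h
    convert h using 1
    · congr 1
      ring
    · ring
  set n := ‖kink N p hp v‖ with hn
  have hn0 : 0 ≤ n := norm_nonneg _
  obtain ⟨t, ht0, htε, h1, h2⟩ := exists_pos_neg_of_cubic (by positivity) (by positivity) hf
    (show 0 < ε / (n + 1) by positivity)
  rw [lt_div_iff₀ (by positivity)] at htε
  have hV : ∀ s : ℝ, |s| = t → kink N p hp (s • v) ∈ constrained N p hp ∧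
      ‖kink N p hp (s • v)‖ < ε ∧ action p (Phi N p hp + kink N p hp (s • v)) =
        action p (Phi N p hp) + remainder p (kink N p hp (s • v)) := by
    intro s hs
    have hs0 : ∑ j, (s • v) j = 0 := by
      simp only [Pi.smul_apply, ← Finset.smul_sum, hv0, smul_zero]
    refine ⟨(kink_mem_constrained_iff p hp _).2 hs0, ?_, ?_⟩
    · rw [kink_smul, norm_smul, Real.norm_eq_abs, hs, ← hn]
      linarith
    · rw [action_expansion, quadForm_kink p hp hs0, add_zero]
  obtain ⟨a1, a2, a3⟩ := hV t (abs_of_pos ht0)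
  obtain ⟨b1, b2, b3⟩ := hV (-t) (by rw [abs_neg, abs_of_pos ht0])
  exact ⟨⟨_, a1, a2, by rw [a3]; linarith⟩, ⟨_, b1, b2, by rw [b3]; linarith⟩⟩

theorem isNonlinearSaddle (hN : 3 ≤ N) {p : ℝ} (hp : 0 < p) (hp₁ : 1 / 2 ≤ p) (hp₂ : p < 2) :
    IsNonlinearSaddle N p hp where
  critical := hasFDerivAt_action hp hp₁
  nonneg V hV := by
    rw [secondVariation_eq hp hp₁]
    have := quadForm_nonneg (by omega) hp hp₂ hV
    linarith
  above ε hε := (action_kink_sign hN hp ε hε).1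
  below ε hε := (action_kink_sign hN hp ε hε).2

/-- The Lyapunov–Schmidt reduction onto `X_c`. -/
theorem IsKernelBasis.reduction (hN : 0 < N) {p : ℝ} {hp : 0 < p} (hp₁ : 1 / 2 ≤ p)
    (hp₂ : p < 2) {U : Fin (N - 1) → H1 N} (hU : IsKernelBasis N p hp U) :
    ∃ r > 0, ∃ δ > 0, ∃ A > 0, ∃ B, ∀ c : EuclideanSpace ℝ (Fin (N - 1)), ‖c‖ ≤ δ →
      (∃ W : H1 N, IsMinimizer p hp r U c W ∧ (∀ W', IsMinimizer p hp r U c W' → W' = W) ∧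
        ‖W‖ ≤ A * ‖c‖ ^ 2) ∧ |reducedM p hp r U c - cubicM p U c| ≤ B * ‖c‖ ^ 4 := by
  have := completeSpace_H1 hN
  obtain ⟨κ, hκ, hcoer⟩ := quadForm_coercive hN hp hp₂
  obtain ⟨C, hC, hrem⟩ := remainder_estimates (N := N) hp hp₁
  have hS : ∀ W ∈ complementSubmodule N p hp, κ * ‖W‖ ^ 2 ≤ quadForm p W := fun W hW =>
    hcoer W hW.1 fun a ha => hW.2 _ ((mem_kernelSet_iff hN hp hp₁ hp₂).2 ⟨a, ha, rfl⟩)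
  obtain ⟨r, hr, A, hA, hred⟩ := exists_reduction (complementSubmodule N p hp)
    (isClosed_complement N p hp) hκ hC one_pos (continuous_quadForm p)
    (quadForm_parallelogram p) hS (fun ρ hρ V W hV hW => (hrem ρ hρ V W hV hW).1)
    fun ρ hρ V W hV hW => (hrem ρ hρ V W hV hW).2
  obtain ⟨a, ha, rfl⟩ := hU.exists_kink hN hp₁ hp₂
  obtain ⟨B, hB, δ, hδ, hexp⟩ := remainder_kink_expansion (N := N) hp
  set K := (∑ i, ‖kink N p hp (a i)‖) + 1 with hK
  have hK0 : 0 < K := add_pos_of_nonneg_of_pos (Finset.sum_nonneg fun _ _ => norm_nonneg _) one_pos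
  set L := (∑ l, ∑ i, |a i l|) + 1 with hL
  have hL0 : 0 < L := add_pos_of_nonneg_of_pos
    (Finset.sum_nonneg fun _ _ => Finset.sum_nonneg fun _ _ => abs_nonneg _) one_pos
  have hci : ∀ (c : EuclideanSpace ℝ (Fin (N - 1))) i, |c i| ≤ ‖c‖ := fun c i =>
    PiLp.norm_apply_le c i
  have hu : ∀ c : EuclideanSpace ℝ (Fin (N - 1)),
      ‖kink N p hp (∑ i, c i • a i)‖ ≤ K * ‖c‖ := by
    intro c
    rw [← sum_smul_kink, hK, add_mul, Finset.sum_mul]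
    refine (norm_sum_le _ _).trans (le_add_of_le_of_nonneg (Finset.sum_le_sum fun i _ => ?_)
      (by positivity))
    rw [norm_smul, mul_comm]
    exact mul_le_mul_of_nonneg_left (hci c i) (norm_nonneg _)
  have hal : ∀ (c : EuclideanSpace ℝ (Fin (N - 1))) l, |(∑ i, c i • a i) l| ≤ L * ‖c‖ := by
    intro c l
    have h1 : |(∑ i, c i • a i) l| ≤ (∑ i, |a i l|) * ‖c‖ := by
      rw [Finset.sum_apply, Finset.sum_mul]
      refine (Finset.abs_sum_le_sum_abs _ _).trans (Finset.sum_le_sum fun i _ => ?_)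
      rw [Pi.smul_apply, smul_eq_mul, abs_mul, mul_comm]
      exact mul_le_mul_of_nonneg_left (hci c i) (abs_nonneg _)
    have h2 := Finset.single_le_sum (f := fun l => ∑ i, |a i l|)
      (fun l _ => Finset.sum_nonneg fun i _ => abs_nonneg (a i l)) (Finset.mem_univ l)
    refine h1.trans (mul_le_mul_of_nonneg_right ?_ (norm_nonneg c))
    rw [hL]
    linarith
  -- r/K keeps the kernel part u within the radius of the reduction, and δ/L keeps its amplitudes
  -- within the range of the cubic expansion.
  refine ⟨r, hr, min (r / K) (δ / L), by positivity, A * K ^ 2, by positivity,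
    A * K ^ 4 + B * (N * L ^ 4), fun c hc => ?_⟩
  have hc1 : K * ‖c‖ ≤ r := by
    have := (le_div_iff₀ hK0).1 (hc.trans (min_le_left _ _))
    linarith
  have hc2 : L * ‖c‖ ≤ δ := by
    have := (le_div_iff₀ hL0).1 (hc.trans (min_le_right _ _))
    linarith
  set u := kink N p hp (∑ i, c i • a i) with hu'
  -- The kernel part drops out of the quadratic form, so the objective is Q(W) + R(u + W), as the
  -- abstract reduction requires.
  have hobj : objective p hp (fun i => kink N p hp (a i)) c =
      fun W => quadForm p W + remainder p (u + W) := by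
    funext W
    rw [objective, sum_smul_kink, add_assoc, action_expansion,
      quadForm_kink_add p hp (sum_sum_smul_eq_zero ha c)]
    ring
  obtain ⟨W, hWm, hWmin, hWu, hWn, hWv⟩ := hred u ((hu c).trans hc1)
  have hn2 : ‖u‖ ^ 2 ≤ K ^ 2 * ‖c‖ ^ 2 := by
    rw [← mul_pow]; exact pow_le_pow_left₀ (norm_nonneg u) (hu c) 2
  have hn4 : ‖u‖ ^ 4 ≤ K ^ 4 * ‖c‖ ^ 4 := by
    rw [← mul_pow]; exact pow_le_pow_left₀ (norm_nonneg u) (hu c) 4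
  refine ⟨⟨W, ⟨hWm, by rw [hobj]; exact hWmin⟩, fun W' hW' => hWu W' hW'.1 ?_, ?_⟩, ?_⟩
  · have := hW'.2
    rwa [hobj] at this
  · refine hWn.trans ((mul_le_mul_of_nonneg_left hn2 hA.le).trans (le_of_eq (by ring)))
  · have hM : reducedM p hp r (fun i => kink N p hp (a i)) c =
        quadForm p W + remainder p (u + W) := by
      rw [reducedM, hobj]
      refine IsLeast.csInf_eq ⟨mem_image_of_mem _ hWm, ?_⟩
      rintro _ ⟨W', hW', rfl⟩
      exact hWmin hW'
    rw [hM, cubicM_kink]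
    have h1 := hexp _ fun l => (hal c l).trans hc2
    have h2 : ∑ l, (∑ i, c i • a i) l ^ 4 ≤ N * L ^ 4 * ‖c‖ ^ 4 := by
      refine (Finset.sum_le_card_nsmul _ _ (L ^ 4 * ‖c‖ ^ 4) fun l _ => ?_).trans (le_of_eq ?_)
      · rw [← mul_pow, ← Even.pow_abs (by decide : Even 4)]
        exact pow_le_pow_left₀ (abs_nonneg _) (hal c l) 4
      · rw [Finset.card_univ, Fintype.card_fin, nsmul_eq_mul]
        ring
    have h3 := mul_le_mul_of_nonneg_left h2 hB.le
    have h4 := mul_le_mul_of_nonneg_left hn4 hA.le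
    -- M - M₀ splits as (M - R(u)) + (R(u) - M₀): the first is quartic by the reduction, the second
    -- by the binomial expansion.
    have h5 := abs_add_le (quadForm p W + remainder p (u + W) - remainder p u)
      (remainder p u - -(2 / 3) * p * (p + 1) * (2 * p + 1) *
        ((∑ l, (∑ i, c i • a i) l ^ 3) * cubicIntegral p))
    rw [sub_add_sub_cancel] at h5
    linarith

end StarGraph

end

/-! ### The theorem -/

theorem theorem2 (N : ℕ) (hN : 3 ≤ N) (p : ℝ) (hp : 0 < p) (hp₁ : 1 / 2 ≤ p) (hp₂ : p < 2) :
    (∃ U : Fin (N - 1) → StarGraph.H1 N, StarGraph.IsKernelBasis N p hp U) ∧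
    (∀ U : Fin (N - 1) → StarGraph.H1 N, StarGraph.IsKernelBasis N p hp U →
      ∃ r > 0, ∃ δ > 0, ∃ A > 0,
        (∀ c : EuclideanSpace ℝ (Fin (N - 1)), ‖c‖ ≤ δ →
          ∃ W : StarGraph.H1 N, StarGraph.IsMinimizer p hp r U c W ∧
            (∀ W' : StarGraph.H1 N, StarGraph.IsMinimizer p hp r U c W' → W' = W) ∧
            ‖W‖ ≤ A * ‖c‖ ^ 2) ∧
        ((fun c : EuclideanSpace ℝ (Fin (N - 1)) =>
            StarGraph.reducedM p hp r U c - StarGraph.cubicM p U c)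
          =o[𝓝 0] fun c => ‖c‖ ^ 3) ∧
        (∃ c : EuclideanSpace ℝ (Fin (N - 1)), StarGraph.cubicM p U c ≠ 0) ∧
        (∀ ε > 0, ∃ c₁ c₂ : EuclideanSpace ℝ (Fin (N - 1)), ‖c₁‖ < ε ∧ ‖c₂‖ < ε ∧
          0 < StarGraph.reducedM p hp r U c₁ ∧ StarGraph.reducedM p hp r U c₂ < 0)) ∧
    StarGraph.IsNonlinearSaddle N p hp := by
  have hN0 : 0 < N := by omega
  refine ⟨StarGraph.exists_isKernelBasis hN0 hp hp₁ hp₂, fun U hU => ?_,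
    StarGraph.isNonlinearSaddle hN hp hp₁ hp₂⟩
  obtain ⟨r, hr, δ, hδ, A, hA, B, h⟩ := hU.reduction hN0 hp₁ hp₂
  obtain ⟨c, hc⟩ := hU.exists_cubicM_ne_zero hN hp₁ hp₂
  refine ⟨r, hr, δ, hδ, A, hA, fun c hc => (h c hc).1, ?_, ⟨c, hc.ne'⟩, fun ε hε => ?_⟩
  · have hO : (fun c : EuclideanSpace ℝ (Fin (N - 1)) =>
        StarGraph.reducedM p hp r U c - StarGraph.cubicM p U c) =O[𝓝 0] fun c => ‖c‖ ^ 4 := by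
      refine Asymptotics.IsBigO.of_bound B ?_
      filter_upwards [Metric.closedBall_mem_nhds (0 : EuclideanSpace ℝ (Fin (N - 1))) hδ]
        with c hc
      rw [Real.norm_eq_abs, Real.norm_of_nonneg (by positivity)]
      exact (h c (mem_closedBall_zero_iff.1 hc)).2
    refine hO.trans_isLittleO ?_
    exact (Asymptotics.isLittleO_pow_pow (𝕜 := ℝ) (show 3 < 4 by norm_num)).comp_tendsto
      tendsto_norm_zero
  · have hf : ∀ t : ℝ, |t| ≤ δ / (‖c‖ + 1) →
        |StarGraph.reducedM p hp r U (t • c) - t ^ 3 * StarGraph.cubicM p U c| ≤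
          B * ‖c‖ ^ 4 * t ^ 4 := by
      intro t ht
      rw [le_div_iff₀ (by positivity)] at ht
      have h1 := (h (t • c) (by
        rw [norm_smul, Real.norm_eq_abs]
        linarith [abs_nonneg t])).2
      rw [StarGraph.cubicM_smul, norm_smul, mul_pow, Real.norm_eq_abs,
        Even.pow_abs (by decide)] at h1
      linarith
    obtain ⟨t, ht0, htε, h1, h2⟩ := exists_pos_neg_of_cubic
      (f := fun t : ℝ => StarGraph.reducedM p hp r U (t • c)) hc (by positivity) hf
      (show 0 < ε / (‖c‖ + 1) by positivity)
    rw [lt_div_iff₀ (by positivity)] at htε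
    refine ⟨t • c, (-t) • c, ?_, ?_, h1, h2⟩
    · rw [norm_smul, Real.norm_eq_abs, abs_of_pos ht0]
      linarith
    · rw [norm_smul, Real.norm_eq_abs, abs_neg, abs_of_pos ht0]
      linarith
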